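/- Let $\gamma>0$ and let $G$ be a probability distribution on $[0,1]$. (a) Let $T$ be a homogeneous Poisson point process on $\mathbb R$ with rate $\gamma$. Divide each interval $I=(x,y)$ between consecutive points of $T$ by the point $x+b_I(y-x)$, where the proportions $b_I$ are i.i.d. with distribution $G$ and independent of $T$ (the intervals being labelled as $I_k=(T_k,T_{k+1})$, $k\in\mathbb Z$, with $\dots<T_{-1}<T_0\le 0<T_1<\dots$ the points of $T$, and $b_{I_k}=b_k$). Let $\Psi_G T$ be the set of all division points. Then $\Psi_G T$ has the same distribution as $T$ (as a point process) if and only if $G=\mathrm{Beta}(r,1-r)$ for some $0<r<1$, or $G$ is one of the degenerate distributions $\delta_0$, $\delta_1$. (b) Let $\tau=(\tau_k)_{k\in\mathbb Z}$ be i.i.d. with the exponential distribution $\Gamma(1,\gamma)$ (the interpoint distances of the process under its Palm distribution), let $(b_k)_{k\in\mathbb Z}$ be i.i.d. with distribution $G$ and independent of $\tau$, and put $\tau'_k=(1-b_k)\tau_k+b_{k+1}\tau_{k+1}$. Then $(\tau'_k)_{k\in\mathbb Z}$ has the same distribution as $(\tau_k)_{k\in\mathbb Z}$ if and only if $G=\mathrm{Beta}(r,1-r)$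 for some $0<r<1$, or $G\in\{\delta_0,\delta_1\}$. In particular, the distributions $\mathrm{Beta}(r,1-r)$, $0<r<1$, are exactly the non-degenerate division distributions that preserve the homogeneous Poisson process. -/

import Mathlib

open MeasureTheory ProbabilityTheory Set

/-- The counting measure `∑_{x ∈ S} δ_x` of a set of points `S ⊆ ℝ`. A random set of points is
regarded as a random element of `Measure ℝ`, whose σ-algebra is generated by the evaluations
`N ↦ N B` at the Borel sets `B`; the law of a point process is its law on this space. -/
noncomputable def pointMeasure (S : Set ℝ) : Measure ℝ :=
  Measure.count.restrict S

/-- `T` is a homogeneous Poisson point process on `ℝ` with rate `γ` under `P`: a random locally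
finite set of points such that the number of points in a Borel set `B` of finite Lebesgue measure
has the Poisson law with mean `γ |B|`, and such that the numbers of points in pairwise disjoint
Borel sets are independent. -/
structure IsHomogeneousPoisson {Ω : Type*} [MeasurableSpace Ω] (γ : ℝ) (T : Ω → Set ℝ)
    (P : Measure Ω) : Prop where
  locallyFinite : ∀ ω x y, (T ω ∩ Icc x y).Finite
  measurable : Measurable fun ω => pointMeasure (T ω)
  hasLaw_count : ∀ B : Set ℝ, MeasurableSet B → volume B ≠ ⊤ →
    HasLaw (fun ω => pointMeasure (T ω) B)
      ((poissonMeasure (γ * volume.real B).toNNReal).map (fun n : ℕ => (n : ENNReal))) P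
  indep_count : ∀ (n : ℕ) (B : Fin n → Set ℝ), (∀ i, MeasurableSet (B i)) →
    (∀ i, volume (B i) ≠ ⊤) → Pairwise (fun i j => Disjoint (B i) (B j)) →
    iIndepFun (fun i ω => pointMeasure (T ω) (B i)) P

/-- The index of a point `x` of a locally finite set `S`, when the points of `S` are enumerated
increasingly so that `… < x₋₁ < x₀ ≤ 0 < x₁ < x₂ < …`. The interval between `x` and the next point
of `S` on its right gets the same index. -/
noncomputable def pointIndex (S : Set ℝ) (x : ℝ) : ℤ :=
  ((S ∩ Ioc 0 x).ncard : ℤ) - ((S ∩ Ioc x 0).ncard : ℤ)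

/-- The neighbour-dependent shift of a locally finite set `S`: each interval `(x, y)` between
consecutive points of `S` contributes the point that divides it in the proportion `β k`, where `k`
is the index of the interval. -/
def neighbourShift (β : ℤ → ℝ) (S : Set ℝ) : Set ℝ :=
  {z | ∃ x ∈ S, ∃ y ∈ S, x < y ∧ S ∩ Ioo x y = ∅ ∧ z = x + β (pointIndex S x) * (y - x)}

/-- The exchange operator on sequences of interval lengths, with division proportions `β`. -/
def exchange (β t : ℤ → ℝ) : ℤ → ℝ :=
  fun k => (1 - β k) * t k + β (k + 1) * t (k + 1)

/-! ### The exponential distribution -/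

/-! Split the interval of length `τ_k` into `Y_k = b_k τ_k` and `X_k = (1 - b_k) τ_k`. The new gaps
are `τ'_k = X_k + Y_{k+1}`, while `τ_k = X_k + Y_k`.

Sufficiency for gaps. If `X_k` and `Y_k` are independent, shifting all the `Y`s by one leaves the
joint law of the two families unchanged, so `τ'` has the law of `τ` (`map_exchange_of_prod`). The
parts are independent for `Beta(r, 1 - r)` by the beta-gamma identity (`map_split_betaMeasure`), and
for `δ₀`, `δ₁` because one part vanishes.

Necessity for gaps. The variables `τ'_{-1} = X_{-1} + Y_0` and `τ'_0 = X_0 + Y_1` share only the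
interval with index 0. Their independence forces `E[Y_0^n X_0] = E[Y_0^n] E[X_0]`, by induction on
`n` (`integral_pow_mul_eq_of_uncorrelated`). As `τ_0` is exponential and independent of `b_0`, this
says that the moments of `G` satisfy `(n + 1) m_{n+1} = (n + m_1) m_n`. On the unit interval this
recursion determines `G` from its mean `r = m_1`: it is `Beta(r, 1 - r)` for `0 < r < 1`, and a
point mass at 0 or 1 otherwise.

The point process. Let `M` be the infinite measure `pointsLaw` on labelled sequences: the point with
index 0 is spread as `γ` times Lebesgue measure, the gaps are independent exponentials. `M` is
invariant under relabelling, `centred` is a fundamental domain of mass one, and the enumerated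
Poisson process has law `M` restricted to it (`IsHomogeneousPoisson.map_pointAt`, by comparing
probabilities of ordered boxes). Division translates the point with index 0 and exchanges the gaps
(`divide_pointsOf`); the translation is absorbed by Lebesgue measure, so `M` with independent marks
is carried to the analogous measure whose gap law is that of `τ'`. Unfolding over the fundamental
domain (`setLIntegral_tsum_comp`) passes between the process and `M`. Hence invariance of the gap
law gives invariance of the process. Conversely, the gap law is recovered from the process as its
Palm distribution, by summing a functional of the gaps over the points in `(0, 1]`. This requires
that division points do not coincide, which follows from equality of intensities
(`ae_strictMono_divide`). -/

lemma gammaMeasure_one_eq_withDensity {γ : ℝ} :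
    gammaMeasure 1 γ =
      (volume.restrict (Ioi 0)).withDensity fun x => ENNReal.ofReal (γ * Real.exp (-(γ * x))) := by
  rw [← withDensity_indicator measurableSet_Ioi, gammaMeasure]
  apply withDensity_congr_ae
  have h0 : ∀ᵐ x : ℝ, x ≠ 0 := by simp [ae_iff]
  filter_upwards [h0] with x hx
  rcases lt_or_gt_of_ne hx with h | h
  · rw [gammaPDF_of_neg h, indicator_of_notMem (by simpa using h.le)]
  · rw [gammaPDF_of_nonneg h.le, indicator_of_mem (by simpa using h)]
    simp

lemma lintegral_gammaMeasure_one {γ : ℝ} {f : ℝ → ENNReal} (hf : Measurable f) :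
    ∫⁻ x, f x ∂(gammaMeasure 1 γ) =
      ∫⁻ x in Ioi 0, ENNReal.ofReal (γ * Real.exp (-(γ * x))) * f x := by
  rw [gammaMeasure_one_eq_withDensity, lintegral_withDensity_eq_lintegral_mul _ (by fun_prop) hf]
  rfl

lemma gammaMeasure_one_ae_pos {γ : ℝ} : ∀ᵐ x ∂(gammaMeasure 1 γ), 0 < x := by
  rw [gammaMeasure_one_eq_withDensity]
  exact (withDensity_absolutelyContinuous _ _).ae_le (ae_restrict_mem measurableSet_Ioi)

lemma integral_gammaMeasure_one {γ : ℝ} (hγ : 0 < γ) (f : ℝ → ℝ) :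
    ∫ x, f x ∂(gammaMeasure 1 γ) = ∫ x in Ioi 0, γ * Real.exp (-(γ * x)) * f x := by
  rw [gammaMeasure_one_eq_withDensity, integral_withDensity_eq_integral_toReal_smul (by fun_prop)
    (by simp)]
  refine integral_congr_ae (ae_of_all _ fun x => ?_)
  simp only [smul_eq_mul]
  rw [ENNReal.toReal_ofReal (by positivity)]

lemma integral_pow_gammaMeasure_one {γ : ℝ} (hγ : 0 < γ) (n : ℕ) :
    ∫ x, x ^ n ∂(gammaMeasure 1 γ) = n.factorial / γ ^ n := by
  rw [integral_gammaMeasure_one hγ]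
  have h := Real.integral_rpow_mul_exp_neg_mul_Ioi (a := n + 1) (r := γ) (by positivity) hγ
  rw [Real.Gamma_nat_eq_factorial] at h
  have : ∀ x ∈ Ioi (0 : ℝ), γ * Real.exp (-(γ * x)) * x ^ n
      = γ * (x ^ ((n : ℝ) + 1 - 1) * Real.exp (-(γ * x))) := by
    intro x _
    rw [add_sub_cancel_right, Real.rpow_natCast]; ring
  rw [setIntegral_congr_fun measurableSet_Ioi this, integral_const_mul, h]
  norm_cast
  rw [one_div, inv_pow, pow_succ]
  field_simp

lemma integrable_pow_gammaMeasure_one {γ : ℝ} (hγ : 0 < γ) (n : ℕ) :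
    Integrable (fun x => x ^ n) (gammaMeasure 1 γ) := by
  apply Integrable.of_integral_ne_zero
  rw [integral_pow_gammaMeasure_one hγ]
  positivity

/-- This form of the moment formula does not mention `γ`: the rate enters only through the mean,
which later cancels. -/
lemma integral_pow_succ_gammaMeasure_one {γ : ℝ} (hγ : 0 < γ) (n : ℕ) :
    ∫ x, x ^ (n + 1) ∂(gammaMeasure 1 γ) =
      (n + 1) * (∫ x, x ^ n ∂(gammaMeasure 1 γ)) * ∫ x, x ∂(gammaMeasure 1 γ) := by
  have h1 := integral_pow_gammaMeasure_one hγ 1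
  simp only [pow_one] at h1
  rw [h1, integral_pow_gammaMeasure_one hγ, integral_pow_gammaMeasure_one hγ, Nat.factorial_succ]
  push_cast
  rw [Nat.factorial_one, pow_succ]
  field_simp
  simp

/-! ### Pairs of independent sequences -/

section Pairs

variable {ι : Type*} (μ ν : Measure ℝ) [IsProbabilityMeasure μ] [IsProbabilityMeasure ν]

/-- A pair of independent sequences is one product measure over `ι × Bool`. Currying with `Bool`
outside gives the pair; currying with `ι` outside, as in the next lemma, gives the sequence of
pairs. -/
lemma map_infinitePi_prod_bool :
    (Measure.infinitePi fun p : ι × Bool => if p.2 then ν else μ).map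
        (fun w => ((fun k => w (k, false)), (fun k => w (k, true)))) =
      (Measure.infinitePi fun _ : ι => μ).prod (Measure.infinitePi fun _ : ι => ν) := by
  have e1 : (Measure.infinitePi fun p : Bool × ι => if p.1 then ν else μ) =
      (Measure.infinitePi fun p : ι × Bool => if p.2 then ν else μ).map
        (fun w p => w (p.2, p.1)) := by
    rw [Measure.map_infinitePi_infinitePi_of_inj (f := fun p : Bool × ι => (p.2, p.1))]
    intro p q h
    simpa [Prod.ext_iff, and_comm] using h
  have e2 := Measure.infinitePi_map_curry (ι := Bool) (κ := ι) (X := ℝ)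
    (fun i _ => if i then ν else μ)
  have e3 := Measure.infinitePi_map_eval_prod
    (P := fun i : Bool => Measure.infinitePi fun _ : ι => if i then ν else μ)
    (i := false) (j := true) (by simp)
  simp only [Bool.false_eq_true, if_false, if_true] at e3
  rw [← e3, ← e2, e1, Measure.map_map (by fun_prop) (by fun_prop),
    Measure.map_map (by fun_prop) (by fun_prop)]
  rfl

lemma iIndepFun_prodMk_infinitePi :
    iIndepFun (fun (k : ι) (ω : (ι → ℝ) × (ι → ℝ)) => (ω.1 k, ω.2 k))
      ((Measure.infinitePi fun _ : ι => μ).prod (Measure.infinitePi fun _ : ι => ν)) := by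
  have h1 : iIndepFun (fun (k : ι) (w : ι × Bool → ℝ) => (fun i => w (k, i) : Bool → ℝ))
      (Measure.infinitePi fun p : ι × Bool => if p.2 then ν else μ) := by
    rw [iIndepFun_iff_map_fun_eq_infinitePi_map (by fun_prop)]
    have e2 := Measure.infinitePi_map_curry (ι := ι) (κ := Bool) (X := ℝ)
      (fun _ i => if i then ν else μ)
    refine e2.trans ?_
    congr 1
    funext k
    rw [Measure.map_infinitePi_infinitePi_of_inj (f := fun i : Bool => (k, i))]
    intro i j h
    simpa using h
  have h2 := h1.comp (fun _ x => (x false, x true)) (by fun_prop)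
  rw [iIndepFun_iff_map_fun_eq_infinitePi_map (by fun_prop)] at h2 ⊢
  rw [← map_infinitePi_prod_bool, Measure.map_map (by fun_prop) (by fun_prop)]
  refine h2.trans ?_
  congr 1
  funext k
  rw [Measure.map_map (by fun_prop) (by fun_prop)]
  rfl

lemma map_prodMk_infinitePi (k : ι) :
    ((Measure.infinitePi fun _ : ι => μ).prod (Measure.infinitePi fun _ : ι => ν)).map
      (fun ω => (ω.1 k, ω.2 k)) = μ.prod ν := by
  have := Measure.map_prod_map (Measure.infinitePi fun _ : ι => μ)
    (Measure.infinitePi fun _ : ι => ν) (f := fun ω => ω k) (g := fun ω => ω k)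
    (by fun_prop) (by fun_prop)
  rw [Measure.infinitePi_map_eval, Measure.infinitePi_map_eval] at this
  rw [this]; rfl

lemma map_zip_infinitePi :
    ((Measure.infinitePi fun _ : ι => μ).prod (Measure.infinitePi fun _ : ι => ν)).map
      (fun ω k => (ω.1 k, ω.2 k)) = Measure.infinitePi fun _ : ι => μ.prod ν := by
  rw [(iIndepFun_prodMk_infinitePi μ ν).map_fun_eq_infinitePi_map (by fun_prop)]
  simp_rw [map_prodMk_infinitePi]

end Pairs

/-! ### The exchange operator on an i.i.d. sequence -/

/-- If the two parts of each interval are independent, then exchanging them preserves the law of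
the sequence of interval lengths. -/
lemma map_exchange_of_prod {ε G μ ν : Measure ℝ} [IsProbabilityMeasure ε] [IsProbabilityMeasure G]
    [IsProbabilityMeasure μ] [IsProbabilityMeasure ν]
    (h : (ε.prod G).map (fun p => ((1 - p.2) * p.1, p.2 * p.1)) = μ.prod ν) :
    ((Measure.infinitePi fun _ : ℤ => ε).prod (Measure.infinitePi fun _ : ℤ => G)).map
      (fun ω => exchange ω.2 ω.1) = Measure.infinitePi fun _ : ℤ => ε := by
  have hXY : ((Measure.infinitePi fun _ : ℤ => ε).prod (Measure.infinitePi fun _ : ℤ => G)).map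
      (fun ω k => ((1 - ω.2 k) * ω.1 k, ω.2 k * ω.1 k)) =
      ((Measure.infinitePi fun _ : ℤ => μ).prod (Measure.infinitePi fun _ : ℤ => ν)).map
        (fun ω k => (ω.1 k, ω.2 k)) := by
    rw [map_zip_infinitePi, ← h,
      ← Measure.infinitePi_map_pi (X := fun _ : ℤ => ℝ × ℝ) (fun _ => ε.prod G) (by fun_prop),
      ← map_zip_infinitePi, Measure.map_map (by fun_prop) (by fun_prop)]
    rfl
  -- Only the second family is shifted. This is harmless because, by `hXY`, the two families of
  -- parts are independent of each other and each is i.i.d.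
  have hshift : (Measure.infinitePi fun _ : ℤ => ν).map (fun y k => y (k + 1)) =
      Measure.infinitePi fun _ : ℤ => ν :=
    Measure.map_infinitePi_infinitePi_of_inj (f := fun k : ℤ => k + 1) (add_left_injective 1)
  have hprod := Measure.map_prod_map (Measure.infinitePi fun _ : ℤ => μ)
    (Measure.infinitePi fun _ : ℤ => ν) (f := id) (g := fun y k => y (k + 1))
    (by fun_prop) (by fun_prop)
  rw [hshift, Measure.map_id] at hprod
  have hsum : ((Measure.infinitePi fun _ : ℤ => ε).prod (Measure.infinitePi fun _ : ℤ => G)).map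
      (fun ω => ω.1) = Measure.infinitePi fun _ : ℤ => ε := by
    simp
  calc _ = (((Measure.infinitePi fun _ : ℤ => ε).prod (Measure.infinitePi fun _ : ℤ => G)).map
      (fun ω k => ((1 - ω.2 k) * ω.1 k, ω.2 k * ω.1 k))).map
        (fun w k => (w k).1 + (w (k + 1)).2) := by
        rw [Measure.map_map (by fun_prop) (by fun_prop)]; rfl
    _ = ((Measure.infinitePi fun _ : ℤ => μ).prod (Measure.infinitePi fun _ : ℤ => ν)).map
        (fun ω k => ω.1 k + ω.2 k) := by
        rw [hXY, Measure.map_map (by fun_prop) (by fun_prop)]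
        conv_rhs => rw [hprod, Measure.map_map (by fun_prop) (by fun_prop)]
        rfl
    _ = (((Measure.infinitePi fun _ : ℤ => ε).prod (Measure.infinitePi fun _ : ℤ => G)).map
      (fun ω k => ((1 - ω.2 k) * ω.1 k, ω.2 k * ω.1 k))).map
        (fun w k => (w k).1 + (w k).2) := by
        rw [hXY, Measure.map_map (by fun_prop) (by fun_prop)]; rfl
    _ = _ := by
        rw [Measure.map_map (by fun_prop) (by fun_prop)]
        rw [← hsum]
        congr 1
        · funext ω k
          simp only [Function.comp]
          ring
        · rw [hsum]

/-- A covariance identity: if `X + B` is uncorrelated with all powers of `A + Y`, where `A`,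
`(X, Y)` and `B` are independent, then `X` is uncorrelated with all powers of `Y`. -/
lemma integral_pow_mul_eq_of_uncorrelated {Ω : Type*} [MeasurableSpace Ω] {P : Measure Ω}
    [IsProbabilityMeasure P] {A X Y B : Ω → ℝ}
    (hA : Measurable A) (hX : Measurable X) (hY : Measurable Y) (hB : Measurable B)
    (hAXY : IndepFun A (fun ω => (X ω, Y ω)) P) (hBAY : IndepFun B (fun ω => (A ω, Y ω)) P)
    (iA : ∀ n : ℕ, Integrable (fun ω => A ω ^ n) P) (iY : ∀ n : ℕ, Integrable (fun ω => Y ω ^ n) P)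
    (iYX : ∀ n : ℕ, Integrable (fun ω => Y ω ^ n * X ω) P) (iB : Integrable B P)
    (h : ∀ n : ℕ, ∫ ω, (A ω + Y ω) ^ n * (X ω + B ω) ∂P =
      (∫ ω, (A ω + Y ω) ^ n ∂P) * ∫ ω, X ω + B ω ∂P) (n : ℕ) :
    ∫ ω, Y ω ^ n * X ω ∂P = (∫ ω, Y ω ^ n ∂P) * ∫ ω, X ω ∂P := by
  have iX : Integrable X P := by simpa using iYX 0
  have indAY : ∀ m i : ℕ, IndepFun (fun ω => A ω ^ m) (fun ω => Y ω ^ i) P := fun m i =>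
    hAXY.comp (φ := fun a => a ^ m) (ψ := fun p : ℝ × ℝ => p.2 ^ i) (by fun_prop) (by fun_prop)
  have indAYX : ∀ m i : ℕ, IndepFun (fun ω => A ω ^ m) (fun ω => Y ω ^ i * X ω) P := fun m i =>
    hAXY.comp (φ := fun a => a ^ m) (ψ := fun p : ℝ × ℝ => p.2 ^ i * p.1)
      (by fun_prop) (by fun_prop)
  have iAY : ∀ m i : ℕ, Integrable (fun ω => A ω ^ m * Y ω ^ i) P := fun m i =>
    (indAY m i).integrable_mul (iA m) (iY i)
  have iAYX : ∀ m i : ℕ, Integrable (fun ω => A ω ^ m * (Y ω ^ i * X ω)) P := fun m i =>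
    (indAYX m i).integrable_mul (iA m) (iYX i)
  have eAY : ∀ m i : ℕ, ∫ ω, A ω ^ m * Y ω ^ i ∂P = (∫ ω, A ω ^ m ∂P) * ∫ ω, Y ω ^ i ∂P :=
    fun m i => (indAY m i).integral_fun_mul_eq_mul_integral (by fun_prop) (by fun_prop)
  have eAYX : ∀ m i : ℕ, ∫ ω, A ω ^ m * (Y ω ^ i * X ω) ∂P =
      (∫ ω, A ω ^ m ∂P) * ∫ ω, Y ω ^ i * X ω ∂P :=
    fun m i => (indAYX m i).integral_fun_mul_eq_mul_integral (by fun_prop) (by fun_prop)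
  have iS : ∀ n : ℕ, Integrable (fun ω => (A ω + Y ω) ^ n) P := by
    intro n
    simp_rw [add_pow]
    exact integrable_finsetSum _ fun m _ => (iAY m _).mul_const _
  have expX : ∀ (n : ℕ) (ω : Ω), (A ω + Y ω) ^ n * X ω =
      ∑ m ∈ Finset.range (n + 1), A ω ^ m * (Y ω ^ (n - m) * X ω) * (n.choose m : ℝ) := by
    intro n ω
    rw [add_pow, Finset.sum_mul]
    refine Finset.sum_congr rfl fun m _ => by ring
  have iSX : ∀ n : ℕ, Integrable (fun ω => (A ω + Y ω) ^ n * X ω) P := by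
    intro n
    simp_rw [expX]
    exact integrable_finsetSum _ fun m _ => (iAYX m _).mul_const _
  have indSB : ∀ n : ℕ, IndepFun (fun ω => (A ω + Y ω) ^ n) B P := fun n =>
    (hBAY.comp (φ := id) (ψ := fun p : ℝ × ℝ => (p.1 + p.2) ^ n) (by fun_prop)
      (by fun_prop)).symm
  have iSB : ∀ n : ℕ, Integrable (fun ω => (A ω + Y ω) ^ n * B ω) P := fun n =>
    (indSB n).integrable_mul (iS n) iB
  have eSB : ∀ n : ℕ, ∫ ω, (A ω + Y ω) ^ n * B ω ∂P =
      (∫ ω, (A ω + Y ω) ^ n ∂P) * ∫ ω, B ω ∂P :=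
    fun n => (indSB n).integral_fun_mul_eq_mul_integral (by fun_prop) (by fun_prop)
  -- `B` is independent of `A + Y`, so its contribution to the covariance vanishes and can be
  -- removed from the hypothesis.
  have key : ∀ n : ℕ, ∫ ω, (A ω + Y ω) ^ n * X ω ∂P =
      (∫ ω, (A ω + Y ω) ^ n ∂P) * ∫ ω, X ω ∂P := by
    intro n
    have := h n
    simp_rw [mul_add] at this
    rw [integral_add (iSX n) (iSB n), eSB, integral_add iX iB] at this
    linarith
  induction n using Nat.strong_induction_on with
  | _ n ih =>
    have hk := key n
    simp_rw [expX] at hk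
    simp_rw [add_pow] at hk
    rw [integral_finsetSum _ fun m _ => (iAYX m _).mul_const _,
      integral_finsetSum _ fun m _ => (iAY m _).mul_const _, Finset.sum_mul] at hk
    simp_rw [integral_mul_const, eAYX, eAY] at hk
    -- The term without a factor of `A` is split off: it alone involves the power `Y ^ n`, and the
    -- induction hypothesis matches all the others.
    rw [Finset.sum_range_succ', Finset.sum_range_succ'] at hk
    have : ∀ m ∈ Finset.range n, (∫ ω, A ω ^ (m + 1) ∂P) *
        (∫ ω, Y ω ^ (n - (m + 1)) * X ω ∂P) * ((n.choose (m + 1) : ℕ) : ℝ) =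
        (∫ ω, A ω ^ (m + 1) ∂P) * (∫ ω, Y ω ^ (n - (m + 1)) ∂P) * ((n.choose (m + 1) : ℕ) : ℝ) *
          ∫ ω, X ω ∂P := by
      intro m hm
      rw [ih (n - (m + 1)) (by have := Finset.mem_range.1 hm; omega)]
      ring
    rw [Finset.sum_congr rfl this] at hk
    simpa using hk

/-! ### Probability measures on the unit interval are determined by their moments -/

/-- Moments give integrals of polynomials, and by Weierstrass these approximate a continuous
function uniformly on the unit interval, which carries both measures. -/
lemma measure_ext_of_moments {G H : Measure ℝ} [IsProbabilityMeasure G] [IsProbabilityMeasure H]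
    (hG : ∀ᵐ x ∂G, x ∈ Icc (0 : ℝ) 1) (hH : ∀ᵐ x ∂H, x ∈ Icc (0 : ℝ) 1)
    (h : ∀ n : ℕ, ∫ x, x ^ n ∂G = ∫ x, x ^ n ∂H) : G = H := by
  have ipow : ∀ (K : Measure ℝ) [IsProbabilityMeasure K], (∀ᵐ x ∂K, x ∈ Icc (0 : ℝ) 1) →
      ∀ n : ℕ, Integrable (fun x => x ^ n) K := by
    intro K _ hK n
    refine Integrable.of_bound (by fun_prop) 1 ?_
    filter_upwards [hK] with x hx
    rw [norm_pow, Real.norm_of_nonneg hx.1]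
    exact pow_le_one₀ hx.1 hx.2
  have ipoly : ∀ (K : Measure ℝ) [IsProbabilityMeasure K], (∀ᵐ x ∂K, x ∈ Icc (0 : ℝ) 1) →
      ∀ p : Polynomial ℝ, Integrable (fun x => p.eval x) K := by
    intro K _ hK p
    simp_rw [Polynomial.eval_eq_sum_range]
    exact integrable_finsetSum _ fun m _ => (ipow K hK m).const_mul _
  have hpoly : ∀ p : Polynomial ℝ, ∫ x, p.eval x ∂G = ∫ x, p.eval x ∂H := by
    intro p
    simp_rw [Polynomial.eval_eq_sum_range]
    rw [integral_finsetSum _ fun m _ => (ipow G hG m).const_mul _,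
      integral_finsetSum _ fun m _ => (ipow H hH m).const_mul _]
    simp_rw [integral_const_mul, h]
  have happrox : ∀ (K : Measure ℝ) [IsProbabilityMeasure K], (∀ᵐ x ∂K, x ∈ Icc (0 : ℝ) 1) →
      ∀ (p : Polynomial ℝ) (f : BoundedContinuousFunction ℝ ℝ) (ε : ℝ),
      (∀ x ∈ Icc (0 : ℝ) 1, |p.eval x - f x| < ε) →
      |∫ x, p.eval x ∂K - ∫ x, f x ∂K| ≤ ε := by
    intro K _ hK p f ε hp
    rw [← integral_sub (ipoly K hK p) (f.integrable K)]
    have := norm_integral_le_of_norm_le_const (μ := K) (f := fun x => p.eval x - f x) (C := ε) (by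
      filter_upwards [hK] with x hx using (hp x hx).le)
    simpa using this
  refine ext_of_forall_integral_eq_of_IsFiniteMeasure fun f => ?_
  refine eq_of_abs_sub_le_all fun ε hε => ?_
  obtain ⟨p, hp⟩ := exists_polynomial_near_of_continuousOn 0 1 f f.continuous.continuousOn (ε / 2)
    (by positivity)
  have h1 := happrox G hG p f _ hp
  have h2 := happrox H hH p f _ hp
  rw [hpoly p] at h1
  rw [abs_le] at *
  constructor <;> linarith [h1.1, h1.2, h2.1, h2.2]

/-- The recursion has a nonzero leading factor and both measures have total mass one, so all moments
agree. -/
lemma measure_ext_of_moment_recursion {G H : Measure ℝ} [IsProbabilityMeasure G]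
    [IsProbabilityMeasure H] (hG : ∀ᵐ x ∂G, x ∈ Icc (0 : ℝ) 1) (hH : ∀ᵐ x ∂H, x ∈ Icc (0 : ℝ) 1)
    (r : ℝ) (recG : ∀ n : ℕ, (n + 1) * ∫ x, x ^ (n + 1) ∂G = (n + r) * ∫ x, x ^ n ∂G)
    (recH : ∀ n : ℕ, (n + 1) * ∫ x, x ^ (n + 1) ∂H = (n + r) * ∫ x, x ^ n ∂H) : G = H := by
  refine measure_ext_of_moments hG hH fun n => ?_
  induction n with
  | zero => simp
  | succ n ih =>
    have h1 := recG n
    rw [ih, ← recH n] at h1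
    exact mul_left_cancel₀ (by positivity) h1

/-! ### Beta distributions -/

lemma betaMeasure_ae_mem_Icc {r s : ℝ} : ∀ᵐ x ∂(betaMeasure r s), x ∈ Icc (0 : ℝ) 1 := by
  have hm : Measurable (betaPDF r s) := (measurable_betaPDFReal r s).ennreal_ofReal
  rw [betaMeasure, ae_withDensity_iff hm]
  refine ae_of_all _ fun x hx => ?_
  by_contra h
  apply hx
  rw [mem_Icc, not_and_or, not_le, not_le] at h
  rcases h with h | h
  · exact betaPDF_eq_zero_of_nonpos h.le
  · exact betaPDF_eq_zero_of_one_le h.le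

lemma betaPDFReal_nonneg {r s : ℝ} (hr : 0 < r) (hs : 0 < s) (x : ℝ) : 0 ≤ betaPDFReal r s x := by
  by_cases h : 0 < x ∧ x < 1
  · exact (betaPDFReal_pos h.1 h.2 hr hs).le
  · rw [betaPDFReal, if_neg h]

lemma integral_betaPDFReal {r s : ℝ} (hr : 0 < r) (hs : 0 < s) : ∫ x, betaPDFReal r s x = 1 := by
  rw [integral_eq_lintegral_of_nonneg_ae (ae_of_all _ (betaPDFReal_nonneg hr hs))
    (measurable_betaPDFReal r s).aestronglyMeasurable]
  change (∫⁻ x, betaPDF r s x).toReal = 1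
  rw [lintegral_betaPDF_eq_one hr hs, ENNReal.toReal_one]

lemma integral_pow_betaMeasure {r s : ℝ} (hr : 0 < r) (hs : 0 < s) (n : ℕ) :
    ∫ x, x ^ n ∂(betaMeasure r s) = beta (r + n) s / beta r s := by
  have hm : Measurable (betaPDF r s) := (measurable_betaPDFReal r s).ennreal_ofReal
  have h2 := beta_pos (α := r + n) (by positivity) hs
  rw [betaMeasure, integral_withDensity_eq_integral_toReal_smul hm (by simp [betaPDF])]
  have : ∀ x : ℝ, (betaPDF r s x).toReal • x ^ n =
      beta (r + n) s / beta r s * betaPDFReal (r + n) s x := by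
    intro x
    rw [betaPDF, ENNReal.toReal_ofReal (betaPDFReal_nonneg hr hs x), smul_eq_mul, betaPDFReal,
      betaPDFReal]
    split_ifs with h
    · rw [show r + n - 1 = r - 1 + n by ring, Real.rpow_add_natCast h.1.ne']
      field_simp
    · simp
  simp_rw [this]
  rw [integral_const_mul, integral_betaPDFReal (by positivity) hs, mul_one]

/-- Since the parameters add up to 1, the denominators of the two beta values are `Γ(n + 2)` and
`Γ(n + 1)`; the functional equation of `Γ` gives the ratio. -/
lemma integral_pow_succ_betaMeasure {r : ℝ} (hr : r ∈ Ioo (0 : ℝ) 1) (n : ℕ) :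
    (n + 1) * ∫ x, x ^ (n + 1) ∂(betaMeasure r (1 - r)) =
      (n + r) * ∫ x, x ^ n ∂(betaMeasure r (1 - r)) := by
  have hs : 0 < 1 - r := by linarith [hr.2]
  have hrn : 0 < r + n := by have := hr.1; positivity
  rw [integral_pow_betaMeasure hr.1 hs, integral_pow_betaMeasure hr.1 hs]
  have e : (n + 1) * beta (r + (n + 1 : ℕ)) (1 - r) = (n + r) * beta (r + n) (1 - r) := by
    rw [beta, beta]
    push_cast
    rw [← add_assoc, Real.Gamma_add_one hrn.ne', show r + n + 1 + (1 - r) = (n + 1 : ℝ) + 1 by ring,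
      show r + n + (1 - r) = (n + 1 : ℝ) by ring, Real.Gamma_add_one (by positivity)]
    have := (Real.Gamma_pos_of_pos (show (0 : ℝ) < n + 1 by positivity)).ne'
    field_simp
    ring
  rw [← mul_div_assoc, ← mul_div_assoc, e]

/-- The substitution `b = y / τ` replaces the proportion by the length of the part it cuts from an
interval of length `τ`. -/
lemma lintegral_eq_mul_lintegral_div {τ : ℝ} (hτ : 0 < τ) {F : ℝ → ENNReal} (hF : Measurable F) :
    ∫⁻ b, F b = ENNReal.ofReal τ⁻¹ * ∫⁻ y, F (y / τ) := by
  conv_lhs => rw [← Real.smul_map_volume_mul_left (inv_ne_zero hτ.ne')]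
  rw [lintegral_smul_measure, lintegral_map hF (by fun_prop), abs_of_pos (by positivity),
    smul_eq_mul]
  simp_rw [div_eq_inv_mul]

/-- The beta-gamma identity for densities. -/
lemma gammaPDF_mul_gammaPDF {γ r x y : ℝ} (hγ : 0 < γ) (hr : r ∈ Ioo (0 : ℝ) 1) (hx : x ≠ 0)
    (hy : y ≠ 0) :
    gammaPDF (1 - r) γ x * gammaPDF r γ y =
      if 0 < x + y then ENNReal.ofReal (γ * Real.exp (-(γ * (x + y)))) *
        (ENNReal.ofReal (x + y)⁻¹ * betaPDF r (1 - r) (y / (x + y))) else 0 := by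
  have hs : 0 < 1 - r := by linarith [hr.2]
  by_cases hpos : 0 < x ∧ 0 < y
  · obtain ⟨hx, hy⟩ := hpos
    have hxy : 0 < x + y := by positivity
    rw [if_pos hxy, gammaPDF_of_nonneg hx.le, gammaPDF_of_nonneg hy.le,
      betaPDF_of_pos_lt_one (by positivity) (by rw [div_lt_one hxy]; linarith),
      ← ENNReal.ofReal_mul (by positivity), ← ENNReal.ofReal_mul (by positivity),
      ← ENNReal.ofReal_mul (by positivity)]
    · congr 1
      have e1 : 1 - y / (x + y) = x / (x + y) := by field_simp; ring
      rw [beta, show r + (1 - r) = 1 by ring, Real.Gamma_one, e1, Real.div_rpow hy.le hxy.le,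
        Real.div_rpow hx.le hxy.le, show -(γ * (x + y)) = -(γ * x) + -(γ * y) by ring, Real.exp_add]
      -- Here `r + (1 - r) = 1` is essential: the powers of `x + y` coming from the beta density
      -- cancel the Jacobian `(x + y)⁻¹`.
      have e2 : (x + y) ^ (r - 1) * (x + y) ^ (1 - r - 1) = (x + y)⁻¹ := by
        rw [← Real.rpow_add hxy, ← Real.rpow_neg_one]; congr 1; ring
      have e3 : γ ^ (1 - r) * γ ^ r = γ := by
        rw [← Real.rpow_add hγ]; simp
      calc _ = (γ ^ (1 - r) * γ ^ r) * (1 / (Real.Gamma r * Real.Gamma (1 - r)) *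
            x ^ (1 - r - 1) * y ^ (r - 1)) * (Real.exp (-(γ * x)) * Real.exp (-(γ * y))) := by
            field_simp
        _ = γ * (1 / (Real.Gamma r * Real.Gamma (1 - r)) *
            x ^ (1 - r - 1) * y ^ (r - 1)) * (Real.exp (-(γ * x)) * Real.exp (-(γ * y))) *
            ((x + y)⁻¹ * ((x + y) ^ (r - 1) * (x + y) ^ (1 - r - 1))⁻¹) := by
            rw [e3, e2, inv_inv, inv_mul_cancel₀ hxy.ne', mul_one]
        _ = _ := by field_simp
  · have hl : gammaPDF (1 - r) γ x * gammaPDF r γ y = 0 := by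
      rcases lt_or_gt_of_ne hx with h | h
      · rw [gammaPDF_of_neg h, zero_mul]
      · have : y < 0 := lt_of_le_of_ne (by by_contra h'; exact hpos ⟨h, not_le.1 h'⟩) hy
        rw [gammaPDF_of_neg this, mul_zero]
    rw [hl]
    split_ifs with hxy
    · have : betaPDF r (1 - r) (y / (x + y)) = 0 := by
        rcases lt_or_ge y 0 with h | h
        · exact betaPDF_eq_zero_of_nonpos (div_nonpos_of_nonpos_of_nonneg h.le hxy.le)
        · refine betaPDF_eq_zero_of_one_le ?_
          rw [le_div_iff₀ hxy]
          have : ¬ 0 < x := fun h' => hpos ⟨h', lt_of_le_of_ne h hy.symm⟩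
          linarith
      rw [this, mul_zero, mul_zero]
    · rfl

/-- Splitting an exponential length in proportions with law `Beta(r, 1 - r)` gives independent
gamma-distributed parts. -/
lemma map_split_betaMeasure {γ r : ℝ} (hγ : 0 < γ) (hr : r ∈ Ioo (0 : ℝ) 1) :
    ((gammaMeasure 1 γ).prod (betaMeasure r (1 - r))).map
      (fun p => ((1 - p.2) * p.1, p.2 * p.1)) =
      (gammaMeasure (1 - r) γ).prod (gammaMeasure r γ) := by
  have hs : 0 < 1 - r := by linarith [hr.2]
  have := isProbabilityMeasureBeta hr.1 hs
  have := isProbabilityMeasure_gammaMeasure hr.1 hγ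
  have := isProbabilityMeasure_gammaMeasure hs hγ
  have := isProbabilityMeasure_gammaMeasure one_pos hγ
  have hb : Measurable (betaPDF r (1 - r)) := (measurable_betaPDFReal r _).ennreal_ofReal
  have hg : ∀ a, Measurable (gammaPDF a γ) := fun a => (measurable_gammaPDFReal a γ).ennreal_ofReal
  refine Measure.ext_of_lintegral _ fun f hf => ?_
  -- The joint density of the total length `t` and its part `y`, the other part being `t - y`.
  set K : ℝ → ℝ → ENNReal := fun t y => if 0 < t then ENNReal.ofReal (γ * Real.exp (-(γ * t))) *
        (ENNReal.ofReal t⁻¹ * betaPDF r (1 - r) (y / t)) else 0 with hK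
  have mK : Measurable (Function.uncurry K) := by
    refine Measurable.ite (measurableSet_lt measurable_const measurable_fst) ?_ measurable_const
    exact Measurable.mul (by fun_prop) (Measurable.mul (by fun_prop)
      (hb.comp (measurable_snd.div measurable_fst)))
  have hL : ∫⁻ p, f p ∂((gammaMeasure 1 γ).prod (betaMeasure r (1 - r))).map
      (fun p => ((1 - p.2) * p.1, p.2 * p.1)) = ∫⁻ t, ∫⁻ y, K t y * f (t - y, y) := by
    have mf2 : Measurable fun t => ∫⁻ y, f ((1 - y) * t, y * t) ∂(betaMeasure r (1 - r)) :=
      Measurable.lintegral_prod_right' (f := fun p : ℝ × ℝ => f ((1 - p.2) * p.1, p.2 * p.1))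
        (by fun_prop)
    rw [lintegral_map hf (by fun_prop), lintegral_prod _ (by fun_prop)]
    refine (lintegral_gammaMeasure_one mf2).trans ?_
    rw [← lintegral_indicator measurableSet_Ioi]
    refine lintegral_congr fun t => ?_
    by_cases ht : 0 < t
    · rw [indicator_of_mem (by simpa using ht), betaMeasure,
        lintegral_withDensity_eq_lintegral_mul _ hb (by fun_prop),
        lintegral_eq_mul_lintegral_div ht (by fun_prop),
        ← lintegral_const_mul _ (by fun_prop), ← lintegral_const_mul _ (by fun_prop)]
      refine lintegral_congr fun y => ?_
      simp only [hK, if_pos ht, Pi.mul_apply]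
      rw [show (1 - y / t) * t = t - y by field_simp, div_mul_cancel₀ _ ht.ne']
      ring
    · rw [indicator_of_notMem (by simpa using ht)]
      simp [hK, if_neg ht]
  have hR : ∫⁻ p, f p ∂(gammaMeasure (1 - r) γ).prod (gammaMeasure r γ) =
      ∫⁻ y, ∫⁻ x, gammaPDF (1 - r) γ x * gammaPDF r γ y * f (x, y) := by
    rw [lintegral_prod_symm' _ hf, gammaMeasure, gammaMeasure,
      lintegral_withDensity_eq_lintegral_mul _ (hg _) (Measurable.lintegral_prod_left' hf)]
    refine lintegral_congr fun y => ?_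
    simp only [Pi.mul_apply]
    rw [lintegral_withDensity_eq_lintegral_mul _ (hg _) (by fun_prop),
      ← lintegral_const_mul _ (by have := hg (1 - r); fun_prop)]
    refine lintegral_congr fun x => ?_
    simp only [Pi.mul_apply]
    ring
  rw [hL, hR, lintegral_lintegral_swap]
  · have h0 : ∀ᵐ x : ℝ, x ≠ 0 := by simp [ae_iff]
    refine lintegral_congr_ae ?_
    filter_upwards [h0] with y hy
    -- Substitution `t = x + y`, after which the beta-gamma identity applies pointwise off the axes.
    rw [← lintegral_add_right_eq_self (fun t => K t y * f (t - y, y)) y]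
    refine lintegral_congr_ae ?_
    filter_upwards [h0] with x hx
    rw [gammaPDF_mul_gammaPDF hγ hr hx hy, add_sub_cancel_right]
  · refine (mK.mul (hf.comp ?_)).aemeasurable
    fun_prop

lemma map_split_dirac_zero (ε : Measure ℝ) [IsProbabilityMeasure ε] :
    (ε.prod (Measure.dirac 0)).map (fun p => ((1 - p.2) * p.1, p.2 * p.1)) =
      ε.prod (Measure.dirac 0) := by
  rw [Measure.prod_dirac, Measure.map_map (by fun_prop) (by fun_prop)]
  congr 1
  funext x
  simp

lemma map_split_dirac_one (ε : Measure ℝ) [IsProbabilityMeasure ε] :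
    (ε.prod (Measure.dirac 1)).map (fun p => ((1 - p.2) * p.1, p.2 * p.1)) =
      (Measure.dirac 0).prod ε := by
  rw [Measure.prod_dirac, Measure.dirac_prod, Measure.map_map (by fun_prop) (by fun_prop)]
  congr 1
  funext x
  simp

/-! ### Division proportions that preserve an i.i.d. exponential sequence -/

/-- If a fraction of an exponential length is uncorrelated with all powers of the complementary
part, then the moments of the proportion satisfy the recursion of a beta distribution. -/
lemma moment_recursion_of_uncorrelated {γ : ℝ} (hγ : 0 < γ) {G : Measure ℝ}
    [IsProbabilityMeasure G] (hG : ∀ᵐ x ∂G, x ∈ Icc (0 : ℝ) 1)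
    (h : ∀ n : ℕ, ∫ p, (p.2 * p.1) ^ n * ((1 - p.2) * p.1) ∂((gammaMeasure 1 γ).prod G) =
      (∫ p, (p.2 * p.1) ^ n ∂((gammaMeasure 1 γ).prod G)) *
        ∫ p, (1 - p.2) * p.1 ∂((gammaMeasure 1 γ).prod G)) (n : ℕ) :
    (n + 1) * ∫ x, x ^ (n + 1) ∂G = (n + ∫ x, x ∂G) * ∫ x, x ^ n ∂G := by
  have := isProbabilityMeasure_gammaMeasure one_pos hγ
  have ipow : ∀ n : ℕ, Integrable (fun x => x ^ n) G := by
    intro n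
    refine Integrable.of_bound (by fun_prop) 1 ?_
    filter_upwards [hG] with x hx
    rw [norm_pow, Real.norm_of_nonneg hx.1]
    exact pow_le_one₀ hx.1 hx.2
  have i1 : Integrable (fun x => x) G := by simpa using ipow 1
  have e1 : ∫ p, (p.2 * p.1) ^ n * ((1 - p.2) * p.1) ∂((gammaMeasure 1 γ).prod G) =
      (∫ x, x ^ (n + 1) ∂(gammaMeasure 1 γ)) * ∫ x, x ^ n - x ^ (n + 1) ∂G := by
    rw [← integral_prod_mul]
    refine integral_congr_ae (ae_of_all _ fun p => ?_)
    ring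
  have e2 : ∫ p, (p.2 * p.1) ^ n ∂((gammaMeasure 1 γ).prod G) =
      (∫ x, x ^ n ∂(gammaMeasure 1 γ)) * ∫ x, x ^ n ∂G := by
    rw [← integral_prod_mul]
    refine integral_congr_ae (ae_of_all _ fun p => ?_)
    ring
  have e3 : ∫ p, (1 - p.2) * p.1 ∂((gammaMeasure 1 γ).prod G) =
      (∫ x, x ∂(gammaMeasure 1 γ)) * ∫ x, 1 - x ∂G := by
    rw [← integral_prod_mul]
    refine integral_congr_ae (ae_of_all _ fun p => ?_)
    ring
  have hn := h n
  rw [e1, e2, e3, integral_pow_succ_gammaMeasure_one hγ, integral_sub (ipow n) (ipow (n + 1)),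
    integral_sub (integrable_const 1) i1] at hn
  simp only [integral_const, probReal_univ, smul_eq_mul, mul_one] at hn
  have p1 : 0 < ∫ x, x ^ n ∂(gammaMeasure 1 γ) := by
    rw [integral_pow_gammaMeasure_one hγ]; positivity
  have p2 : 0 < ∫ x, x ∂(gammaMeasure 1 γ) := by
    have := integral_pow_gammaMeasure_one hγ 1
    simp only [pow_one] at this
    rw [this]; positivity
  -- Both sides carry the factor `E[τ^n] E[τ] > 0`, which leaves a relation between moments of `G`
  -- only.
  have := mul_left_cancel₀ (mul_pos p1 p2).ne' (show ((∫ x, x ^ n ∂(gammaMeasure 1 γ)) *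
    ∫ x, x ∂(gammaMeasure 1 γ)) * ((n + 1) * ((∫ x, x ^ n ∂G) - ∫ x, x ^ (n + 1) ∂G)) =
    ((∫ x, x ^ n ∂(gammaMeasure 1 γ)) *
    ∫ x, x ∂(gammaMeasure 1 γ)) * ((∫ x, x ^ n ∂G) * (1 - ∫ x, x ∂G)) by linear_combination hn)
  linarith

/-- The candidate is chosen by the mean of `G`, which lies in `[0, 1]`; it satisfies the same
recursion with the same parameter, the mean 0 and the mean 1 giving the point masses. -/
lemma eq_beta_or_dirac_of_moment_recursion {G : Measure ℝ} [IsProbabilityMeasure G]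
    (hG : ∀ᵐ x ∂G, x ∈ Icc (0 : ℝ) 1)
    (h : ∀ n : ℕ, (n + 1) * ∫ x, x ^ (n + 1) ∂G = (n + ∫ x, x ∂G) * ∫ x, x ^ n ∂G) :
    G = Measure.dirac 0 ∨ G = Measure.dirac 1 ∨
      ∃ r ∈ Ioo (0 : ℝ) 1, G = betaMeasure r (1 - r) := by
  have i1 : Integrable (fun x => x) G := by
    refine Integrable.of_bound (by fun_prop) 1 ?_
    filter_upwards [hG] with x hx
    rw [Real.norm_of_nonneg hx.1]
    exact hx.2
  have h0 : 0 ≤ ∫ x, x ∂G := integral_nonneg_of_ae (by filter_upwards [hG] with x hx using hx.1)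
  have h1 : ∫ x, x ∂G ≤ 1 := by
    have := integral_mono_ae i1 (integrable_const 1) (by filter_upwards [hG] with x hx using hx.2)
    simpa using this
  rcases h0.eq_or_lt with h0 | h0
  · left
    refine measure_ext_of_moment_recursion hG (by simp [ae_dirac_eq]) _ h fun n => ?_
    rw [← h0]
    rcases n with _ | n <;> simp
  rcases h1.eq_or_lt with h1 | h1
  · right; left
    refine measure_ext_of_moment_recursion hG (by simp [ae_dirac_eq]) _ h fun n => ?_
    rw [h1]
    simp
  · right; right
    have := isProbabilityMeasureBeta h0 (sub_pos.2 h1)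
    exact ⟨_, ⟨h0, h1⟩, measure_ext_of_moment_recursion hG betaMeasure_ae_mem_Icc _ h
      (integral_pow_succ_betaMeasure ⟨h0, h1⟩)⟩

/-- The covariance identity is applied to the exchanged gaps with indices -1 and 0. They are `A + Y`
and `X + B`, where `(X, Y)` are the parts of interval 0 while `A` and `B` come from intervals -1 and
1. -/
lemma integral_split_of_map_exchange {γ : ℝ} (hγ : 0 < γ) {G : Measure ℝ}
    [IsProbabilityMeasure G] (hG : ∀ᵐ x ∂G, x ∈ Icc (0 : ℝ) 1)
    (h : ((Measure.infinitePi fun _ : ℤ => gammaMeasure 1 γ).prod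
        (Measure.infinitePi fun _ : ℤ => G)).map (fun ω => exchange ω.2 ω.1) =
      Measure.infinitePi fun _ : ℤ => gammaMeasure 1 γ) (n : ℕ) :
    ∫ p, (p.2 * p.1) ^ n * ((1 - p.2) * p.1) ∂((gammaMeasure 1 γ).prod G) =
      (∫ p, (p.2 * p.1) ^ n ∂((gammaMeasure 1 γ).prod G)) *
        ∫ p, (1 - p.2) * p.1 ∂((gammaMeasure 1 γ).prod G) := by
  have := isProbabilityMeasure_gammaMeasure one_pos hγ
  set ε := gammaMeasure 1 γ
  set Q := (Measure.infinitePi fun _ : ℤ => ε).prod (Measure.infinitePi fun _ : ℤ => G)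
  have ind := iIndepFun_prodMk_infinitePi (ι := ℤ) ε G
  have law : ∀ k : ℤ, Q.map (fun ω => (ω.1 k, ω.2 k)) = ε.prod G := map_prodMk_infinitePi ε G
  have mp : ∀ k : ℤ, Measurable fun ω : (ℤ → ℝ) × (ℤ → ℝ) => (ω.1 k, ω.2 k) := by
    intro k; fun_prop
  have trans : ∀ (k : ℤ) (f : ℝ × ℝ → ℝ), Measurable f →
      ∫ ω, f (ω.1 k, ω.2 k) ∂Q = ∫ p, f p ∂(ε.prod G) := by
    intro k f hf
    rw [← law k, integral_map (mp k).aemeasurable hf.aestronglyMeasurable]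
  have itrans : ∀ (k : ℤ) (f : ℝ × ℝ → ℝ), Measurable f → Integrable f (ε.prod G) →
      Integrable (fun ω => f (ω.1 k, ω.2 k)) Q := by
    intro k f hf hi
    rw [← law k] at hi
    exact (integrable_map_measure hf.aestronglyMeasurable (mp k).aemeasurable).1 hi
  have aep : ∀ᵐ p ∂(ε.prod G), 0 < p.1 ∧ p.2 ∈ Icc (0 : ℝ) 1 := by
    have a1 : ∀ᵐ p ∂(ε.prod G), 0 < p.1 :=
      Measure.quasiMeasurePreserving_fst.ae gammaMeasure_one_ae_pos
    have a2 : ∀ᵐ p ∂(ε.prod G), p.2 ∈ Icc (0 : ℝ) 1 :=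
      Measure.quasiMeasurePreserving_snd.ae hG
    filter_upwards [a1, a2] with p h1 h2 using ⟨h1, h2⟩
  have ipow : ∀ n : ℕ, Integrable (fun p : ℝ × ℝ => p.1 ^ n) (ε.prod G) := by
    intro n
    have := (integrable_pow_gammaMeasure_one hγ n).mul_prod (integrable_const (1 : ℝ) (μ := G))
    simpa using this
  have iY : ∀ n : ℕ, Integrable (fun p : ℝ × ℝ => (p.2 * p.1) ^ n) (ε.prod G) := by
    intro n
    refine (ipow n).mono' (by fun_prop) ?_
    filter_upwards [aep] with p ⟨h1, h2⟩
    rw [norm_pow, Real.norm_of_nonneg (mul_nonneg h2.1 h1.le)]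
    exact pow_le_pow_left₀ (mul_nonneg h2.1 h1.le) (mul_le_of_le_one_left h1.le h2.2) n
  have iX : ∀ n : ℕ, Integrable (fun p : ℝ × ℝ => ((1 - p.2) * p.1) ^ n) (ε.prod G) := by
    intro n
    refine (ipow n).mono' (by fun_prop) ?_
    filter_upwards [aep] with p ⟨h1, h2⟩
    have h3 : 0 ≤ (1 - p.2) * p.1 := mul_nonneg (by linarith [h2.2]) h1.le
    rw [norm_pow, Real.norm_of_nonneg h3]
    exact pow_le_pow_left₀ h3 (mul_le_of_le_one_left h1.le (by linarith [h2.1])) n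
  have iYX : ∀ n : ℕ, Integrable (fun p : ℝ × ℝ => (p.2 * p.1) ^ n * ((1 - p.2) * p.1))
      (ε.prod G) := by
    intro n
    refine (ipow (n + 1)).mono' (by fun_prop) ?_
    filter_upwards [aep] with p ⟨h1, h2⟩
    have h3 : 0 ≤ (1 - p.2) * p.1 := mul_nonneg (by linarith [h2.2]) h1.le
    have h4 : 0 ≤ p.2 * p.1 := mul_nonneg h2.1 h1.le
    rw [Real.norm_of_nonneg (by positivity), pow_succ]
    exact mul_le_mul (pow_le_pow_left₀ h4 (mul_le_of_le_one_left h1.le h2.2) n)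
      (mul_le_of_le_one_left h1.le (by linarith [h2.1])) h3 (by positivity)
  have key := integral_pow_mul_eq_of_uncorrelated (P := Q)
    (A := fun ω => (1 - ω.2 (-1)) * ω.1 (-1)) (X := fun ω => (1 - ω.2 0) * ω.1 0)
    (Y := fun ω => ω.2 0 * ω.1 0) (B := fun ω => ω.2 1 * ω.1 1)
    (by fun_prop) (by fun_prop) (by fun_prop) (by fun_prop)
    ((ind.indepFun (i := -1) (j := 0) (by simp)).comp (φ := fun p : ℝ × ℝ => (1 - p.2) * p.1)
      (ψ := fun p : ℝ × ℝ => ((1 - p.2) * p.1, p.2 * p.1)) (by fun_prop) (by fun_prop))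
    ((ind.indepFun_prodMk mp (-1) 0 1 (by simp) (by simp)).symm.comp
      (φ := fun p : ℝ × ℝ => p.2 * p.1)
      (ψ := fun q : (ℝ × ℝ) × (ℝ × ℝ) => ((1 - q.1.2) * q.1.1, q.2.2 * q.2.1))
      (by fun_prop) (by fun_prop))
    (fun n => itrans (-1) _ (by fun_prop) (iX n)) (fun n => itrans 0 _ (by fun_prop) (iY n))
    (fun n => itrans 0 _ (by fun_prop) (iYX n))
    (by simpa using itrans 1 _ (by fun_prop) (iY 1)) ?_ n
  · rw [trans 0 (fun p => (p.2 * p.1) ^ n * ((1 - p.2) * p.1)) (by fun_prop),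
      trans 0 (fun p => (p.2 * p.1) ^ n) (by fun_prop),
      trans 0 (fun p => (1 - p.2) * p.1) (by fun_prop)] at key
    exact key
  · intro n
    have mE : Measurable fun ω : (ℤ → ℝ) × (ℤ → ℝ) => exchange ω.2 ω.1 := by
      unfold exchange; fun_prop
    have tr : ∀ f : (ℤ → ℝ) → ℝ, Measurable f →
        ∫ ω, f (exchange ω.2 ω.1) ∂Q = ∫ t, f t ∂(Measure.infinitePi fun _ : ℤ => ε) := by
      intro f hf
      rw [← h, integral_map mE.aemeasurable hf.aestronglyMeasurable]
    have t1 := tr (fun t => t (-1) ^ n * t 0) (by fun_prop)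
    have t2 := tr (fun t => t (-1) ^ n) (by fun_prop)
    have t3 := tr (fun t => t 0) (by fun_prop)
    have indE : IndepFun (fun t : ℤ → ℝ => t (-1)) (fun t => t 0)
        (Measure.infinitePi fun _ : ℤ => ε) :=
      (iIndepFun_infinitePi (P := fun _ : ℤ => ε) (X := fun _ x => x) (by fun_prop)).indepFun
        (by simp)
    have t4 := (indE.comp (φ := fun x => x ^ n) (ψ := id) (by fun_prop)
      (by fun_prop)).integral_fun_mul_eq_mul_integral
      ((measurable_pi_apply _).pow_const n).aestronglyMeasurable
      (measurable_pi_apply _).aestronglyMeasurable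
    simp only [Function.comp, id] at t4
    rw [t4, ← t2, ← t3] at t1
    simpa [exchange] using t1

/-- Exchanging preserves the law of an i.i.d. exponential sequence if and only if the law of the
division proportions is `Beta(r, 1 - r)` or degenerate at an end point. -/
lemma map_exchange_iff {γ : ℝ} (hγ : 0 < γ) {G : Measure ℝ}
    [IsProbabilityMeasure G] (hG : ∀ᵐ x ∂G, x ∈ Icc (0 : ℝ) 1) :
    ((Measure.infinitePi fun _ : ℤ => gammaMeasure 1 γ).prod
        (Measure.infinitePi fun _ : ℤ => G)).map (fun ω => exchange ω.2 ω.1) =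
      (Measure.infinitePi fun _ : ℤ => gammaMeasure 1 γ) ↔
    G = Measure.dirac 0 ∨ G = Measure.dirac 1 ∨
      ∃ r ∈ Ioo (0 : ℝ) 1, G = betaMeasure r (1 - r) := by
  have := isProbabilityMeasure_gammaMeasure one_pos hγ
  constructor
  · intro h
    exact eq_beta_or_dirac_of_moment_recursion hG
      (moment_recursion_of_uncorrelated hγ hG (integral_split_of_map_exchange hγ hG h))
  · rintro (rfl | rfl | ⟨r, hr, rfl⟩)
    · exact map_exchange_of_prod (map_split_dirac_zero _)
    · exact map_exchange_of_prod (map_split_dirac_one _)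
    · have := isProbabilityMeasure_gammaMeasure hr.1 hγ
      have := isProbabilityMeasure_gammaMeasure (sub_pos.2 hr.2) hγ
      exact map_exchange_of_prod (map_split_betaMeasure hγ hr)

/-! ### Enumerations of sets of points -/

/-- A strictly increasing two-sided sequence that is unbounded in both directions. -/
structure BiInfinite (t : ℤ → ℝ) : Prop where
  strictMono : StrictMono t
  exists_lt : ∀ x, ∃ k, t k < x
  exists_gt : ∀ x, ∃ k, x < t k

/-- The sequences whose interval with index `0` contains the origin. -/
def centred : Set (ℤ → ℝ) := {t | t 0 ≤ 0 ∧ 0 < t 1}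

lemma measurableSet_centred : MeasurableSet centred :=
  (measurableSet_le (measurable_pi_apply 0) measurable_const).inter
    (measurableSet_lt measurable_const (measurable_pi_apply 1))

namespace BiInfinite

variable {t : ℤ → ℝ}

lemma comp_add (ht : BiInfinite t) (m : ℤ) : BiInfinite fun k => t (k + m) where
  strictMono := fun i j hij => ht.strictMono (by omega)
  exists_lt := fun x => by
    obtain ⟨k, hk⟩ := ht.exists_lt x
    exact ⟨k - m, by simpa using hk⟩
  exists_gt := fun x => by
    obtain ⟨k, hk⟩ := ht.exists_gt x
    exact ⟨k - m, by simpa using hk⟩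

lemma exists_floor (ht : BiInfinite t) (x : ℝ) : ∃ j, t j ≤ x ∧ x < t (j + 1) := by
  obtain ⟨b, hb⟩ := ht.exists_gt x
  obtain ⟨a, ha⟩ := ht.exists_lt x
  obtain ⟨j, hj, hmax⟩ := Int.exists_greatest_of_bdd (P := fun k => t k ≤ x)
    ⟨b, fun z hz => (ht.strictMono.lt_iff_lt.1 (hz.trans_lt hb)).le⟩ ⟨a, ha.le⟩
  refine ⟨j, hj, ?_⟩
  by_contra h
  have := hmax (j + 1) (not_lt.1 h)
  omega

lemma le_iff_of_floor (ht : BiInfinite t) {x : ℝ} {j k : ℤ} (hj : t j ≤ x) (hj' : x < t (j + 1)) :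
    t k ≤ x ↔ k ≤ j := by
  constructor
  · intro h
    have := ht.strictMono.lt_iff_lt.1 (h.trans_lt hj')
    omega
  · intro h
    exact (ht.strictMono.monotone h).trans hj

/-- The origin lies in exactly one interval `[t j, t (j + 1))`. Thus `centred` is a fundamental
domain for the action of `ℤ` by relabelling. -/
lemma existsUnique_centred (ht : BiInfinite t) : ∃! m : ℤ, (fun k => t (k + m)) ∈ centred := by
  obtain ⟨j, hj, hj'⟩ := ht.exists_floor 0
  refine ⟨j, ⟨by simpa using hj, by simpa [add_comm] using hj'⟩, ?_⟩
  rintro m ⟨h0, h1⟩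
  simp only [zero_add] at h0
  have h2 := (ht.le_iff_of_floor hj hj').1 h0
  have h3 := (ht.le_iff_of_floor (k := 1 + m) hj hj').not.1 (not_le.2 h1)
  omega

lemma pos_iff (ht : BiInfinite t) (h0 : t ∈ centred) (k : ℤ) : 0 < t k ↔ 1 ≤ k := by
  rw [← not_le, ht.le_iff_of_floor (j := 0) h0.1 (by simpa using h0.2)]
  omega

lemma range_inter_Ioc_zero (ht : BiInfinite t) (h0 : t ∈ centred) {x : ℝ} {j : ℤ}
    (hj : t j ≤ x) (hj' : x < t (j + 1)) : range t ∩ Ioc 0 x = t '' Icc 1 j := by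
  ext y
  constructor
  · rintro ⟨⟨k, rfl⟩, hk0, hkx⟩
    exact ⟨k, ⟨(ht.pos_iff h0 k).1 hk0, (ht.le_iff_of_floor hj hj').1 hkx⟩, rfl⟩
  · rintro ⟨k, ⟨h1, h2⟩, rfl⟩
    exact ⟨⟨k, rfl⟩, (ht.pos_iff h0 k).2 h1, (ht.le_iff_of_floor hj hj').2 h2⟩

lemma range_inter_Ioc_zero_right (ht : BiInfinite t) (h0 : t ∈ centred) {x : ℝ} {j : ℤ}
    (hj : t j ≤ x) (hj' : x < t (j + 1)) : range t ∩ Ioc x 0 = t '' Icc (j + 1) 0 := by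
  have e1 : ∀ k, x < t k ↔ j + 1 ≤ k := fun k => by
    rw [← not_le, ht.le_iff_of_floor hj hj']; omega
  have e2 : ∀ k, t k ≤ 0 ↔ k ≤ 0 := fun k =>
    ht.le_iff_of_floor (j := 0) h0.1 (by simpa using h0.2)
  ext y
  constructor
  · rintro ⟨⟨k, rfl⟩, hk0, hkx⟩
    exact ⟨k, ⟨(e1 k).1 hk0, (e2 k).1 hkx⟩, rfl⟩
  · rintro ⟨k, ⟨h1, h2⟩, rfl⟩
    exact ⟨⟨k, rfl⟩, (e1 k).2 h1, (e2 k).2 h2⟩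

lemma encard_image_Icc (ht : BiInfinite t) (a b : ℤ) :
    (t '' Icc a b).encard = (b + 1 - a).toNat := by
  rw [ht.strictMono.injective.encard_image, ← Finset.coe_Icc, Set.encard_coe_eq_coe_finsetCard,
    Int.card_Icc]

/-- For a centred enumeration the intrinsic index of a point is its label, so the interval after `t
k` receives the mark `β k`. -/
lemma pointIndex_eq (ht : BiInfinite t) (h0 : t ∈ centred) (k : ℤ) :
    pointIndex (range t) (t k) = k := by
  have hk : t k < t (k + 1) := ht.strictMono (by omega)
  rw [pointIndex, ht.range_inter_Ioc_zero h0 le_rfl hk, ht.range_inter_Ioc_zero_right h0 le_rfl hk,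
    Set.ncard, Set.ncard, ht.encard_image_Icc, ht.encard_image_Icc, ENat.toNat_natCast, ENat.toNat_natCast]
  omega

lemma neighbourShift_range (ht : BiInfinite t) (h0 : t ∈ centred) (β : ℤ → ℝ) :
    neighbourShift β (range t) = range fun k => t k + β k * (t (k + 1) - t k) := by
  ext z
  constructor
  · rintro ⟨_, ⟨k, rfl⟩, _, ⟨l, rfl⟩, hkl, hempty, rfl⟩
    have hlt := ht.strictMono.lt_iff_lt.1 hkl
    have : l = k + 1 := by
      by_contra hne
      have : t (k + 1) ∈ range t ∩ Ioo (t k) (t l) :=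
        ⟨⟨_, rfl⟩, ht.strictMono (by omega), ht.strictMono (by omega)⟩
      rw [hempty] at this
      exact this
    subst this
    exact ⟨k, by rw [ht.pointIndex_eq h0]⟩
  · rintro ⟨k, rfl⟩
    refine ⟨_, ⟨k, rfl⟩, _, ⟨k + 1, rfl⟩, ht.strictMono (by omega), ?_, by rw [ht.pointIndex_eq h0]⟩
    rw [eq_empty_iff_forall_notMem]
    rintro _ ⟨⟨l, rfl⟩, h1, h2⟩
    have h3 := ht.strictMono.lt_iff_lt.1 h1
    have h4 := ht.strictMono.lt_iff_lt.1 h2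
    omega

end BiInfinite

/-- Every locally finite set of points that is unbounded in both directions can be enumerated. -/
lemma exists_biInfinite_range {S : Set ℝ} (hf : ∀ x y, (S ∩ Icc x y).Finite)
    (hgt : ∀ x, ∃ s ∈ S, x < s) (hlt : ∀ x, ∃ s ∈ S, s < x) :
    ∃ t, BiInfinite t ∧ t ∈ centred ∧ range t = S := by
  have hfin : ∀ a b : S, (Set.Icc a b).Finite := by
    intro a b
    refine Set.Finite.of_finite_image ((hf a b).subset ?_) Subtype.val_injective.injOn
    rintro _ ⟨c, hc, rfl⟩
    exact ⟨c.2, hc⟩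
  -- A nonempty locally finite linear order without end points is order isomorphic to `ℤ`.
  let _ : LocallyFiniteOrder S := LocallyFiniteOrder.ofFiniteIcc hfin
  let _ : SuccOrder S := LinearLocallyFiniteOrder.succOrder S
  let _ : PredOrder S := LinearLocallyFiniteOrder.predOrder S
  have : NoMaxOrder S := ⟨fun a => by
    obtain ⟨s, hs, h⟩ := hgt a
    exact ⟨⟨s, hs⟩, h⟩⟩
  have : NoMinOrder S := ⟨fun a => by
    obtain ⟨s, hs, h⟩ := hlt a
    exact ⟨⟨s, hs⟩, h⟩⟩
  have : Nonempty S := by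
    obtain ⟨s, hs, _⟩ := hgt 0
    exact ⟨⟨s, hs⟩⟩
  let e : S ≃o ℤ := orderIsoIntOfLinearSuccPredArch
  let u : ℤ → ℝ := fun k => e.symm k
  have hu : range u = S := by
    have : u = Subtype.val ∘ e.symm := rfl
    rw [this, range_comp, e.symm.surjective.range_eq, image_univ, Subtype.range_val]
  have hub : BiInfinite u := by
    refine ⟨fun i j hij => e.symm.strictMono hij, fun x => ?_, fun x => ?_⟩
    · obtain ⟨s, hs, h⟩ := hlt x
      exact ⟨e ⟨s, hs⟩, by simpa [u] using h⟩
    · obtain ⟨s, hs, h⟩ := hgt x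
      exact ⟨e ⟨s, hs⟩, by simpa [u] using h⟩
  obtain ⟨m, hm, -⟩ := hub.existsUnique_centred
  refine ⟨_, hub.comp_add m, hm, ?_⟩
  rw [← hu]
  exact (Equiv.addRight m).surjective.range_comp u

/-! ### The counting measure of a sequence of points -/

lemma pointMeasure_apply_of_countable {S B : Set ℝ} (hS : S.Countable) (hB : MeasurableSet B) :
    pointMeasure S B = (S ∩ B).encard := by
  rw [pointMeasure, Measure.restrict_apply hB, inter_comm,
    Measure.count_apply (hS.measurableSet.inter hB)]

lemma pointMeasure_range_apply (t : ℤ → ℝ) {B : Set ℝ} (hB : MeasurableSet B) :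
    pointMeasure (range t) B = (range t ∩ B).encard :=
  pointMeasure_apply_of_countable (countable_range t) hB

lemma pointMeasure_range_comp_add (t : ℤ → ℝ) (m : ℤ) :
    pointMeasure (range fun k => t (k + m)) = pointMeasure (range t) := by
  congr 1
  exact (Equiv.addRight m).surjective.range_comp t

lemma encard_eq_tsum_indicator {ι : Type*} (A : Set ι) :
    (A.encard : ENNReal) = ∑' k, A.indicator 1 k := by
  rw [← tsum_subtype]
  simp

/-- A sequence may visit a point repeatedly. Each point is counted at the index with the smallest
code among those visiting it, which exhibits the count as a measurable function of the sequence. -/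
lemma pointMeasure_range_eq_tsum (z : ℤ → ℝ) {B : Set ℝ} (hB : MeasurableSet B) :
    pointMeasure (range z) B = ∑' k : ℤ,
      {z : ℤ → ℝ | z k ∈ B ∧ ∀ j, Encodable.encode j < Encodable.encode k → z j ≠ z k}.indicator
        1 z := by
  set A : Set ℤ := {k | z k ∈ B ∧ ∀ j, Encodable.encode j < Encodable.encode k → z j ≠ z k}
  have himg : range z ∩ B = z '' A := by
    ext y
    constructor
    · rintro ⟨⟨k, rfl⟩, hk⟩
      obtain ⟨m, hm, hmin⟩ := WellFounded.has_min (measure (Encodable.encode : ℤ → ℕ)).wf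
        {j | z j = z k} ⟨k, rfl⟩
      have hm' : z m = z k := hm
      refine ⟨m, ⟨by rwa [hm'], fun j hj hjm => hmin j (hjm.trans hm') hj⟩, hm'⟩
    · rintro ⟨k, hk, rfl⟩
      exact ⟨⟨k, rfl⟩, hk.1⟩
  have hinj : InjOn z A := by
    intro i hi j hj hij
    rcases lt_trichotomy (Encodable.encode i) (Encodable.encode j) with h | h | h
    · exact absurd hij (hj.2 i h)
    · exact Encodable.encode_injective h
    · exact absurd hij.symm (hi.2 j h)
  rw [pointMeasure_range_apply z hB, himg, hinj.encard_image, encard_eq_tsum_indicator]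
  rfl

lemma measurable_pointMeasure_range : Measurable fun z : ℤ → ℝ => pointMeasure (range z) := by
  refine Measure.measurable_of_measurable_coe _ fun B hB => ?_
  simp_rw [pointMeasure_range_eq_tsum _ hB]
  refine Measurable.tsum fun k => measurable_one.indicator ?_
  have h : {z : ℤ → ℝ | ∀ j, Encodable.encode j < Encodable.encode k → z j ≠ z k} =
      ⋂ j : ℤ, ⋂ _ : Encodable.encode j < Encodable.encode k, {z | z j = z k}ᶜ := by
    ext z; simp
  have h' : MeasurableSet (⋂ j : ℤ, ⋂ _ : Encodable.encode j < Encodable.encode k,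
      {z : ℤ → ℝ | z j = z k}ᶜ) :=
    MeasurableSet.iInter fun j => MeasurableSet.iInter fun _ =>
      (measurableSet_eq_fun (measurable_pi_apply j) (measurable_pi_apply k)).compl
  rw [← h] at h'
  exact (measurable_pi_apply k hB).inter h'

/-- The position of the point with index `k` of a counting measure. -/
noncomputable def pointAt (N : Measure ℝ) (k : ℤ) : ℝ :=
  open scoped Classical in
  (⨅ q : ℚ, if (k.toNat : ENNReal) ≤ N (Ioc 0 (q : ℝ)) ∧ N (Ioc (q : ℝ) 0) ≤ (-k).toNat then
    ((q : ℝ) : EReal) else ⊤).toReal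

lemma measurable_pointAt : Measurable pointAt := by
  refine measurable_pi_lambda _ fun k => ?_
  refine measurable_ereal_toReal.comp (Measurable.iInf fun q => ?_)
  refine Measurable.ite ?_ measurable_const measurable_const
  exact (measurableSet_le measurable_const (Measure.measurable_coe measurableSet_Ioc)).inter
    (measurableSet_le (Measure.measurable_coe measurableSet_Ioc) measurable_const)

/-- For rational `q`, the relation `t k ≤ q` can be read off from the counts: at least `k` points in
`(0, q]` if `k` is positive, at most `-k` points in `(q, 0]` otherwise. The infimum of such `q` is
`t k`. So the labelled points are a measurable function of the counting measure. -/
lemma BiInfinite.pointAt_pointMeasure {t : ℤ → ℝ} (ht : BiInfinite t) (h0 : t ∈ centred) :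
    pointAt (pointMeasure (range t)) = t := by
  classical
  funext k
  have key : ∀ q : ℚ, ((k.toNat : ENNReal) ≤ pointMeasure (range t) (Ioc 0 (q : ℝ)) ∧
      pointMeasure (range t) (Ioc (q : ℝ) 0) ≤ (-k).toNat) ↔ t k ≤ q := by
    intro q
    obtain ⟨j, hj, hj'⟩ := ht.exists_floor q
    rw [pointMeasure_range_apply t measurableSet_Ioc, pointMeasure_range_apply t measurableSet_Ioc,
      ht.range_inter_Ioc_zero h0 hj hj', ht.range_inter_Ioc_zero_right h0 hj hj',
      ht.encard_image_Icc, ht.encard_image_Icc, ht.le_iff_of_floor hj hj']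
    simp only [ENat.toENNReal_coe, Nat.cast_le]
    omega
  simp only [pointAt, key]
  have : (⨅ q : ℚ, if t k ≤ q then ((q : ℝ) : EReal) else ⊤) = (t k : EReal) := by
    apply le_antisymm
    · refine le_of_forall_gt fun c hc => ?_
      obtain ⟨y, hy1, hy2⟩ := EReal.lt_iff_exists_real_btwn.1 hc
      obtain ⟨q, hq1, hq2⟩ := exists_rat_btwn (EReal.coe_lt_coe_iff.1 hy1)
      refine (iInf_le _ q).trans_lt ?_
      rw [if_pos hq1.le]
      exact (EReal.coe_lt_coe_iff.2 hq2).trans hy2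
    · refine le_iInf fun q => ?_
      split_ifs with h
      · exact EReal.coe_le_coe_iff.2 h
      · exact le_top
  rw [this, EReal.toReal_coe]

/-- The number of points of a nondecreasing sequence in a set is at most the number of indices at
which the sequence increases. -/
lemma pointMeasure_range_le_tsum {z : ℤ → ℝ} (hz : Monotone z) (hgt : ∀ x, ∃ k, x < z k)
    {B : Set ℝ} (hB : MeasurableSet B) :
    pointMeasure (range z) B ≤ ∑' k : ℤ, {k | z k < z (k + 1) ∧ z k ∈ B}.indicator 1 k := by
  rw [pointMeasure_range_apply z hB, ← encard_eq_tsum_indicator]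
  refine ENat.toENNReal_le.2 (le_trans (encard_le_encard ?_) (encard_image_le z _))
  rintro _ ⟨⟨k, rfl⟩, hk⟩
  obtain ⟨b, hb⟩ := hgt (z k)
  -- The last index at which the value `z k` is taken. It exists because the sequence is unbounded
  -- above, and the sequence increases right after it.
  obtain ⟨j, hj, hmax⟩ := Int.exists_greatest_of_bdd (P := fun i => z i = z k)
    ⟨b, fun i hi => le_of_not_gt fun h => (hb.trans_le (hz h.le)).ne hi.symm⟩ ⟨k, rfl⟩
  refine ⟨j, ⟨lt_of_le_of_ne (hz (by omega)) fun h => ?_, by rwa [hj]⟩, hj⟩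
  have := hmax (j + 1) (by rw [← h, hj])
  omega

/-! ### Sequences of points with given gaps -/

/-- The partial sums of a two-sided sequence, normalised to vanish at the index `0`. -/
noncomputable def partialSum (τ : ℤ → ℝ) (k : ℤ) : ℝ :=
  ∑ i ∈ Finset.Ico 0 k, τ i - ∑ i ∈ Finset.Ico k 0, τ i

lemma partialSum_zero (τ : ℤ → ℝ) : partialSum τ 0 = 0 := by simp [partialSum]

lemma partialSum_add_one (τ : ℤ → ℝ) (k : ℤ) : partialSum τ (k + 1) = partialSum τ k + τ k := by
  unfold partialSum
  rcases le_or_gt 0 k with h | h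
  · rw [← Finset.insert_Ico_right_eq_Ico_add_one h, Finset.sum_insert (by simp),
      Finset.Ico_eq_empty (by omega : ¬ k + 1 < 0), Finset.Ico_eq_empty (by omega : ¬ k < 0)]
    simp [add_comm]
  · rw [← Finset.insert_Ico_add_one_left_eq_Ico h, Finset.sum_insert (by simp),
      Finset.Ico_eq_empty (by omega : ¬ 0 < k + 1), Finset.Ico_eq_empty (by omega : ¬ 0 < k)]
    simp

/-- The sequence of points with gaps `τ` whose point with index `0` is `a`. -/
noncomputable def pointsOf (a : ℝ) (τ : ℤ → ℝ) (k : ℤ) : ℝ := a + partialSum τ k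

lemma pointsOf_zero (a : ℝ) (τ : ℤ → ℝ) : pointsOf a τ 0 = a := by
  simp [pointsOf, partialSum_zero]

lemma pointsOf_add_one (a : ℝ) (τ : ℤ → ℝ) (k : ℤ) :
    pointsOf a τ (k + 1) = pointsOf a τ k + τ k := by
  simp [pointsOf, partialSum_add_one, add_assoc]

lemma measurable_pointsOf : Measurable fun p : ℝ × (ℤ → ℝ) => pointsOf p.1 p.2 := by
  refine measurable_pi_lambda _ fun k => ?_
  unfold pointsOf partialSum
  fun_prop

/-- The sequence of gaps of a sequence of points. -/
def gapsOf (t : ℤ → ℝ) (k : ℤ) : ℝ := t (k + 1) - t k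

lemma measurable_gapsOf : Measurable gapsOf := by
  refine measurable_pi_lambda _ fun k => ?_
  unfold gapsOf
  fun_prop

lemma gapsOf_pointsOf (a : ℝ) (τ : ℤ → ℝ) : gapsOf (pointsOf a τ) = τ := by
  funext k
  rw [gapsOf, pointsOf_add_one]
  ring

lemma eq_pointsOf {u τ : ℤ → ℝ} (h : ∀ k, u (k + 1) = u k + τ k) : u = pointsOf (u 0) τ := by
  funext k
  induction k using Int.induction_on with
  | zero => rw [pointsOf_zero]
  | succ k ih => rw [h, pointsOf_add_one, ih]
  | pred k ih =>
    have h1 := h (-(k : ℤ) - 1)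
    have h2 := pointsOf_add_one (u 0) τ (-(k : ℤ) - 1)
    rw [sub_add_cancel] at h1 h2
    linarith

lemma pointsOf_comp_add (a : ℝ) (τ : ℤ → ℝ) (m : ℤ) :
    (fun k => pointsOf a τ (k + m)) = pointsOf (a + partialSum τ m) fun k => τ (k + m) := by
  have := eq_pointsOf (u := fun k => pointsOf a τ (k + m)) (τ := fun k => τ (k + m))
    fun k => by rw [add_right_comm, pointsOf_add_one]
  rw [this]
  simp [pointsOf]

/-- The points that divide the intervals of the sequence `t` in the proportions `β`. -/
def divide (t β : ℤ → ℝ) (k : ℤ) : ℝ := t k + β k * (t (k + 1) - t k)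

lemma measurable_divide : Measurable fun p : (ℤ → ℝ) × (ℤ → ℝ) => divide p.1 p.2 := by
  refine measurable_pi_lambda _ fun k => ?_
  unfold divide
  fun_prop

/-- In terms of an initial point and gaps, division is a translation of the initial point together
with the exchange operator on the gaps. -/
lemma divide_pointsOf (a : ℝ) (τ β : ℤ → ℝ) :
    divide (pointsOf a τ) β = pointsOf (a + β 0 * τ 0) (exchange β τ) := by
  have := eq_pointsOf (u := divide (pointsOf a τ) β) (τ := exchange β τ) fun k => by
    simp only [divide, exchange, pointsOf_add_one]
    ring
  rw [this]
  congr 1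
  have h := pointsOf_add_one a τ 0
  rw [zero_add] at h
  simp [divide, h, pointsOf_zero]

lemma measurable_exchange : Measurable fun p : (ℤ → ℝ) × (ℤ → ℝ) => exchange p.2 p.1 := by
  refine measurable_pi_lambda _ fun k => ?_
  unfold exchange
  fun_prop

lemma BiInfinite.divide_mem_Icc {t β : ℤ → ℝ} (ht : BiInfinite t) (hβ : ∀ k, β k ∈ Icc (0 : ℝ) 1)
    (k : ℤ) : divide t β k ∈ Icc (t k) (t (k + 1)) := by
  have h1 : t k < t (k + 1) := ht.strictMono (by omega)
  have h2 := hβ k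
  constructor <;> unfold divide <;> nlinarith [h2.1, h2.2]

lemma BiInfinite.monotone_divide {t β : ℤ → ℝ} (ht : BiInfinite t)
    (hβ : ∀ k, β k ∈ Icc (0 : ℝ) 1) : Monotone (divide t β) :=
  monotone_int_of_le_succ fun k =>
    (ht.divide_mem_Icc hβ k).2.trans (ht.divide_mem_Icc hβ (k + 1)).1

lemma BiInfinite.exists_lt_divide {t β : ℤ → ℝ} (ht : BiInfinite t)
    (hβ : ∀ k, β k ∈ Icc (0 : ℝ) 1) (x : ℝ) : ∃ k, x < divide t β k := by
  obtain ⟨k, hk⟩ := ht.exists_gt x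
  exact ⟨k, hk.trans_le (ht.divide_mem_Icc hβ k).1⟩

lemma BiInfinite.divide_of_strictMono {t β : ℤ → ℝ} (ht : BiInfinite t)
    (hβ : ∀ k, β k ∈ Icc (0 : ℝ) 1) (h : StrictMono (divide t β)) : BiInfinite (divide t β) where
  strictMono := h
  exists_gt := ht.exists_lt_divide hβ
  exists_lt := fun x => by
    obtain ⟨k, hk⟩ := ht.exists_lt x
    refine ⟨k - 1, (ht.divide_mem_Icc hβ (k - 1)).2.trans_lt ?_⟩
    rwa [sub_add_cancel]

/-! ### The stationary measure on marked sequences of points -/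

/-- The measure on sequences of points under which the point with index `0` is distributed
according to `γ` times Lebesgue measure and the gaps are independent of it with law `κ`. -/
noncomputable def pointsLaw (γ : ℝ) (κ : Measure (ℤ → ℝ)) : Measure (ℤ → ℝ) :=
  ((ENNReal.ofReal γ • volume).prod κ).map fun p => pointsOf p.1 p.2

instance (γ : ℝ) (κ : Measure (ℤ → ℝ)) [SFinite κ] : SFinite (pointsLaw γ κ) := by
  unfold pointsLaw
  infer_instance

section PointsLaw

variable {γ : ℝ} {κ lam : Measure (ℤ → ℝ)} [SFinite κ] [SFinite lam]

lemma lintegral_pointsLaw {f : (ℤ → ℝ) → ENNReal} (hf : Measurable f) :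
    ∫⁻ t, f t ∂(pointsLaw γ κ) = ENNReal.ofReal γ * ∫⁻ τ, (∫⁻ a, f (pointsOf a τ)) ∂κ := by
  rw [pointsLaw, lintegral_map hf measurable_pointsOf,
    lintegral_prod_symm (fun p : ℝ × (ℤ → ℝ) => f (pointsOf p.1 p.2))
      (hf.comp measurable_pointsOf).aemeasurable]
  simp_rw [lintegral_smul_measure, smul_eq_mul]
  rw [lintegral_const_mul]
  exact Measurable.lintegral_prod_left' (f := fun p : ℝ × (ℤ → ℝ) => f (pointsOf p.1 p.2))
    (hf.comp measurable_pointsOf)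

lemma lintegral_pointsLaw_prod {f : (ℤ → ℝ) × (ℤ → ℝ) → ENNReal} (hf : Measurable f) :
    ∫⁻ ω, f ω ∂((pointsLaw γ κ).prod lam) =
      ENNReal.ofReal γ * ∫⁻ ω, (∫⁻ a, f (pointsOf a ω.1, ω.2)) ∂(κ.prod lam) := by
  have m1 : Measurable fun q : ((ℤ → ℝ) × (ℤ → ℝ)) × ℝ => f (pointsOf q.2 q.1.1, q.1.2) :=
    hf.comp ((measurable_pointsOf.comp (measurable_snd.prodMk (measurable_fst.comp
      measurable_fst))).prodMk (measurable_snd.comp measurable_fst))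
  rw [lintegral_prod _ hf.aemeasurable, lintegral_pointsLaw hf.lintegral_prod_right',
    lintegral_prod _ m1.lintegral_prod_right'.aemeasurable]
  congr 1
  refine lintegral_congr fun τ => ?_
  rw [lintegral_lintegral_swap]
  have m2 : Measurable fun p : ℝ × (ℤ → ℝ) => (((τ, p.2), p.1) : ((ℤ → ℝ) × (ℤ → ℝ)) × ℝ) := by
    fun_prop
  exact (m1.comp m2).aemeasurable

/-- For fixed gaps and marks the initial point is translated by a constant, which Lebesgue measure
does not see; only the exchange of gaps remains. -/
lemma lintegral_divide_pointsLaw_prod {f : (ℤ → ℝ) → ENNReal} (hf : Measurable f) :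
    ∫⁻ ω, f (divide ω.1 ω.2) ∂((pointsLaw γ κ).prod lam) =
      ∫⁻ t, f t ∂(pointsLaw γ ((κ.prod lam).map fun ω => exchange ω.2 ω.1)) := by
  rw [lintegral_pointsLaw_prod (f := fun ω => f (divide ω.1 ω.2)) (hf.comp measurable_divide), lintegral_pointsLaw hf, lintegral_map
    (Measurable.lintegral_prod_left' (f := fun p : ℝ × (ℤ → ℝ) => f (pointsOf p.1 p.2))
    (hf.comp measurable_pointsOf)) measurable_exchange]
  congr 1
  refine lintegral_congr fun ω => ?_
  simp_rw [divide_pointsOf]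
  exact lintegral_add_right_eq_self (fun a => f (pointsOf a (exchange ω.2 ω.1))) _

/-- Relabelling of a marked sequence of points. -/
def relabel (m : ℤ) (ω : (ℤ → ℝ) × (ℤ → ℝ)) : (ℤ → ℝ) × (ℤ → ℝ) :=
  (fun k => ω.1 (k + m), fun k => ω.2 (k + m))

lemma measurable_relabel (m : ℤ) : Measurable (relabel m) := by
  unfold relabel
  fun_prop

lemma relabel_relabel_neg (m : ℤ) (ω : (ℤ → ℝ) × (ℤ → ℝ)) : relabel (-m) (relabel m ω) = ω := by
  simp [relabel]

lemma divide_relabel (m : ℤ) (ω : (ℤ → ℝ) × (ℤ → ℝ)) :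
    divide (relabel m ω).1 (relabel m ω).2 = fun k => divide ω.1 ω.2 (k + m) := by
  funext k
  simp [divide, relabel, add_right_comm]

/-- Relabelling shifts gaps and marks, whose laws are stationary, and moves the initial point by a
partial sum of the gaps, which translation invariance absorbs. -/
lemma measurePreserving_relabel
    (hκ : ∀ m : ℤ, κ.map (fun τ k => τ (k + m)) = κ)
    (hl : ∀ m : ℤ, lam.map (fun τ k => τ (k + m)) = lam) (m : ℤ) :
    MeasurePreserving (relabel m) ((pointsLaw γ κ).prod lam) ((pointsLaw γ κ).prod lam) := by
  refine ⟨measurable_relabel m, Measure.ext_of_lintegral _ fun f hf => ?_⟩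
  rw [lintegral_map hf (measurable_relabel m),
    lintegral_pointsLaw_prod (f := fun ω => f (relabel m ω)) (hf.comp (measurable_relabel m)),
    lintegral_pointsLaw_prod hf]
  have hprod := Measure.map_prod_map κ lam (f := fun τ k => τ (k + m)) (g := fun τ k => τ (k + m))
    (by fun_prop) (by fun_prop)
  rw [hκ, hl] at hprod
  have m1 : Measurable fun q : ((ℤ → ℝ) × (ℤ → ℝ)) × ℝ => f (pointsOf q.2 q.1.1, q.1.2) :=
    hf.comp ((measurable_pointsOf.comp (measurable_snd.prodMk (measurable_fst.comp
      measurable_fst))).prodMk (measurable_snd.comp measurable_fst))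
  conv_rhs => rw [hprod]
  rw [lintegral_map m1.lintegral_prod_right' (by fun_prop)]
  congr 1
  refine lintegral_congr fun ω => ?_
  simp only [relabel, pointsOf_comp_add, Prod.map]
  exact lintegral_add_right_eq_self
    (fun a => f (pointsOf a fun k => ω.1 (k + m), fun k => ω.2 (k + m))) _

lemma measurePreserving_pointsLaw_comp_add
    (hκ : ∀ m : ℤ, κ.map (fun τ k => τ (k + m)) = κ) (m : ℤ) :
    MeasurePreserving (fun t k => t (k + m)) (pointsLaw γ κ) (pointsLaw γ κ) := by
  refine ⟨by fun_prop, Measure.ext_of_lintegral _ fun f hf => ?_⟩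
  rw [lintegral_map hf (by fun_prop), lintegral_pointsLaw hf, lintegral_pointsLaw (by fun_prop)]
  conv_rhs => rw [← hκ m]
  rw [lintegral_map (Measurable.lintegral_prod_left' (f := fun p : ℝ × (ℤ → ℝ) =>
    f (pointsOf p.1 p.2)) (hf.comp measurable_pointsOf)) (by fun_prop)]
  congr 1
  refine lintegral_congr fun τ => ?_
  simp only [pointsOf_comp_add]
  exact lintegral_add_right_eq_self (fun a => f (pointsOf a fun k => τ (k + m))) _

end PointsLaw

/-- Integrals over a fundamental domain of a measure-preserving action of `ℤ`. -/
lemma setLIntegral_tsum_comp {α : Type*} [MeasurableSpace α] {μ : Measure α} {σ : ℤ → α → α}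
    (hσ : ∀ k, MeasurePreserving (σ k) μ μ) (hinv : ∀ k x, σ (-k) (σ k x) = x) {D : Set α}
    (hD : MeasurableSet D) (hone : ∀ᵐ x ∂μ, ∑' k, D.indicator 1 (σ k x) = (1 : ENNReal))
    {g : α → ENNReal} (hg : Measurable g) :
    ∫⁻ x in D, ∑' k, g (σ k x) ∂μ = ∫⁻ x, g x ∂μ := by
  have mD : Measurable (D.indicator (1 : α → ENNReal)) := measurable_one.indicator hD
  rw [lintegral_tsum (f := fun k x => g (σ k x)) fun k => (hg.comp (hσ k).measurable).aemeasurable]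
  -- By invariance, integrating `g ∘ σ k` over `D` is integrating `g` over the translate of `D` by
  -- `σ k`; these translates cover almost every point exactly once.
  have h1 : ∀ k, ∫⁻ x in D, g (σ k x) ∂μ = ∫⁻ x, D.indicator 1 (σ (-k) x) * g x ∂μ := by
    intro k
    rw [← (hσ k).lintegral_comp (f := fun x => D.indicator 1 (σ (-k) x) * g x)
      ((mD.comp (hσ (-k)).measurable).mul hg), ← lintegral_indicator hD]
    refine lintegral_congr fun x => ?_
    rw [hinv]
    by_cases hx : x ∈ D <;> simp [hx]
  simp_rw [h1]
  rw [← lintegral_tsum (f := fun k x => D.indicator 1 (σ (-k) x) * g x) fun k => ((mD.comp (hσ (-k)).measurable).mul hg).aemeasurable]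
  refine lintegral_congr_ae ?_
  filter_upwards [hone] with x hx
  have h2 := (Equiv.neg ℤ).tsum_eq fun k => D.indicator (1 : α → ENNReal) (σ k x)
  simp only [Equiv.neg_apply] at h2
  rw [ENNReal.tsum_mul_right, h2, hx, one_mul]

lemma BiInfinite.tsum_indicator_centred {t : ℤ → ℝ} (ht : BiInfinite t) :
    ∑' m : ℤ, centred.indicator 1 (fun k => t (k + m)) = (1 : ENNReal) := by
  obtain ⟨m, hm, huniq⟩ := ht.existsUnique_centred
  rw [tsum_eq_single m fun j hj => indicator_of_notMem (fun h => hj (huniq j h)) _,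
    indicator_of_mem hm]
  rfl

/-! ### Exponential gaps -/

section ExponentialGaps

variable {γ : ℝ}

lemma map_infinitePi_comp_add (μ : Measure ℝ) [IsProbabilityMeasure μ] (m : ℤ) :
    (Measure.infinitePi fun _ : ℤ => μ).map (fun τ k => τ (k + m)) =
      Measure.infinitePi fun _ : ℤ => μ :=
  Measure.map_infinitePi_infinitePi_of_inj (f := fun k : ℤ => k + m) (add_left_injective m)

lemma gammaMeasure_one_Ioo (hγ : 0 < γ) {a b : ℝ} (ha : 0 ≤ a) (hab : a ≤ b) :
    gammaMeasure 1 γ (Ioo a b) = ENNReal.ofReal (Real.exp (-(γ * a)) - Real.exp (-(γ * b))) := by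
  have hb : 0 ≤ b := ha.trans hab
  have h := cdf_expMeasure_eq hγ
  have hp : IsProbabilityMeasure (expMeasure γ) := isProbabilityMeasure_expMeasure hγ
  have hna : NullSingletonClass (expMeasure γ) := by
    rw [expMeasure, gammaMeasure]; infer_instance
  change expMeasure γ _ = _
  rw [measure_congr Ioo_ae_eq_Ioc, ← measure_cdf (expMeasure γ), StieltjesFunction.measure_Ioc,
    h, h, if_pos ha, if_pos hb]
  congr 1
  ring

lemma ae_forall_pos_infinitePi (hγ : 0 < γ) :
    ∀ᵐ τ ∂(Measure.infinitePi fun _ : ℤ => gammaMeasure 1 γ), ∀ k, 0 < τ k := by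
  have := isProbabilityMeasure_gammaMeasure one_pos hγ
  rw [ae_all_iff]
  intro k
  exact (measurePreserving_eval_infinitePi (fun _ : ℤ => gammaMeasure 1 γ) k).quasiMeasurePreserving.ae
    gammaMeasure_one_ae_pos

lemma gammaMeasure_one_Iic_lt_one (hγ : 0 < γ) (x : ℝ) : gammaMeasure 1 γ (Iic x) < 1 := by
  have hp := isProbabilityMeasure_gammaMeasure one_pos hγ
  have h1 : gammaMeasure 1 γ (Ioo (max x 0) (max x 0 + 1)) ≠ 0 := by
    rw [gammaMeasure_one_Ioo hγ (le_max_right _ _) (by linarith)]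
    simp only [ne_eq, ENNReal.ofReal_eq_zero, not_le, sub_pos, Real.exp_lt_exp]
    nlinarith
  refine lt_of_le_of_ne prob_le_one fun h => h1 ?_
  have h2 : gammaMeasure 1 γ (Iic x)ᶜ = 0 := (prob_compl_eq_zero_iff measurableSet_Iic).2 h
  refine measure_mono_null ?_ h2
  intro y hy
  simpa using (le_max_left x 0).trans_lt hy.1

/-- Distinct indices give independent entries, so the probability that the first `n` of them are all
at most `x` is the `n`-th power of a number below 1. -/
lemma ae_exists_gt_infinitePi (hγ : 0 < γ) {f : ℕ → ℤ} (hf : Function.Injective f) (x : ℝ) :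
    ∀ᵐ τ ∂(Measure.infinitePi fun _ : ℤ => gammaMeasure 1 γ), ∃ n, x < τ (f n) := by
  have := isProbabilityMeasure_gammaMeasure one_pos hγ
  have hle : ∀ n : ℕ, (Measure.infinitePi fun _ : ℤ => gammaMeasure 1 γ)
      {τ | ¬ ∃ n, x < τ (f n)} ≤ gammaMeasure 1 γ (Iic x) ^ n := by
    intro n
    have := Measure.infinitePi_pi (fun _ : ℤ => gammaMeasure 1 γ)
      (s := (Finset.range n).map ⟨f, hf⟩) (t := fun _ => Iic x) (fun _ _ => measurableSet_Iic)
    simp only [Finset.prod_const, Finset.card_map, Finset.card_range] at this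
    rw [← this]
    refine measure_mono fun τ hτ k hk => ?_
    simp only [Finset.coe_map, Function.Embedding.coeFn_mk, mem_image] at hk
    obtain ⟨i, -, rfl⟩ := hk
    exact not_lt.1 fun h => hτ ⟨i, h⟩
  refine le_antisymm (ge_of_tendsto' (ENNReal.tendsto_pow_atTop_nhds_zero_of_lt_one
    (gammaMeasure_one_Iic_lt_one hγ x)) hle) zero_le

/-- On each side of the index 0 some gap exceeds any given `m`. Since gaps are positive, this single
gap already pushes the points beyond distance `m` from the initial one. -/
lemma ae_biInfinite_pointsOf (hγ : 0 < γ) :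
    ∀ᵐ τ ∂(Measure.infinitePi fun _ : ℤ => gammaMeasure 1 γ), ∀ a, BiInfinite (pointsOf a τ) := by
  have h1 : ∀ᵐ τ ∂(Measure.infinitePi fun _ : ℤ => gammaMeasure 1 γ),
      ∀ m : ℕ, ∃ n : ℕ, (m : ℝ) < τ (n : ℤ) :=
    ae_all_iff.2 fun m => ae_exists_gt_infinitePi hγ (f := fun n : ℕ => (n : ℤ))
      Nat.cast_injective m
  have h2 : ∀ᵐ τ ∂(Measure.infinitePi fun _ : ℤ => gammaMeasure 1 γ),
      ∀ m : ℕ, ∃ n : ℕ, (m : ℝ) < τ (-(n : ℤ) - 1) :=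
    ae_all_iff.2 fun m => ae_exists_gt_infinitePi hγ (f := fun n : ℕ => -(n : ℤ) - 1)
      (fun i j h => by simpa using h) m
  filter_upwards [ae_forall_pos_infinitePi hγ, h1, h2] with τ hpos h1 h2 a
  have hmono : StrictMono (pointsOf a τ) := strictMono_int_of_lt_succ fun k => by
    rw [pointsOf_add_one]; linarith [hpos k]
  refine ⟨hmono, fun x => ?_, fun x => ?_⟩
  · obtain ⟨m, hm⟩ := exists_nat_gt (a - x)
    obtain ⟨n, hn⟩ := h2 m
    refine ⟨-(n : ℤ) - 1, ?_⟩
    have e := pointsOf_add_one a τ (-(n : ℤ) - 1)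
    have l : pointsOf a τ (-(n : ℤ) - 1 + 1) ≤ pointsOf a τ 0 := hmono.monotone (by omega)
    rw [pointsOf_zero] at l
    linarith
  · obtain ⟨m, hm⟩ := exists_nat_gt (x - a)
    obtain ⟨n, hn⟩ := h1 m
    refine ⟨(n : ℤ) + 1, ?_⟩
    have e := pointsOf_add_one a τ n
    have l : pointsOf a τ 0 ≤ pointsOf a τ n := hmono.monotone (by omega)
    rw [pointsOf_zero] at l
    linarith

end ExponentialGaps

/-! ### Ordered boxes -/

/-- The end points `l k`, `u k` of ordered disjoint intervals, those with positive index lying to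
the right of the origin and the others to the left. -/
structure OrderedIntervals (l u : ℤ → ℝ) : Prop where
  lt : ∀ k, l k < u k
  le : ∀ k, u k ≤ l (k + 1)
  left : u 0 ≤ 0
  right : 0 ≤ l 1

/-- The sequences with `k`-th entry in the `k`-th interval, for `-n ≤ k ≤ n + 1`. -/
def orderedBox (n : ℕ) (l u : ℤ → ℝ) : Set (ℤ → ℝ) :=
  {t | ∀ k ∈ Finset.Icc (-n : ℤ) (n + 1), t k ∈ Ioo (l k) (u k)}

lemma isOpen_orderedBox (n : ℕ) (l u : ℤ → ℝ) : IsOpen (orderedBox n l u) := by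
  have : orderedBox n l u =
      ⋂ k ∈ Finset.Icc (-n : ℤ) (n + 1), (fun t : ℤ → ℝ => t k) ⁻¹' Ioo (l k) (u k) := by
    ext t; simp [orderedBox]
  rw [this]
  exact isOpen_biInter_finset fun k _ => isOpen_Ioo.preimage (continuous_apply k)

/-- The ordered boxes of all sizes. -/
def orderedBoxes : Set (Set (ℤ → ℝ)) :=
  {B | ∃ n l u, OrderedIntervals l u ∧ B = orderedBox n l u}

/-- Inside the smaller index range the intervals are intersected, and a common element keeps them
nonempty; outside it those of the larger box are kept. Shrinking intervals preserves their order. -/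
lemma orderedBox_inter_mem {n m : ℕ} (hnm : n ≤ m) {l u l' u' : ℤ → ℝ}
    (h' : OrderedIntervals l' u') (hne : (orderedBox n l u ∩ orderedBox m l' u').Nonempty) :
    orderedBox n l u ∩ orderedBox m l' u' ∈ orderedBoxes := by
  obtain ⟨t, ht, ht'⟩ := hne
  have hsub : ∀ k, k ∈ Finset.Icc (-n : ℤ) (n + 1) → k ∈ Finset.Icc (-m : ℤ) (m + 1) := by
    intro k hk
    rw [Finset.mem_Icc] at *
    omega
  have hl : ∀ k, l' k ≤ if k ∈ Finset.Icc (-n : ℤ) (n + 1) then max (l k) (l' k) else l' k := by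
    intro k; split_ifs
    · exact le_max_right _ _
    · exact le_rfl
  have hu : ∀ k, (if k ∈ Finset.Icc (-n : ℤ) (n + 1) then min (u k) (u' k) else u' k) ≤ u' k := by
    intro k; split_ifs
    · exact min_le_right _ _
    · exact le_rfl
  refine ⟨m, fun k => if k ∈ Finset.Icc (-n : ℤ) (n + 1) then max (l k) (l' k) else l' k,
    fun k => if k ∈ Finset.Icc (-n : ℤ) (n + 1) then min (u k) (u' k) else u' k,
    ⟨fun k => ?_, fun k => ?_, (hu 0).trans h'.left, h'.right.trans (hl 1)⟩, ?_⟩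
  · by_cases hk : k ∈ Finset.Icc (-n : ℤ) (n + 1)
    · simp only [hk, if_true]
      have h1 := ht k hk
      have h2 := ht' k (hsub k hk)
      exact (max_lt h1.1 h2.1).trans (lt_min h1.2 h2.2)
    · simp only [hk, if_false]
      exact h'.lt k
  · exact (hu k).trans ((h'.le k).trans (hl (k + 1)))
  · ext s
    constructor
    · rintro ⟨h1, h2⟩ k hk
      by_cases hk' : k ∈ Finset.Icc (-n : ℤ) (n + 1)
      · simp only [hk', if_true]
        exact ⟨max_lt (h1 k hk').1 (h2 k hk).1, lt_min (h1 k hk').2 (h2 k hk).2⟩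
      · simp only [hk', if_false]
        exact h2 k hk
    · intro h
      constructor
      · intro k hk
        have := h k (hsub k hk)
        simp only [hk, if_true] at this
        exact ⟨(le_max_left _ _).trans_lt this.1, this.2.trans_le (min_le_left _ _)⟩
      · intro k hk
        exact ⟨(hl k).trans_lt (h k hk).1, (h k hk).2.trans_le (hu k)⟩

lemma isPiSystem_orderedBoxes : IsPiSystem orderedBoxes := by
  rintro _ ⟨n, l, u, h, rfl⟩ _ ⟨m, l', u', h', rfl⟩ hne
  rcases le_total n m with hnm | hnm
  · exact orderedBox_inter_mem hnm h' hne
  · rw [inter_comm] at hne ⊢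
    exact orderedBox_inter_mem hnm h hne

/-- The strictly increasing sequences with the origin strictly between the points
`0` and `1`. -/
def strictCentred : Set (ℤ → ℝ) := {t | StrictMono t ∧ t 0 < 0 ∧ 0 < t 1}

/-- Boxes fit around any sequence in `strictCentred`, with one upper end point as tight as desired.
This exhibits `strictCentred` and the half-spaces in it through unions of boxes. -/
lemma exists_orderedBox {t : ℤ → ℝ} (ht : t ∈ strictCentred) (j : ℤ) {q : ℝ} (hq : t j < q) :
    ∃ l u, OrderedIntervals l u ∧ (∀ k, t k ∈ Ioo (l k) (u k)) ∧ u j ≤ q := by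
  obtain ⟨hm, h0, h1⟩ := ht
  have hstep : ∀ k, t k < t (k + 1) := fun k => hm (by omega)
  have hex : ∀ k, ∃ u, t k < u ∧ u < t (k + 1) ∧ (k = 0 → u ≤ 0) ∧ (k = j → u ≤ q) := by
    intro k
    have h : t k < min (t (k + 1)) (min (if k = 0 then 0 else t (k + 1))
        (if k = j then q else t (k + 1))) := by
      refine lt_min (hstep k) (lt_min ?_ ?_)
      · split_ifs with hk
        · rwa [hk]
        · exact hstep k
      · split_ifs with hk
        · rwa [hk]
        · exact hstep k
    obtain ⟨u, hu1, hu2⟩ := exists_between h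
    rw [lt_min_iff, lt_min_iff] at hu2
    refine ⟨u, hu1, hu2.1, fun hk => ?_, fun hk => ?_⟩
    · simpa [hk] using hu2.2.1.le
    · simpa [hk] using hu2.2.2.le
  choose u hu1 hu2 hu3 hu4 using hex
  -- Each interval starts where the previous one ends, except that interval 1 starts at the origin,
  -- as `OrderedIntervals` requires `0 ≤ l 1` whereas `u 0` may be negative.
  have hl : ∀ k, (if k = 1 then 0 else u (k - 1)) < t k := by
    intro k
    split_ifs with hk
    · rwa [hk]
    · have := hu2 (k - 1)
      rwa [sub_add_cancel] at this
  refine ⟨fun k => if k = 1 then 0 else u (k - 1), u, ⟨fun k => (hl k).trans (hu1 k), fun k => ?_,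
    hu3 0 rfl, by simp⟩, fun k => ⟨hl k, hu1 k⟩, hu4 j rfl⟩
  by_cases hk : k + 1 = 1
  · simp only [hk, if_true]
    exact hu3 k (by omega)
  · simp [hk]

/-- The union is uncountable, but boxes are open and the sequence space is second countable, so
countably many of them suffice. -/
lemma measurableSet_sUnion_orderedBoxes (n : ℕ) (W : Set (ℤ → ℝ)) :
    MeasurableSet[MeasurableSpace.generateFrom orderedBoxes]
      (⋃₀ {B | (∃ l u, OrderedIntervals l u ∧ B = orderedBox n l u) ∧ B ⊆ W}) := by
  obtain ⟨S, hS, hsub, heq⟩ := TopologicalSpace.isOpen_sUnion_countable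
    {B | (∃ l u, OrderedIntervals l u ∧ B = orderedBox n l u) ∧ B ⊆ W} (by
      rintro _ ⟨⟨l, u, -, rfl⟩, -⟩
      exact isOpen_orderedBox n l u)
  rw [← heq]
  refine MeasurableSet.sUnion hS fun B hB => ?_
  obtain ⟨⟨l, u, h, rfl⟩, -⟩ := hsub hB
  exact MeasurableSpace.measurableSet_generateFrom ⟨n, l, u, h, rfl⟩

lemma measurableSet_strictCentred :
    MeasurableSet[MeasurableSpace.generateFrom orderedBoxes] strictCentred := by
  have : strictCentred = ⋂ n : ℕ,
      ⋃₀ {B | (∃ l u, OrderedIntervals l u ∧ B = orderedBox n l u) ∧ B ⊆ univ} := by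
    ext t
    simp only [mem_iInter]
    constructor
    · intro ht n
      obtain ⟨l, u, h, hmem, -⟩ := exists_orderedBox ht 0 (lt_add_one (t 0))
      exact ⟨_, ⟨⟨l, u, h, rfl⟩, subset_univ _⟩, fun k _ => hmem k⟩
    · intro h
      refine ⟨strictMono_int_of_lt_succ fun k => ?_, ?_, ?_⟩
      · obtain ⟨_, ⟨⟨l, u, h, rfl⟩, -⟩, hmem⟩ := h k.natAbs
        have h1 := (hmem k (by rw [Finset.mem_Icc]; omega)).2
        have h2 := (hmem (k + 1) (by rw [Finset.mem_Icc]; omega)).1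
        exact h1.trans ((h.le k).trans_lt h2)
      · obtain ⟨_, ⟨⟨l, u, h, rfl⟩, -⟩, hmem⟩ := h 0
        exact (hmem 0 (by simp)).2.trans_le h.left
      · obtain ⟨_, ⟨⟨l, u, h, rfl⟩, -⟩, hmem⟩ := h 0
        exact h.right.trans_lt (hmem 1 (by simp)).1
  rw [this]
  exact MeasurableSet.iInter fun n => measurableSet_sUnion_orderedBoxes n univ

lemma measurableSet_strictCentred_inter (j : ℤ) (q : ℝ) :
    MeasurableSet[MeasurableSpace.generateFrom orderedBoxes]
      (strictCentred ∩ {t | t j < q}) := by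
  have : strictCentred ∩ {t | t j < q} = strictCentred ∩
      ⋃₀ {B | (∃ l u, OrderedIntervals l u ∧ B = orderedBox j.natAbs l u) ∧ B ⊆ {t | t j < q}} := by
    ext t
    refine and_congr_right fun ht => ⟨fun hq => ?_, ?_⟩
    · obtain ⟨l, u, h, hmem, huq⟩ := exists_orderedBox ht j hq
      refine ⟨_, ⟨⟨l, u, h, rfl⟩, fun s hs => ?_⟩, fun k _ => hmem k⟩
      exact (hs j (by rw [Finset.mem_Icc]; omega)).2.trans_le huq
    · rintro ⟨B, ⟨-, hB⟩, htB⟩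
      exact hB htB
  rw [this]
  exact measurableSet_strictCentred.inter (measurableSet_sUnion_orderedBoxes _ _)

/-- A law of strictly increasing sequences is determined by the probabilities of ordered boxes. -/
lemma measure_ext_of_orderedBoxes {μ ν : Measure (ℤ → ℝ)} [IsProbabilityMeasure μ]
    [IsProbabilityMeasure ν] (hμ : ∀ᵐ t ∂μ, t ∈ strictCentred) (hν : ∀ᵐ t ∂ν, t ∈ strictCentred)
    (h : ∀ n l u, OrderedIntervals l u → μ (orderedBox n l u) = ν (orderedBox n l u)) : μ = ν := by
  classical
  have hle : MeasurableSpace.generateFrom orderedBoxes ≤ MeasurableSpace.pi := by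
    refine MeasurableSpace.generateFrom_le ?_
    rintro _ ⟨n, l, u, -, rfl⟩
    exact (isOpen_orderedBox n l u).measurableSet
  have htrim : μ.trim hle = ν.trim hle := by
    have i1 := isFiniteMeasure_trim hle (μ := μ)
    refine @ext_of_generate_finite _ (MeasurableSpace.generateFrom orderedBoxes) _ _
      orderedBoxes rfl isPiSystem_orderedBoxes i1 ?_ ?_
    · rintro B ⟨n, l, u, hlu, rfl⟩
      have hB : MeasurableSet[MeasurableSpace.generateFrom orderedBoxes] (orderedBox n l u) :=
        MeasurableSpace.measurableSet_generateFrom ⟨n, l, u, hlu, rfl⟩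
      rw [trim_measurableSet_eq hle hB, trim_measurableSet_eq hle hB, h n l u hlu]
    · rw [trim_measurableSet_eq hle MeasurableSet.univ, trim_measurableSet_eq hle MeasurableSet.univ]
      simp
  -- The boxes are only known to generate the product σ-algebra on `strictCentred`. The map `g` is
  -- the identity there and constant elsewhere, so preimages under `g` are measurable for the
  -- generated σ-algebra and differ from the original sets by null sets.
  set g : (ℤ → ℝ) → ℤ → ℝ := fun t => if t ∈ strictCentred then t else 0 with hg
  have mg : @Measurable _ _ (MeasurableSpace.generateFrom orderedBoxes) MeasurableSpace.pi g := by
    rw [@measurable_pi_iff]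
    intro j
    refine measurable_of_Iio (mδ := MeasurableSpace.generateFrom orderedBoxes) fun q => ?_
    have : (fun t => g t j) ⁻¹' Iio q =
        (strictCentred ∩ {t | t j < q}) ∪ (strictCentredᶜ ∩ {_t | (0 : ℝ) < q}) := by
      ext t
      by_cases ht : t ∈ strictCentred <;> simp [hg, ht]
    rw [this]
    exact (measurableSet_strictCentred_inter j q).union
      (measurableSet_strictCentred.compl.inter (MeasurableSet.const _))
  have hgid : ∀ κ : Measure (ℤ → ℝ), (∀ᵐ t ∂κ, t ∈ strictCentred) → ∀ A, κ (g ⁻¹' A) = κ A := by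
    intro κ hκ A
    refine measure_congr ?_
    filter_upwards [hκ] with t ht
    change (g t ∈ A) = (t ∈ A)
    simp [hg, ht]
  ext A hA
  have hA' := mg hA
  rw [← hgid μ hμ, ← hgid ν hν, ← trim_measurableSet_eq hle hA', ← trim_measurableSet_eq hle hA',
    htrim]

/-! ### Boxes under the stationary measure -/

section BoxLaw

variable {γ : ℝ}

/-- The sequence with first entry `x`, followed by the entries of `τ`. -/
def consSeq (x : ℝ) (τ : ℕ → ℝ) : ℕ → ℝ
  | 0 => x
  | n + 1 => τ n

lemma measurable_consSeq : Measurable fun p : ℝ × (ℕ → ℝ) => consSeq p.1 p.2 := by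
  refine measurable_pi_lambda _ fun n => ?_
  cases n with
  | zero => exact measurable_fst
  | succ n => exact (measurable_pi_apply n).comp measurable_snd

/-- Allows conditioning on the first gap: prepending an independent entry to an i.i.d. sequence
reproduces its law. -/
lemma map_consSeq_infinitePi (μ : Measure ℝ) [IsProbabilityMeasure μ] :
    (μ.prod (Measure.infinitePi fun _ : ℕ => μ)).map (fun p => consSeq p.1 p.2) =
      Measure.infinitePi fun _ : ℕ => μ := by
  let f : ℕ → ℕ × Bool := fun n => if n = 0 then (0, false) else (n - 1, true)
  have hf : Function.Injective f := by
    intro a b hab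
    rcases a with _ | a <;> rcases b with _ | b <;> simp_all [f]
  have e1 := Measure.map_infinitePi_infinitePi_of_inj (P := fun _ : ℕ × Bool => μ) hf
  have e2 := map_infinitePi_prod_bool (ι := ℕ) μ μ
  simp only [ite_self] at e2
  have e3 := Measure.map_prod_map (Measure.infinitePi fun _ : ℕ => μ)
    (Measure.infinitePi fun _ : ℕ => μ) (f := fun x => x 0) (g := id) (by fun_prop) (by fun_prop)
  rw [Measure.infinitePi_map_eval, Measure.map_id] at e3
  have m1 := measurable_consSeq
  rw [e3, ← e2, ← e1, Measure.map_map (by fun_prop) (by fun_prop),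
    Measure.map_map (m1.comp (by fun_prop)) (by fun_prop)]
  congr 1
  funext w n
  cases n <;> rfl

/-- The points `a + τ 0 + ⋯ + τ i`, for `i < N`, lie in the given intervals. -/
def StepsIn : ℕ → (ℕ → ℝ) → (ℕ → ℝ) → ℝ → (ℕ → ℝ) → Prop
  | 0, _, _, _, _ => True
  | N + 1, l, u, a, τ => a + τ 0 ∈ Ioo (l 0) (u 0) ∧
      StepsIn N (fun i => l (i + 1)) (fun i => u (i + 1)) (a + τ 0) fun i => τ (i + 1)

lemma measurableSet_stepsIn (N : ℕ) (l u : ℕ → ℝ) :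
    MeasurableSet {p : ℝ × (ℕ → ℝ) | StepsIn N l u p.1 p.2} := by
  induction N generalizing l u with
  | zero => simp [StepsIn]
  | succ N ih =>
    have m1 : Measurable fun p : ℝ × (ℕ → ℝ) => p.1 + p.2 0 := by fun_prop
    have m2 : Measurable fun p : ℝ × (ℕ → ℝ) =>
      ((p.1 + p.2 0, fun i => p.2 (i + 1)) : ℝ × (ℕ → ℝ)) := by fun_prop
    exact (m1 measurableSet_Ioo).inter (m2 (ih _ _))

lemma stepsIn_pointsOf_iff (N : ℕ) (l u : ℕ → ℝ) (a : ℝ) (τ : ℤ → ℝ) :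
    StepsIn N l u a (fun i => τ i) ↔
      ∀ i < N, pointsOf a τ ((i : ℤ) + 1) ∈ Ioo (l i) (u i) := by
  induction N generalizing l u a τ with
  | zero => simp [StepsIn]
  | succ N ih =>
    have h0 : a + τ 0 = pointsOf a τ 1 := by
      have := pointsOf_add_one a τ 0
      rw [pointsOf_zero, zero_add] at this
      exact this.symm
    have h1 : ∀ k, pointsOf a τ (k + 1) = pointsOf (a + τ 0) (fun i => τ (i + 1)) k := by
      intro k
      have := congrFun (pointsOf_comp_add a τ 1) k
      have e : partialSum τ 1 = τ 0 := by
        have := partialSum_add_one τ 0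
        rwa [partialSum_zero, zero_add, zero_add] at this
      rw [e] at this
      exact this
    have := ih (fun i => l (i + 1)) (fun i => u (i + 1)) (a + τ 0) (fun i => τ (i + 1))
    simp only [StepsIn, Nat.cast_add, Nat.cast_one, Nat.cast_zero] at this ⊢
    rw [this]
    constructor
    · rintro ⟨h2, h3⟩ i hi
      rcases i with _ | i
      · simpa [← h0] using h2
      · have := h3 i (by omega)
        rw [← h1] at this
        exact_mod_cast this
    · intro h
      refine ⟨by simpa [← h0] using h 0 (by omega), fun i hi => ?_⟩
      rw [← h1]
      exact_mod_cast h (i + 1) (by omega)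

/-- Induction on the number of steps, conditioning on the first gap `x`. The density factor `exp (-γ
x)` cancels the factor `exp (γ (a + x))` of the induction hypothesis up to `exp (γ a)`, so each
intermediate interval contributes just `γ` times its length. -/
lemma infinitePi_stepsIn (hγ : 0 < γ) (K : ℕ) {l u : ℕ → ℝ} (hlu : ∀ i, l i < u i)
    (hul : ∀ i, u i ≤ l (i + 1)) {a : ℝ} (ha : a ≤ l 0) :
    (Measure.infinitePi fun _ : ℕ => gammaMeasure 1 γ) {τ | StepsIn (K + 1) l u a τ} =
      ENNReal.ofReal (Real.exp (γ * a) * ((∏ i ∈ Finset.range K, γ * (u i - l i)) *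
        (Real.exp (-(γ * l K)) - Real.exp (-(γ * u K))))) := by
  have hp := isProbabilityMeasure_gammaMeasure one_pos hγ
  induction K generalizing l u a with
  | zero =>
    have : {τ : ℕ → ℝ | StepsIn (0 + 1) l u a τ} =
        (fun τ => τ 0) ⁻¹' Ioo (l 0 - a) (u 0 - a) := by
      ext τ
      simp only [StepsIn, and_true, mem_Ioo, mem_preimage]
      change (l 0 < a + τ 0 ∧ a + τ 0 < u 0) ↔ _
      rw [sub_lt_iff_lt_add', lt_sub_iff_add_lt']
    rw [this, ← Measure.map_apply (by fun_prop) measurableSet_Ioo, Measure.infinitePi_map_eval,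
      gammaMeasure_one_Ioo hγ (by linarith) (by linarith [hlu 0])]
    congr 1
    rw [Finset.prod_range_zero, one_mul, mul_sub (Real.exp _), ← Real.exp_add, ← Real.exp_add]
    congr 2 <;> ring
  | succ K ih =>
    set c := (∏ i ∈ Finset.range K, γ * (u (i + 1) - l (i + 1))) *
        (Real.exp (-(γ * l (K + 1))) - Real.exp (-(γ * u (K + 1)))) with hc
    have hc0 : 0 ≤ c := by
      refine mul_nonneg (Finset.prod_nonneg fun i _ => ?_) ?_
      · have := hlu (i + 1)
        exact mul_nonneg hγ.le (by linarith)
      · rw [sub_nonneg, Real.exp_le_exp]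
        have := hlu (K + 1)
        nlinarith
    have mS : MeasurableSet {τ : ℕ → ℝ | StepsIn (K + 1 + 1) l u a τ} := by
      have m : Measurable fun τ : ℕ → ℝ => (a, τ) := by fun_prop
      exact m (measurableSet_stepsIn (K + 1 + 1) l u)
    rw [← map_consSeq_infinitePi, Measure.map_apply measurable_consSeq mS,
      Measure.prod_apply (measurable_consSeq mS)]
    have hin : ∀ x : ℝ, (Measure.infinitePi fun _ : ℕ => gammaMeasure 1 γ)
        (Prod.mk x ⁻¹' ((fun p : ℝ × (ℕ → ℝ) => consSeq p.1 p.2) ⁻¹'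
          {τ | StepsIn (K + 1 + 1) l u a τ})) =
        (Ioo (l 0 - a) (u 0 - a)).indicator
          (fun x => ENNReal.ofReal (Real.exp (γ * (a + x)) * c)) x := by
      intro x
      by_cases hx : x ∈ Ioo (l 0 - a) (u 0 - a)
      · rw [indicator_of_mem hx]
        have hx' : a + x ∈ Ioo (l 0) (u 0) := ⟨by linarith [hx.1], by linarith [hx.2]⟩
        rw [← ih (l := fun i => l (i + 1)) (u := fun i => u (i + 1)) (fun i => hlu _)
          (fun i => hul _) (hx'.2.le.trans (hul 0))]
        congr 1
        ext τ
        change (a + x ∈ Ioo (l 0) (u 0) ∧ _) ↔ _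
        simp only [hx', true_and]
        rfl
      · rw [indicator_of_notMem hx]
        convert measure_empty (μ := Measure.infinitePi fun _ : ℕ => gammaMeasure 1 γ)
        rw [eq_empty_iff_forall_notMem]
        rintro τ ⟨h, -⟩
        have h' : a + x ∈ Ioo (l 0) (u 0) := h
        exact hx ⟨by linarith [h'.1], by linarith [h'.2]⟩
    simp_rw [hin]
    have m3 : Measurable ((Ioo (l 0 - a) (u 0 - a)).indicator
        (fun x => ENNReal.ofReal (Real.exp (γ * (a + x)) * c))) :=
      Measurable.indicator (by fun_prop) measurableSet_Ioo
    rw [lintegral_gammaMeasure_one m3, ← lintegral_indicator measurableSet_Ioi]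
    have hpt : ∀ x : ℝ, (Ioi (0 : ℝ)).indicator (fun x => ENNReal.ofReal (γ * Real.exp (-(γ * x))) *
        (Ioo (l 0 - a) (u 0 - a)).indicator
          (fun x => ENNReal.ofReal (Real.exp (γ * (a + x)) * c)) x) x =
        (Ioo (l 0 - a) (u 0 - a)).indicator
          (fun _ => ENNReal.ofReal (γ * (Real.exp (γ * a) * c))) x := by
      intro x
      by_cases hx : x ∈ Ioo (l 0 - a) (u 0 - a)
      · have hx0 : x ∈ Ioi (0 : ℝ) := lt_of_le_of_lt (by linarith) hx.1
        rw [indicator_of_mem hx0, indicator_of_mem hx, indicator_of_mem hx,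
          ← ENNReal.ofReal_mul (by positivity)]
        congr 1
        rw [mul_add, Real.exp_add, Real.exp_neg]
        field_simp
      · rw [indicator_of_notMem hx]
        by_cases hx0 : x ∈ Ioi (0 : ℝ)
        · rw [indicator_of_mem hx0, indicator_of_notMem hx, mul_zero]
        · rw [indicator_of_notMem hx0]
    simp_rw [hpt]
    rw [lintegral_indicator_const measurableSet_Ioo, Real.volume_Ioo,
      ← ENNReal.ofReal_mul (by positivity)]
    congr 1
    rw [Finset.prod_range_succ']
    rw [hc]
    ring

/-- The measure of an ordered box under the stationary measure with exponential gaps. -/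
lemma pointsLaw_orderedBox (hγ : 0 < γ) (n : ℕ) {l u : ℤ → ℝ} (h : OrderedIntervals l u) :
    pointsLaw γ (Measure.infinitePi fun _ : ℤ => gammaMeasure 1 γ) (orderedBox n l u) =
      ENNReal.ofReal ((Real.exp (γ * u (-n)) - Real.exp (γ * l (-n))) *
        ((∏ i ∈ Finset.range (2 * n), γ * (u (i + 1 - n) - l (i + 1 - n))) *
          (Real.exp (-(γ * l (n + 1))) - Real.exp (-(γ * u (n + 1)))))) := by
  have hp := isProbabilityMeasure_gammaMeasure one_pos hγ
  set M := pointsLaw γ (Measure.infinitePi fun _ : ℤ => gammaMeasure 1 γ)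
  set l' : ℕ → ℝ := fun i => l (i + 1 - n) with hl'
  set u' : ℕ → ℝ := fun i => u (i + 1 - n) with hu'
  set c := (∏ i ∈ Finset.range (2 * n), γ * (u' i - l' i)) *
    (Real.exp (-(γ * l' (2 * n))) - Real.exp (-(γ * u' (2 * n)))) with hc
  have hlu : ∀ i, l' i < u' i := fun i => h.lt _
  have hul : ∀ i, u' i ≤ l' (i + 1) := fun i => by
    have := h.le (i + 1 - n)
    simp only [hl', hu']
    push_cast
    rwa [show (i : ℤ) + 1 - n + 1 = i + 1 + 1 - n by ring] at this
  have hc0 : 0 ≤ c := by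
    refine mul_nonneg (Finset.prod_nonneg fun i _ => ?_) ?_
    · have := hlu i
      exact mul_nonneg hγ.le (by linarith)
    · rw [sub_nonneg, Real.exp_le_exp]
      have := hlu (2 * n)
      nlinarith
  let S : Set (ℤ → ℝ) := {s | s 0 ∈ Ioo (l (-n)) (u (-n)) ∧
    ∀ i < 2 * n + 1, s ((i : ℤ) + 1) ∈ Ioo (l' i) (u' i)}
  have mS : MeasurableSet S := by
    have : S = (fun s => s 0) ⁻¹' Ioo (l (-n)) (u (-n)) ∩
        ⋂ i ∈ Finset.range (2 * n + 1), (fun s => s ((i : ℤ) + 1)) ⁻¹' Ioo (l' i) (u' i) := by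
      ext s; simp [S]
    rw [this]
    exact (measurable_pi_apply 0 measurableSet_Ioo).inter
      (Finset.measurableSet_biInter _ fun i _ => measurable_pi_apply _ measurableSet_Ioo)
  -- Relabelling by `-n`, which preserves the measure, moves the leftmost constrained point to the
  -- index 0, where its distribution is explicit.
  have hbox : orderedBox n l u = (fun (t : ℤ → ℝ) k => t (k + -n)) ⁻¹' S := by
    ext t
    simp only [orderedBox, S, mem_preimage, Finset.mem_Icc]
    constructor
    · intro ht
      refine ⟨by simpa using ht (-n) ⟨le_rfl, by omega⟩, fun i hi => ?_⟩
      exact ht ((i : ℤ) + 1 - n) ⟨by omega, by omega⟩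
    · rintro ⟨h0, h1⟩ k ⟨hk1, hk2⟩
      rcases hk1.eq_or_lt with rfl | hk1
      · simpa using h0
      · have := h1 (k + n - 1).toNat (by omega)
        simp only [hl', hu'] at this
        rw [Int.toNat_of_nonneg (by omega), show k + n - 1 + 1 + -n = k by ring,
          show k + n - 1 + 1 - n = k by ring] at this
        exact this
  have hcast : (Measure.infinitePi fun _ : ℤ => gammaMeasure 1 γ).map
      (fun τ (i : ℕ) => τ (i : ℤ)) = Measure.infinitePi fun _ : ℕ => gammaMeasure 1 γ :=
    Measure.map_infinitePi_infinitePi_of_inj (f := fun i : ℕ => (i : ℤ)) Nat.cast_injective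
  have msteps : ∀ a, MeasurableSet {τ : ℕ → ℝ | StepsIn (2 * n + 1) l' u' a τ} := fun a => by
    have m : Measurable fun τ : ℕ → ℝ => (a, τ) := by fun_prop
    exact m (measurableSet_stepsIn (2 * n + 1) l' u')
  rw [hbox, (measurePreserving_pointsLaw_comp_add (γ := γ) (fun m => map_infinitePi_comp_add
    (gammaMeasure 1 γ) m) (-n)).measure_preimage mS.nullMeasurableSet,
    ← lintegral_indicator_one mS, lintegral_pointsLaw (measurable_one.indicator mS),
    lintegral_lintegral_swap]
  · have hin : ∀ a : ℝ, ∫⁻ τ, S.indicator 1 (pointsOf a τ)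
        ∂(Measure.infinitePi fun _ : ℤ => gammaMeasure 1 γ) =
        (Ioo (l (-n)) (u (-n))).indicator (fun a => ENNReal.ofReal (Real.exp (γ * a) * c)) a := by
      intro a
      by_cases ha : a ∈ Ioo (l (-n)) (u (-n))
      · have ha' : a ≤ l' 0 := by
          refine ha.2.le.trans ?_
          have := h.le (-n)
          simp only [hl']
          push_cast
          rwa [show (-n : ℤ) + 1 = 0 + 1 - n by ring] at this
        rw [indicator_of_mem ha, ← infinitePi_stepsIn hγ (2 * n) hlu hul ha', ← hcast,
          Measure.map_apply (by fun_prop) (msteps a),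
          ← lintegral_indicator_one ((by fun_prop : Measurable fun (τ : ℤ → ℝ) (i : ℕ) => τ (i : ℤ))
            (msteps a))]
        refine lintegral_congr fun τ => ?_
        have : pointsOf a τ ∈ S ↔ τ ∈ (fun (τ : ℤ → ℝ) (i : ℕ) => τ (i : ℤ)) ⁻¹'
            {τ | StepsIn (2 * n + 1) l' u' a τ} := by
          change _ ↔ StepsIn (2 * n + 1) l' u' a (fun i => τ i)
          rw [stepsIn_pointsOf_iff]
          change (pointsOf a τ 0 ∈ _ ∧ _) ↔ _
          rw [pointsOf_zero]
          exact and_iff_right ha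
        by_cases hm : pointsOf a τ ∈ S
        · rw [indicator_of_mem hm, indicator_of_mem (this.1 hm)]
          rfl
        · rw [indicator_of_notMem hm, indicator_of_notMem fun h => hm (this.2 h)]
      · rw [indicator_of_notMem ha]
        refine (lintegral_congr fun τ => ?_).trans lintegral_zero
        refine indicator_of_notMem (fun hs => ha ?_) _
        have := hs.1
        rwa [pointsOf_zero] at this
    simp_rw [hin]
    have hab : l (-n) ≤ u (-n) := (h.lt _).le
    have hI : ∫⁻ a in Ioo (l (-n)) (u (-n)), ENNReal.ofReal (γ * (Real.exp (γ * a) * c)) =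
        ENNReal.ofReal ((Real.exp (γ * u (-n)) - Real.exp (γ * l (-n))) * c) := by
      have hcont : Continuous fun a => γ * (Real.exp (γ * a) * c) := by fun_prop
      have hd : ∀ x ∈ uIcc (l (-n)) (u (-n)), HasDerivAt (fun a => Real.exp (γ * a) * c)
          (γ * (Real.exp (γ * x) * c)) x := by
        intro x _
        have h1 : HasDerivAt (fun a => γ * a) γ x := by
          simpa using (hasDerivAt_id x).const_mul γ
        have := h1.exp.mul_const c
        convert! this using 1
        ring
      rw [← ofReal_integral_eq_lintegral_ofReal, ← integral_Ioc_eq_integral_Ioo,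
        ← intervalIntegral.integral_of_le hab,
        intervalIntegral.integral_eq_sub_of_hasDerivAt hd (hcont.intervalIntegrable _ _), sub_mul]
      · exact (hcont.integrableOn_Icc).mono_set Ioo_subset_Icc_self
      · exact ae_of_all _ fun a => by positivity
    rw [lintegral_indicator measurableSet_Ioo, ← lintegral_const_mul _ (by fun_prop)]
    simp_rw [← ENNReal.ofReal_mul hγ.le]
    rw [hI, hc]
    simp only [hl', hu']
    push_cast
    rw [show 2 * (n : ℤ) + 1 - n = n + 1 by ring]
  · exact ((measurable_one.indicator mS).comp
      (measurable_pointsOf.comp measurable_swap)).aemeasurable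

end BoxLaw

/-! ### Total mass and almost sure properties of the stationary measure -/

lemma measurableSet_biInfinite : MeasurableSet {t : ℤ → ℝ | BiInfinite t} := by
  have : {t : ℤ → ℝ | BiInfinite t} = (⋂ k : ℤ, {t | t k < t (k + 1)}) ∩
      ((⋂ n : ℕ, ⋃ k : ℤ, {t | t k < -(n : ℝ)}) ∩ ⋂ n : ℕ, ⋃ k : ℤ, {t | (n : ℝ) < t k}) := by
    ext t
    simp only [mem_inter_iff, mem_iInter, mem_iUnion]
    constructor
    · intro h
      exact ⟨fun k => h.strictMono (by omega), fun n => h.exists_lt _, fun n => h.exists_gt _⟩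
    · rintro ⟨h1, h2, h3⟩
      refine ⟨strictMono_int_of_lt_succ h1, fun x => ?_, fun x => ?_⟩
      · obtain ⟨n, hn⟩ := exists_nat_gt (-x)
        obtain ⟨k, hk⟩ := h2 n
        have hk' : t k < -n := hk
        exact ⟨k, by linarith⟩
      · obtain ⟨n, hn⟩ := exists_nat_gt x
        obtain ⟨k, hk⟩ := h3 n
        have hk' : (n : ℝ) < t k := hk
        exact ⟨k, by linarith⟩
  rw [this]
  refine (MeasurableSet.iInter fun k => measurableSet_lt (by fun_prop) (by fun_prop)).inter
    ((MeasurableSet.iInter fun n => MeasurableSet.iUnion fun k => ?_).inter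
    (MeasurableSet.iInter fun n => MeasurableSet.iUnion fun k => ?_))
  · exact measurableSet_lt (by fun_prop) (by fun_prop)
  · exact measurableSet_lt (by fun_prop) (by fun_prop)

section

variable {γ : ℝ}

lemma ae_pointsLaw_biInfinite (hγ : 0 < γ) :
    ∀ᵐ t ∂(pointsLaw γ (Measure.infinitePi fun _ : ℤ => gammaMeasure 1 γ)), BiInfinite t := by
  have hp := isProbabilityMeasure_gammaMeasure one_pos hγ
  rw [pointsLaw, ae_map_iff measurable_pointsOf.aemeasurable measurableSet_biInfinite]
  have := Measure.quasiMeasurePreserving_snd (μ := ENNReal.ofReal γ • (volume : Measure ℝ)).ae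
    (ae_biInfinite_pointsOf hγ)
  filter_upwards [this] with p hp using hp p.1

lemma ae_pointsLaw_ne_zero (κ : Measure (ℤ → ℝ)) [SFinite κ] :
    ∀ᵐ t ∂(pointsLaw γ κ), t 0 ≠ 0 := by
  have hm : MeasurableSet {t : ℤ → ℝ | t 0 ≠ 0} :=
    (measurable_pi_apply 0) (measurableSet_singleton 0).compl
  rw [pointsLaw, ae_map_iff measurable_pointsOf.aemeasurable hm]
  have h0 : ∀ᵐ x ∂(ENNReal.ofReal γ • (volume : Measure ℝ)), x ≠ 0 :=
    Measure.ae_smul_measure (by simp [ae_iff]) _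
  have := (Measure.quasiMeasurePreserving_fst (ν := κ)).ae h0
  filter_upwards [this] with p hp
  rwa [pointsOf_zero]

/-- For fixed gaps the admissible initial points form an interval of length `τ 0`; its expected
length is `1 / γ`, compensating the factor `γ`. -/
lemma pointsLaw_centred (hγ : 0 < γ) :
    pointsLaw γ (Measure.infinitePi fun _ : ℤ => gammaMeasure 1 γ) centred = 1 := by
  have hp := isProbabilityMeasure_gammaMeasure one_pos hγ
  rw [← lintegral_indicator_one measurableSet_centred,
    lintegral_pointsLaw (measurable_one.indicator measurableSet_centred)]
  have hin : ∀ τ : ℤ → ℝ, ∫⁻ a, centred.indicator 1 (pointsOf a τ) = ENNReal.ofReal (τ 0) := by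
    intro τ
    have : ∀ a, centred.indicator (1 : (ℤ → ℝ) → ENNReal) (pointsOf a τ) =
        (Ioc (-τ 0) 0).indicator 1 a := by
      intro a
      have h1 := pointsOf_add_one a τ 0
      rw [pointsOf_zero, zero_add] at h1
      have : pointsOf a τ ∈ centred ↔ a ∈ Ioc (-τ 0) 0 := by
        change (pointsOf a τ 0 ≤ 0 ∧ 0 < pointsOf a τ 1) ↔ _
        rw [h1, pointsOf_zero, mem_Ioc, neg_lt_iff_pos_add, and_comm]
      by_cases h : a ∈ Ioc (-τ 0) 0
      · rw [indicator_of_mem h, indicator_of_mem (this.2 h)]; rfl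
      · rw [indicator_of_notMem h, indicator_of_notMem fun h' => h (this.1 h')]
    simp_rw [this]
    rw [lintegral_indicator_one measurableSet_Ioc, Real.volume_Ioc]
    simp
  simp_rw [hin]
  have hmap : ∫⁻ τ, ENNReal.ofReal (τ 0) ∂(Measure.infinitePi fun _ : ℤ => gammaMeasure 1 γ) =
      ∫⁻ x, ENNReal.ofReal x ∂(gammaMeasure 1 γ) := by
    conv_rhs => rw [← Measure.infinitePi_map_eval (fun _ : ℤ => gammaMeasure 1 γ) 0]
    rw [lintegral_map (by fun_prop) (by fun_prop)]
  have h1 := integral_pow_gammaMeasure_one hγ 1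
  have h2 := integrable_pow_gammaMeasure_one hγ 1
  simp only [pow_one] at h1 h2
  rw [hmap, ← ofReal_integral_eq_lintegral_ofReal h2
    (by filter_upwards [gammaMeasure_one_ae_pos] with x hx using hx.le), h1,
    ← ENNReal.ofReal_mul hγ.le, Nat.factorial_one, Nat.cast_one, mul_one_div_cancel hγ.ne',
    ENNReal.ofReal_one]

end

/-! ### Ordered boxes in terms of counts -/

lemma pointMeasure_range_eq_zero_iff (t : ℤ → ℝ) {B : Set ℝ} (hB : MeasurableSet B) :
    pointMeasure (range t) B = 0 ↔ ∀ k, t k ∉ B := by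
  rw [pointMeasure_range_apply t hB, ENat.toENNReal_eq_zero, encard_eq_zero,
    eq_empty_iff_forall_notMem]
  constructor
  · intro h k hk
    exact h _ ⟨⟨k, rfl⟩, hk⟩
  · rintro h _ ⟨⟨k, rfl⟩, hk⟩
    exact h k hk

lemma pointMeasure_range_eq_one_iff {t : ℤ → ℝ} (ht : StrictMono t) {B : Set ℝ}
    (hB : MeasurableSet B) : pointMeasure (range t) B = 1 ↔ ∃! k, t k ∈ B := by
  rw [pointMeasure_range_apply t hB, ← ENat.toENNReal_one, ENat.toENNReal_inj, encard_eq_one]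
  constructor
  · rintro ⟨x, hx⟩
    obtain ⟨⟨k, rfl⟩, hk⟩ : x ∈ range t ∩ B := hx ▸ rfl
    refine ⟨k, hk, fun j hj => ?_⟩
    have : t j ∈ ({t k} : Set ℝ) := hx ▸ ⟨⟨j, rfl⟩, hj⟩
    exact ht.injective this
  · rintro ⟨k, hk, huniq⟩
    refine ⟨t k, ?_⟩
    ext x
    constructor
    · rintro ⟨⟨j, rfl⟩, hj⟩
      rw [huniq j hj]; rfl
    · rintro rfl
      exact ⟨⟨k, rfl⟩, hk⟩

/-- Expresses a box through counts on disjoint sets. The outermost intervals need only be nonempty,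
since points beyond `t (-n)` and `t (n + 1)` are unconstrained. For the converse, centring
identifies the points nearest to the origin, and one moves outwards: an inner interval holds one
point, the gap after it none, and the next interval some point. -/
lemma BiInfinite.mem_orderedBox_iff {t : ℤ → ℝ} (ht : BiInfinite t) (h0 : t ∈ centred) (n : ℕ)
    {l u : ℤ → ℝ} (h : OrderedIntervals l u) :
    t ∈ orderedBox n l u ↔
      (∀ k : ℤ, -n ≤ k → k ≤ n + 1 → ∃ j, t j ∈ Ioo (l k) (u k)) ∧
      (∀ k : ℤ, -n < k → k < n + 1 → ∃! j, t j ∈ Ioo (l k) (u k)) ∧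
      (∀ k : ℤ, -n ≤ k → k < n + 1 → ∀ j, t j ∉ Icc (u k) (l (k + 1))) := by
  have hlt : ∀ {i j : ℤ}, t i < t j → i < j := fun h => ht.strictMono.lt_iff_lt.1 h
  constructor
  · intro hb
    have hb : ∀ k : ℤ, -n ≤ k → k ≤ n + 1 → t k ∈ Ioo (l k) (u k) := fun k h1 h2 =>
      hb k (Finset.mem_Icc.2 ⟨h1, h2⟩)
    refine ⟨fun k h1 h2 => ⟨k, hb k h1 h2⟩, fun k h1 h2 => ⟨k, hb k h1.le h2.le, fun j hj => ?_⟩,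
      fun k h1 h2 j hj => ?_⟩
    · have a1 := hb (k - 1) (by omega) (by omega)
      have a2 := hb (k + 1) (by omega) (by omega)
      have e1 := h.le (k - 1)
      rw [sub_add_cancel] at e1
      have b1 := hlt (a1.2.trans (e1.trans_lt hj.1))
      have b2 := hlt (hj.2.trans ((h.le k).trans_lt a2.1))
      omega
    · have b1 := hlt ((hb k h1 h2.le).2.trans_le hj.1)
      have b2 := hlt (hj.2.trans_lt (hb (k + 1) (by omega) (by omega)).1)
      omega
  · rintro ⟨hex, huniq, hgap⟩
    have up : ∀ m : ℕ, m ≤ n → t (m + 1) ∈ Ioo (l (m + 1)) (u (m + 1)) := by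
      intro m
      induction m with
      | zero =>
        intro _
        simp only [Nat.cast_zero, zero_add]
        obtain ⟨k, hk⟩ := hex 1 (by omega) (by omega)
        have hk1 := (ht.pos_iff h0 k).1 (h.right.trans_lt hk.1)
        refine ⟨not_le.1 fun hle => hgap 0 (by omega) (by omega) 1 ⟨h.left.trans h0.2.le, ?_⟩,
          (ht.strictMono.monotone hk1).trans_lt hk.2⟩
        rwa [zero_add]
      | succ m ih =>
        intro hm
        have ih := ih (by omega)
        push_cast at ih ⊢
        set j : ℤ := (m : ℤ) + 1 with hj
        have hjj : t j < t (j + 1) := ht.strictMono (by omega)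
        -- Uniqueness keeps the next point out of interval `j`, emptiness keeps it out of the gap,
        -- and a point in interval `j + 1` prevents it from lying beyond.
        obtain ⟨i, hi, hiu⟩ := huniq j (by omega) (by omega)
        have hni : t (j + 1) ∉ Ioo (l j) (u j) := fun hmem => by
          have e1 := hiu (j + 1) hmem
          have e2 := hiu j ih
          omega
        have hge : u j ≤ t (j + 1) := not_lt.1 fun hlt' => hni ⟨ih.1.trans hjj, hlt'⟩
        have hgt : l (j + 1) < t (j + 1) := not_le.1 fun hle =>
          hgap j (by omega) (by omega) (j + 1) ⟨hge, hle⟩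
        refine ⟨hgt, not_le.1 fun hle => ?_⟩
        obtain ⟨k, hk⟩ := hex (j + 1) (by omega) (by omega)
        have b1 := hlt (hk.2.trans_le hle)
        have b2 := hlt (ih.2.trans ((h.le j).trans_lt hk.1))
        omega
    have down : ∀ m : ℕ, m ≤ n → t (-m) ∈ Ioo (l (-m)) (u (-m)) := by
      intro m
      induction m with
      | zero =>
        intro _
        simp only [Nat.cast_zero, neg_zero]
        obtain ⟨k, hk⟩ := hex 0 (by omega) (by omega)
        have hk1 : ¬ (1 : ℤ) ≤ k := fun h1 =>
          ((ht.pos_iff h0 k).2 h1).not_gt (hk.2.trans_le h.left)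
        refine ⟨hk.1.trans_le (ht.strictMono.monotone (by omega)), not_le.1 fun hle =>
          hgap 0 (by omega) (by omega) 0 ⟨hle, h0.1.trans ?_⟩⟩
        rw [zero_add]
        exact h.right
      | succ m ih =>
        intro hm
        have ih := ih (by omega)
        push_cast at ih ⊢
        rw [show (-((m : ℤ) + 1)) = -m - 1 by ring]
        set j : ℤ := -(m : ℤ) with hj
        have hjj : t (j - 1) < t j := ht.strictMono (by omega)
        have hle1 := h.le (j - 1)
        rw [sub_add_cancel] at hle1
        obtain ⟨i, hi, hiu⟩ := huniq j (by omega) (by omega)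
        have hni : t (j - 1) ∉ Ioo (l j) (u j) := fun hmem => by
          have e1 := hiu (j - 1) hmem
          have e2 := hiu j ih
          omega
        have hle : t (j - 1) ≤ l j := not_lt.1 fun hlt' => hni ⟨hlt', hjj.trans ih.2⟩
        have hlt1 : t (j - 1) < u (j - 1) := not_le.1 fun hle' =>
          hgap (j - 1) (by omega) (by omega) (j - 1) ⟨hle', by rwa [sub_add_cancel]⟩
        refine ⟨not_le.1 fun hle' => ?_, hlt1⟩
        obtain ⟨k, hk⟩ := hex (j - 1) (by omega) (by omega)
        have b1 := hlt (hle'.trans_lt hk.1)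
        have b2 := hlt (hk.2.trans_le (hle1.trans ih.1.le))
        omega
    intro k hk
    rw [Finset.mem_Icc] at hk
    rcases le_or_gt k 0 with hk0 | hk0
    · have := down k.natAbs (by omega)
      rwa [show -((k.natAbs : ℕ) : ℤ) = k by omega] at this
    · have := up (k - 1).toNat (by omega)
      rwa [Int.toNat_of_nonneg (by omega), sub_add_cancel] at this

/-! ### The points of a homogeneous Poisson process -/

namespace IsHomogeneousPoisson

variable {Ω : Type*} [MeasurableSpace Ω] {γ : ℝ} {T : Ω → Set ℝ} {P : Measure Ω}

lemma countable (hT : IsHomogeneousPoisson γ T P) (ω : Ω) : (T ω).Countable := by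
  have : T ω = ⋃ n : ℕ, T ω ∩ Icc (-n : ℝ) n := by
    ext x
    simp only [mem_iUnion]
    constructor
    · intro hx
      obtain ⟨n, hn⟩ := exists_nat_ge |x|
      exact ⟨n, hx, abs_le.1 hn⟩
    · rintro ⟨n, hx, -⟩
      exact hx
  rw [this]
  exact countable_iUnion fun n => (hT.locallyFinite ω _ _).countable

lemma pointMeasure_eq_zero_iff (hT : IsHomogeneousPoisson γ T P) (ω : Ω) {B : Set ℝ}
    (hB : MeasurableSet B) : pointMeasure (T ω) B = 0 ↔ T ω ∩ B = ∅ := by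
  rw [pointMeasure_apply_of_countable (hT.countable ω) hB, ENat.toENNReal_eq_zero, encard_eq_zero]

lemma measure_count_mem (hT : IsHomogeneousPoisson γ T P) {B : Set ℝ} (hB : MeasurableSet B)
    (hB' : volume B ≠ ⊤) {A : Set ENNReal} (hA : MeasurableSet A) :
    P {ω | pointMeasure (T ω) B ∈ A} =
      poissonMeasure (γ * volume.real B).toNNReal {n : ℕ | (n : ENNReal) ∈ A} := by
  rw [(hT.hasLaw_count B hB hB').measure_eq (p := fun x => x ∈ A) hA]
  exact Measure.map_apply (by fun_prop) hA

lemma measure_count_eq_zero (hT : IsHomogeneousPoisson γ T P) (hγ : 0 < γ) {B : Set ℝ}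
    (hB : MeasurableSet B) (hB' : volume B ≠ ⊤) :
    P {ω | pointMeasure (T ω) B ∈ ({0} : Set ENNReal)} =
      ENNReal.ofReal (Real.exp (-(γ * volume.real B))) := by
  rw [hT.measure_count_mem hB hB' (measurableSet_singleton 0)]
  have : {n : ℕ | (n : ENNReal) ∈ ({0} : Set ENNReal)} = {0} := by ext; simp
  rw [this, poissonMeasure_singleton, Real.coe_toNNReal _ (by positivity)]
  simp

lemma measure_count_eq_one (hT : IsHomogeneousPoisson γ T P) (hγ : 0 < γ) {B : Set ℝ}
    (hB : MeasurableSet B) (hB' : volume B ≠ ⊤) :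
    P {ω | pointMeasure (T ω) B ∈ ({1} : Set ENNReal)} =
      ENNReal.ofReal (γ * volume.real B * Real.exp (-(γ * volume.real B))) := by
  rw [hT.measure_count_mem hB hB' (measurableSet_singleton 1)]
  have : {n : ℕ | (n : ENNReal) ∈ ({1} : Set ENNReal)} = {1} := by ext; simp
  rw [this, poissonMeasure_singleton, Real.coe_toNNReal _ (by positivity)]
  simp [mul_comm]

lemma measure_count_ne_zero (hT : IsHomogeneousPoisson γ T P) (hγ : 0 < γ) {B : Set ℝ}
    (hB : MeasurableSet B) (hB' : volume B ≠ ⊤) :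
    P {ω | pointMeasure (T ω) B ∈ ({0}ᶜ : Set ENNReal)} =
      ENNReal.ofReal (1 - Real.exp (-(γ * volume.real B))) := by
  rw [hT.measure_count_mem hB hB' (measurableSet_singleton 0).compl]
  have : {n : ℕ | (n : ENNReal) ∈ ({0}ᶜ : Set ENNReal)} = {0}ᶜ := by ext; simp
  rw [this, prob_compl_eq_one_sub (measurableSet_singleton 0), poissonMeasure_singleton,
    Real.coe_toNNReal _ (by positivity), ENNReal.ofReal_sub _ (by positivity)]
  simp

/-- The probability that `S` contains no point is at most the void probability `exp (-γ n)` of `B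
n`, for every `n`. -/
lemma ae_inter_nonempty (hT : IsHomogeneousPoisson γ T P) (hγ : 0 < γ) {B : ℕ → Set ℝ} {S : Set ℝ}
    (hB : ∀ n, MeasurableSet (B n)) (hvol : ∀ n, volume (B n) = n) (hS : ∀ n, B n ⊆ S) :
    ∀ᵐ ω ∂P, (T ω ∩ S).Nonempty := by
  have hle : ∀ n : ℕ, P {ω | ¬ (T ω ∩ S).Nonempty} ≤ ENNReal.ofReal (Real.exp (-(γ * n))) := by
    intro n
    have h1 := hT.measure_count_eq_zero hγ (hB n) (by rw [hvol]; simp)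
    rw [Measure.real, hvol n, ENNReal.toReal_natCast] at h1
    rw [← h1]
    refine measure_mono fun ω hω => ?_
    change pointMeasure (T ω) (B n) = 0
    rw [hT.pointMeasure_eq_zero_iff ω (hB n)]
    exact subset_eq_empty (inter_subset_inter_right _ (hS n)) (not_nonempty_iff_eq_empty.1 hω)
  have hlim : Filter.Tendsto (fun n : ℕ => ENNReal.ofReal (Real.exp (-(γ * n)))) Filter.atTop
      (nhds 0) := by
    rw [← ENNReal.ofReal_zero]
    refine ENNReal.tendsto_ofReal (Real.tendsto_exp_neg_atTop_nhds_zero.comp ?_)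
    exact Filter.Tendsto.const_mul_atTop hγ tendsto_natCast_atTop_atTop
  exact le_antisymm (ge_of_tendsto' hlim hle) zero_le

/-- Almost surely, the points of a homogeneous Poisson process form a two-sided sequence. -/
lemma ae_exists_biInfinite (hT : IsHomogeneousPoisson γ T P) (hγ : 0 < γ) :
    ∀ᵐ ω ∂P, ∃ t, BiInfinite t ∧ t ∈ centred ∧ range t = T ω := by
  have h1 : ∀ᵐ ω ∂P, ∀ m : ℕ, (T ω ∩ Ioi (m : ℝ)).Nonempty :=
    ae_all_iff.2 fun m => hT.ae_inter_nonempty hγ (B := fun n => Ioc (m : ℝ) (m + n))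
      (fun n => measurableSet_Ioc) (fun n => by simp) (fun n x hx => hx.1)
  have h2 : ∀ᵐ ω ∂P, ∀ m : ℕ, (T ω ∩ Iio (-m : ℝ)).Nonempty :=
    ae_all_iff.2 fun m => hT.ae_inter_nonempty hγ (B := fun n => Ico (-m - n : ℝ) (-m))
      (fun n => measurableSet_Ico) (fun n => by simp) (fun n x hx => hx.2)
  filter_upwards [h1, h2] with ω h1 h2
  refine exists_biInfinite_range (hT.locallyFinite ω) (fun x => ?_) fun x => ?_
  · obtain ⟨m, hm⟩ := exists_nat_gt x
    obtain ⟨s, hs, hs'⟩ := h1 m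
    exact ⟨s, hs, hm.trans hs'⟩
  · obtain ⟨m, hm⟩ := exists_nat_gt (-x)
    obtain ⟨s, hs, hs'⟩ := h2 m
    have hs'' : s < -m := hs'
    exact ⟨s, hs, by linarith⟩

lemma ae_zero_notMem (hT : IsHomogeneousPoisson γ T P) (hγ : 0 < γ) [IsProbabilityMeasure P] :
    ∀ᵐ ω ∂P, (0 : ℝ) ∉ T ω := by
  have h := hT.measure_count_eq_zero hγ (measurableSet_singleton (0 : ℝ)) (by simp)
  simp only [Measure.real, Real.volume_singleton, ENNReal.toReal_zero, mul_zero, neg_zero,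
    Real.exp_zero, ENNReal.ofReal_one] at h
  have hm : NullMeasurableSet {ω | pointMeasure (T ω) {0} ∈ ({0} : Set ENNReal)} P :=
    ((Measure.measurable_coe (measurableSet_singleton (0 : ℝ))).comp hT.measurable
      (measurableSet_singleton 0)).nullMeasurableSet
  have h' : ∀ᵐ ω ∂P, pointMeasure (T ω) {0} = 0 := (prob_compl_eq_zero_iff₀ hm).2 h
  filter_upwards [h'] with ω hω h0
  rw [hT.pointMeasure_eq_zero_iff ω (measurableSet_singleton 0)] at hω
  exact (hω.subset ⟨h0, rfl⟩)

lemma iIndepFun_of_fintype (hT : IsHomogeneousPoisson γ T P) {ι : Type*} [Fintype ι]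
    {B : ι → Set ℝ} (hB : ∀ i, MeasurableSet (B i)) (hB' : ∀ i, volume (B i) ≠ ⊤)
    (hd : Pairwise fun i j => Disjoint (B i) (B j)) :
    iIndepFun (fun i ω => pointMeasure (T ω) (B i)) P := by
  let e := Fintype.equivFin ι
  have := hT.indep_count (Fintype.card ι) (fun i => B (e.symm i)) (fun i => hB _) (fun i => hB' _)
    fun i j hij => hd (fun h => hij (e.symm.injective h))
  have := this.precomp e.injective
  simpa using this

end IsHomogeneousPoisson

/-- The left side is the product of the Poisson probabilities of the counts, the right side the box
probability for exponential gaps. The exponentials of inner lengths and of gaps telescope to `exp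
(-γ (l (K + 1) - u 0))`, which the two outer factors absorb. -/
lemma box_probability_identity (γ : ℝ) (l u : ℕ → ℝ) (K : ℕ) :
    (1 - Real.exp (-(γ * (u 0 - l 0)))) *
      (∏ i ∈ Finset.range K, γ * (u (i + 1) - l (i + 1)) *
        Real.exp (-(γ * (u (i + 1) - l (i + 1))))) *
      (1 - Real.exp (-(γ * (u (K + 1) - l (K + 1))))) *
      (∏ i ∈ Finset.range (K + 1), Real.exp (-(γ * (l (i + 1) - u i)))) =
    (Real.exp (γ * u 0) - Real.exp (γ * l 0)) *
      ((∏ i ∈ Finset.range K, γ * (u (i + 1) - l (i + 1))) *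
        (Real.exp (-(γ * l (K + 1))) - Real.exp (-(γ * u (K + 1))))) := by
  have htel : (∏ i ∈ Finset.range K, Real.exp (-(γ * (u (i + 1) - l (i + 1))))) *
      (∏ i ∈ Finset.range (K + 1), Real.exp (-(γ * (l (i + 1) - u i)))) =
      Real.exp (γ * u 0) * Real.exp (-(γ * l (K + 1))) := by
    induction K with
    | zero =>
      simp only [Finset.range_zero, Finset.prod_empty, one_mul, zero_add, Finset.prod_range_one]
      rw [← Real.exp_add]
      congr 1; ring
    | succ K ih =>
      rw [Finset.prod_range_succ, Finset.prod_range_succ _ (K + 1)]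
      calc _ = ((∏ i ∈ Finset.range K, Real.exp (-(γ * (u (i + 1) - l (i + 1))))) *
          (∏ i ∈ Finset.range (K + 1), Real.exp (-(γ * (l (i + 1) - u i))))) *
          (Real.exp (-(γ * (u (K + 1) - l (K + 1)))) *
            Real.exp (-(γ * (l (K + 1 + 1) - u (K + 1))))) := by ring
        _ = _ := by
          rw [ih, ← Real.exp_add, ← Real.exp_add, ← Real.exp_add, ← Real.exp_add]
          congr 1; ring
  have e1 : (1 - Real.exp (-(γ * (u 0 - l 0)))) * Real.exp (γ * u 0) =
      Real.exp (γ * u 0) - Real.exp (γ * l 0) := by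
    rw [sub_mul, one_mul, ← Real.exp_add]
    congr 2; ring
  have e2 : (1 - Real.exp (-(γ * (u (K + 1) - l (K + 1))))) * Real.exp (-(γ * l (K + 1))) =
      Real.exp (-(γ * l (K + 1))) - Real.exp (-(γ * u (K + 1))) := by
    rw [sub_mul, one_mul, ← Real.exp_add]
    congr 2; ring
  rw [← e1, ← e2, Finset.prod_mul_distrib]
  linear_combination ((1 - Real.exp (-(γ * (u 0 - l 0)))) *
    (∏ i ∈ Finset.range K, γ * (u (i + 1) - l (i + 1))) *
    (1 - Real.exp (-(γ * (u (K + 1) - l (K + 1)))))) * htel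

namespace IsHomogeneousPoisson

variable {Ω : Type*} [MeasurableSpace Ω] {γ : ℝ} {T : Ω → Set ℝ} {P : Measure Ω}

lemma measure_box_counts (hT : IsHomogeneousPoisson γ T P) (hγ : 0 < γ) (K : ℕ) {l u : ℕ → ℝ}
    (hlu : ∀ i, l i < u i) (hul : ∀ i, u i ≤ l (i + 1)) :
    P {ω | (∀ i < K + 2, pointMeasure (T ω) (Ioo (l i) (u i)) ∈
        (if i = 0 ∨ i = K + 1 then {0}ᶜ else {1} : Set ENNReal)) ∧
      ∀ i < K + 1, pointMeasure (T ω) (Icc (u i) (l (i + 1))) ∈ ({0} : Set ENNReal)} =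
    ENNReal.ofReal ((Real.exp (γ * u 0) - Real.exp (γ * l 0)) *
      ((∏ i ∈ Finset.range K, γ * (u (i + 1) - l (i + 1))) *
        (Real.exp (-(γ * l (K + 1))) - Real.exp (-(γ * u (K + 1)))))) := by
  have hmono : ∀ {i j : ℕ}, i < j → u i ≤ l j := by
    intro i j hij
    have hl : Monotone l := monotone_nat_of_le_succ fun i => (hlu i).le.trans (hul i)
    exact (hul i).trans (hl hij)
  have hlu' : ∀ {i j : ℕ}, i ≤ j → l i < u j := by
    intro i j hij
    rcases hij.eq_or_lt with rfl | hij
    · exact hlu i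
    · exact (hlu i).trans_le ((hmono hij).trans (hlu j).le)
  -- The open intervals and the closed gaps between them form one disjoint family, so independence
  -- of the counts is used once for all of them.
  let B : Fin (K + 2) ⊕ Fin (K + 1) → Set ℝ :=
    Sum.elim (fun i => Ioo (l i) (u i)) (fun i => Icc (u i) (l (i + 1)))
  let A : Fin (K + 2) ⊕ Fin (K + 1) → Set ENNReal :=
    Sum.elim (fun i => if (i : ℕ) = 0 ∨ (i : ℕ) = K + 1 then {0}ᶜ else {1}) (fun _ => {0})
  have hB : ∀ i, MeasurableSet (B i) := by
    rintro (i | i)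
    · exact measurableSet_Ioo
    · exact measurableSet_Icc
  have hB' : ∀ i, volume (B i) ≠ ⊤ := by
    rintro (i | i)
    · exact measure_Ioo_lt_top.ne
    · exact measure_Icc_lt_top.ne
  have hA : ∀ i, MeasurableSet (A i) := by
    rintro (i | i)
    · simp only [A, Sum.elim_inl]
      split_ifs
      · exact (measurableSet_singleton 0).compl
      · exact measurableSet_singleton 1
    · exact measurableSet_singleton 0
  have hd : Pairwise fun i j => Disjoint (B i) (B j) := by
    have h1 : ∀ i j : ℕ, i < j → Disjoint (Ioo (l i) (u i)) (Ioo (l j) (u j)) := by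
      intro i j hij
      rw [Set.disjoint_left]
      intro x hx hx'
      exact absurd (hx.2.trans_le (hmono hij)) hx'.1.not_gt
    have h2 : ∀ i j : ℕ, i < j → Disjoint (Icc (u i) (l (i + 1))) (Icc (u j) (l (j + 1))) := by
      intro i j hij
      rw [Set.disjoint_left]
      intro x hx hx'
      exact absurd (hx'.1.trans hx.2) (hlu' hij).not_ge
    have h3 : ∀ i j : ℕ, Disjoint (Ioo (l i) (u i)) (Icc (u j) (l (j + 1))) := by
      intro i j
      rw [Set.disjoint_left]
      intro x hx hx'
      rcases le_or_gt i j with hij | hij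
      · rcases hij.eq_or_lt with rfl | hij
        · exact absurd hx.2 hx'.1.not_gt
        · exact absurd (hx.2.trans ((hmono hij).trans_lt (hlu j))) hx'.1.not_gt
      · have hl : Monotone l := monotone_nat_of_le_succ fun i => (hlu i).le.trans (hul i)
        exact absurd (hx'.2.trans (hl hij)) hx.1.not_ge
    rintro (i | i) (j | j) hij
    · rcases lt_or_gt_of_ne (fun h => hij (by rw [Fin.ext h]) : (i : ℕ) ≠ j) with h | h
      · exact h1 i j h
      · exact (h1 j i h).symm
    · exact h3 i j
    · exact (h3 j i).symm
    · rcases lt_or_gt_of_ne (fun h => hij (by rw [Fin.ext h]) : (i : ℕ) ≠ j) with h | h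
      · exact h2 i j h
      · exact (h2 j i h).symm
  have hind := (hT.iIndepFun_of_fintype hB hB' hd).measure_inter_preimage_eq_mul Finset.univ
    (sets := A) (fun i _ => hA i)
  have hset : {ω | (∀ i < K + 2, pointMeasure (T ω) (Ioo (l i) (u i)) ∈
        (if i = 0 ∨ i = K + 1 then {0}ᶜ else {1} : Set ENNReal)) ∧
      ∀ i < K + 1, pointMeasure (T ω) (Icc (u i) (l (i + 1))) ∈ ({0} : Set ENNReal)} =
      ⋂ i ∈ Finset.univ, (fun ω => pointMeasure (T ω) (B i)) ⁻¹' A i := by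
    ext ω
    simp only [Finset.mem_univ, iInter_true, mem_iInter, mem_preimage]
    constructor
    · rintro ⟨h1, h2⟩ (i | i)
      · exact h1 i i.2
      · exact h2 i i.2
    · intro h
      exact ⟨fun i hi => h (Sum.inl ⟨i, hi⟩), fun i hi => h (Sum.inr ⟨i, hi⟩)⟩
  let f : ℕ → ℝ := fun i => if i = 0 ∨ i = K + 1 then 1 - Real.exp (-(γ * (u i - l i)))
    else γ * (u i - l i) * Real.exp (-(γ * (u i - l i)))
  have hf0 : ∀ i, 0 ≤ f i := by
    intro i
    have : 0 < γ * (u i - l i) := mul_pos hγ (sub_pos.2 (hlu i))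
    simp only [f]
    split_ifs
    · rw [sub_nonneg, Real.exp_le_one_iff]; linarith
    · positivity
  have hvol : ∀ i, volume.real (Ioo (l i) (u i)) = u i - l i := fun i => by
    rw [Real.volume_real_Ioo_of_le (hlu i).le]
  have hvol' : ∀ i, volume.real (Icc (u i) (l (i + 1))) = l (i + 1) - u i := fun i => by
    rw [Real.volume_real_Icc_of_le (hul i)]
  have hl1 : ∀ i : Fin (K + 2), P ((fun ω => pointMeasure (T ω) (B (Sum.inl i))) ⁻¹'
      A (Sum.inl i)) = ENNReal.ofReal (f i) := by
    intro i
    simp only [A, B, Sum.elim_inl, f]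
    split_ifs with hi
    · rw [← hvol]
      exact hT.measure_count_ne_zero hγ measurableSet_Ioo measure_Ioo_lt_top.ne
    · rw [← hvol]
      exact hT.measure_count_eq_one hγ measurableSet_Ioo measure_Ioo_lt_top.ne
  have hl2 : ∀ i : Fin (K + 1), P ((fun ω => pointMeasure (T ω) (B (Sum.inr i))) ⁻¹'
      A (Sum.inr i)) = ENNReal.ofReal (Real.exp (-(γ * (l ((i : ℕ) + 1) - u i)))) := by
    intro i
    rw [← hvol']
    exact hT.measure_count_eq_zero hγ measurableSet_Icc measure_Icc_lt_top.ne
  rw [hset, hind, Fintype.prod_sum_type]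
  simp_rw [hl1, hl2]
  rw [Fin.prod_univ_eq_prod_range (fun i => ENNReal.ofReal (f i)),
    Fin.prod_univ_eq_prod_range
      (fun i => ENNReal.ofReal (Real.exp (-(γ * (l (i + 1) - u i))))),
    ← ENNReal.ofReal_prod_of_nonneg fun i _ => hf0 i,
    ← ENNReal.ofReal_prod_of_nonneg fun i _ => (Real.exp_pos _).le,
    ← ENNReal.ofReal_mul (Finset.prod_nonneg fun i _ => hf0 i), ← box_probability_identity]
  congr 1
  rw [Finset.prod_range_succ, Finset.prod_range_succ']
  have hf1 : f 0 = 1 - Real.exp (-(γ * (u 0 - l 0))) := by simp [f]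
  have hf2 : f (K + 1) = 1 - Real.exp (-(γ * (u (K + 1) - l (K + 1)))) := by simp [f]
  have hf3 : ∏ i ∈ Finset.range K, f (i + 1) = ∏ i ∈ Finset.range K, γ * (u (i + 1) - l (i + 1)) *
        Real.exp (-(γ * (u (i + 1) - l (i + 1)))) := by
    refine Finset.prod_congr rfl fun i hi => ?_
    have := Finset.mem_range.1 hi
    simp only [f]
    rw [if_neg (by omega)]
  rw [hf1, hf2, hf3, mul_comm (∏ i ∈ Finset.range K, _)]

lemma ae_biInfinite_pointAt (hT : IsHomogeneousPoisson γ T P) (hγ : 0 < γ) :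
    ∀ᵐ ω ∂P, BiInfinite (pointAt (pointMeasure (T ω))) ∧
      pointAt (pointMeasure (T ω)) ∈ centred ∧ range (pointAt (pointMeasure (T ω))) = T ω := by
  filter_upwards [hT.ae_exists_biInfinite hγ] with ω ⟨t, ht, h0, hr⟩
  have : pointAt (pointMeasure (T ω)) = t := by rw [← hr, ht.pointAt_pointMeasure h0]
  rw [this]
  exact ⟨ht, h0, hr⟩

/-- The law of the points of a homogeneous Poisson process. -/
lemma map_pointAt (hT : IsHomogeneousPoisson γ T P) (hγ : 0 < γ) [IsProbabilityMeasure P] :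
    P.map (fun ω => pointAt (pointMeasure (T ω))) =
      (pointsLaw γ (Measure.infinitePi fun _ : ℤ => gammaMeasure 1 γ)).restrict centred := by
  have hp := isProbabilityMeasure_gammaMeasure one_pos hγ
  have mt : Measurable fun ω => pointAt (pointMeasure (T ω)) :=
    measurable_pointAt.comp hT.measurable
  have i1 : IsProbabilityMeasure (P.map fun ω => pointAt (pointMeasure (T ω))) :=
    Measure.isProbabilityMeasure_map mt.aemeasurable
  have i2 : IsProbabilityMeasure
      ((pointsLaw γ (Measure.infinitePi fun _ : ℤ => gammaMeasure 1 γ)).restrict centred) :=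
    ⟨by rw [Measure.restrict_apply_univ, pointsLaw_centred hγ]⟩
  have hstrict : ∀ t, BiInfinite t → t ∈ centred → t 0 ≠ 0 → t ∈ strictCentred :=
    fun t h1 h2 h3 => ⟨h1.strictMono, lt_of_le_of_ne h2.1 h3, h2.2⟩
  have hle : MeasurableSpace.generateFrom orderedBoxes ≤ MeasurableSpace.pi := by
    refine MeasurableSpace.generateFrom_le ?_
    rintro _ ⟨n, l, u, -, rfl⟩
    exact (isOpen_orderedBox n l u).measurableSet
  refine measure_ext_of_orderedBoxes ?_ ?_ fun n l u h => ?_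
  · refine (ae_map_iff mt.aemeasurable (hle _ measurableSet_strictCentred)).2 ?_
    filter_upwards [hT.ae_biInfinite_pointAt hγ, hT.ae_zero_notMem hγ] with ω ⟨h1, h2, h3⟩ h4
    exact hstrict _ h1 h2 fun h5 => h4 (h3 ▸ ⟨0, h5⟩)
  · filter_upwards [ae_restrict_of_ae (ae_pointsLaw_biInfinite hγ),
      ae_restrict_of_ae (ae_pointsLaw_ne_zero _), ae_restrict_mem measurableSet_centred] with
      t h1 h2 h3 using hstrict t h1 h3 h2
  · have hbm : MeasurableSet (orderedBox n l u) := (isOpen_orderedBox n l u).measurableSet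
    have hsub : orderedBox n l u ⊆ centred := fun t ht =>
      ⟨(ht 0 (by rw [Finset.mem_Icc]; omega)).2.le.trans h.left,
        h.right.trans_lt (ht 1 (by rw [Finset.mem_Icc]; omega)).1⟩
    rw [Measure.restrict_apply hbm, inter_eq_self_of_subset_left hsub, pointsLaw_orderedBox hγ n h,
      Measure.map_apply mt hbm]
    have hcount := hT.measure_box_counts hγ (2 * n) (l := fun i => l (i - n))
      (u := fun i => u (i - n)) (fun i => h.lt _) (fun i => by
        have := h.le (i - n)
        push_cast
        rwa [show (i : ℤ) - n + 1 = i + 1 - n by ring] at this)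
    push_cast at hcount
    rw [zero_sub, show 2 * (n : ℤ) + 1 - n = n + 1 by ring] at hcount
    rw [← hcount]
    refine measure_congr ?_
    filter_upwards [hT.ae_biInfinite_pointAt hγ] with ω ⟨h1, h2, h3⟩
    refine propext ?_
    change pointAt (pointMeasure (T ω)) ∈ orderedBox n l u ↔ _
    rw [h1.mem_orderedBox_iff h2 n h]
    set t := pointAt (pointMeasure (T ω)) with ht
    change _ ↔ (∀ i < 2 * n + 2, pointMeasure (T ω) (Ioo (l (i - n)) (u (i - n))) ∈
        (if i = 0 ∨ i = 2 * n + 1 then {0}ᶜ else {1} : Set ENNReal)) ∧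
      ∀ i < 2 * n + 1, pointMeasure (T ω) (Icc (u (i - n)) (l (i + 1 - n))) ∈ ({0} : Set ENNReal)
    rw [← h3]
    have c0 : ∀ k, pointMeasure (range t) (Ioo (l k) (u k)) ∈ ({0}ᶜ : Set ENNReal) ↔
        ∃ j, t j ∈ Ioo (l k) (u k) := fun k => by
      rw [mem_compl_iff, mem_singleton_iff, pointMeasure_range_eq_zero_iff t measurableSet_Ioo]
      push Not
      rfl
    have c1 : ∀ k, pointMeasure (range t) (Ioo (l k) (u k)) ∈ ({1} : Set ENNReal) ↔
        ∃! j, t j ∈ Ioo (l k) (u k) := fun k => by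
      rw [mem_singleton_iff, pointMeasure_range_eq_one_iff h1.strictMono measurableSet_Ioo]
    have c2 : ∀ k, pointMeasure (range t) (Icc (u k) (l (k + 1))) ∈ ({0} : Set ENNReal) ↔
        ∀ j, t j ∉ Icc (u k) (l (k + 1)) := fun k => by
      rw [mem_singleton_iff, pointMeasure_range_eq_zero_iff t measurableSet_Icc]
    constructor
    · rintro ⟨a1, a2, a3⟩
      refine ⟨fun i hi => ?_, fun i hi => ?_⟩
      · split_ifs with hi'
        · rw [c0]
          exact a1 _ (by omega) (by omega)
        · rw [c1]
          exact a2 _ (by omega) (by omega)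
      · have := (c2 (i - n)).2 (a3 _ (by omega) (by omega))
        rwa [show (i : ℤ) - n + 1 = i + 1 - n by ring] at this
    · rintro ⟨b1, b2⟩
      have b1' : ∀ k : ℤ, -n ≤ k → k ≤ n + 1 → pointMeasure (range t) (Ioo (l k) (u k)) ∈
          (if k = -n ∨ k = n + 1 then {0}ᶜ else {1} : Set ENNReal) := by
        intro k hk1 hk2
        have := b1 (k + n).toNat (by omega)
        rw [Int.toNat_of_nonneg (by omega), add_sub_cancel_right] at this
        convert this using 2
        constructor <;> rintro (h | h)
        · left; omega
        · right; omega
        · left; omega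
        · right; omega
      refine ⟨fun k hk1 hk2 => ?_, fun k hk1 hk2 => ?_, fun k hk1 hk2 => ?_⟩
      · have := b1' k hk1 hk2
        split_ifs at this
        · exact (c0 k).1 this
        · exact ((c1 k).1 this).exists
      · have := b1' k hk1.le hk2.le
        rw [if_neg (by omega)] at this
        exact (c1 k).1 this
      · have := b2 (k + n).toNat (by omega)
        rw [Int.toNat_of_nonneg (by omega), add_sub_cancel_right,
          show k + n + 1 - n = k + 1 by ring] at this
        exact (c2 k).1 this

end IsHomogeneousPoisson

/-! ### The divided Poisson process -/

/-- The Palm formula in its simplest form: restricting the initial point to a set of unit length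
leaves `γ` times the law of the gaps. -/
lemma lintegral_pointsLaw_intensity {γ : ℝ} {κ : Measure (ℤ → ℝ)} [SFinite κ]
    {H : (ℤ → ℝ) → ENNReal} (hH : Measurable H) :
    ∫⁻ t, (Ioc (0 : ℝ) 1).indicator 1 (t 0) * H (gapsOf t) ∂(pointsLaw γ κ) =
      ENNReal.ofReal γ * ∫⁻ τ, H τ ∂κ := by
  have m1 : Measurable ((Ioc (0 : ℝ) 1).indicator (1 : ℝ → ENNReal)) :=
    measurable_one.indicator measurableSet_Ioc
  rw [lintegral_pointsLaw (f := fun t => (Ioc (0 : ℝ) 1).indicator 1 (t 0) * H (gapsOf t))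
    ((m1.comp (measurable_pi_apply 0)).mul (hH.comp measurable_gapsOf))]
  congr 1
  refine lintegral_congr fun τ => ?_
  simp_rw [gapsOf_pointsOf, pointsOf_zero]
  rw [lintegral_mul_const _ m1, lintegral_indicator_one measurableSet_Ioc, Real.volume_Ioc]
  simp

/-- The counting measure forgets the labelling, and the enumeration recovered from it may be a
relabelling of `t`; a sum over all relabellings does not see the difference. -/
lemma BiInfinite.tsum_comp_pointAt {t : ℤ → ℝ} (ht : BiInfinite t) (g : (ℤ → ℝ) → ENNReal) :
    ∑' k : ℤ, g (fun j => pointAt (pointMeasure (range t)) (j + k)) =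
      ∑' k : ℤ, g (fun j => t (j + k)) := by
  obtain ⟨m, hm, -⟩ := ht.existsUnique_centred
  rw [← pointMeasure_range_comp_add t m, (ht.comp_add m).pointAt_pointMeasure hm,
    ← (Equiv.addRight m).tsum_eq fun k => g fun j => t (j + k)]
  simp [add_assoc]

lemma measurable_pointMeasure_range_divide :
    Measurable fun ω : (ℤ → ℝ) × (ℤ → ℝ) => pointMeasure (range (divide ω.1 ω.2)) :=
  measurable_pointMeasure_range.comp measurable_divide

lemma measurable_pointMeasure_range_fst :
    Measurable fun ω : (ℤ → ℝ) × (ℤ → ℝ) => pointMeasure (range ω.1) :=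
  measurable_pointMeasure_range.comp measurable_fst

section DividedProcess

variable {γ : ℝ} {G : Measure ℝ} [IsProbabilityMeasure G]

lemma map_divide_pointsLaw_prod {κ lam : Measure (ℤ → ℝ)} [SFinite κ] [SFinite lam] :
    ((pointsLaw γ κ).prod lam).map (fun ω => divide ω.1 ω.2) =
      pointsLaw γ ((κ.prod lam).map fun ω => exchange ω.2 ω.1) := by
  refine Measure.ext_of_lintegral _ fun f hf => ?_
  rw [lintegral_map hf measurable_divide, lintegral_divide_pointsLaw_prod hf]

lemma ae_forall_mem_Icc (hG : ∀ᵐ x ∂G, x ∈ Icc (0 : ℝ) 1) :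
    ∀ᵐ β ∂(Measure.infinitePi fun _ : ℤ => G), ∀ k, β k ∈ Icc (0 : ℝ) 1 :=
  ae_all_iff.2 fun k =>
    (measurePreserving_eval_infinitePi (fun _ : ℤ => G) k).quasiMeasurePreserving.ae hG

/-- Integrals of sums over all relabellings with respect to the law of the marked points of a
Poisson process. -/
lemma setLIntegral_tsum_relabel (hγ : 0 < γ) {g : (ℤ → ℝ) × (ℤ → ℝ) → ENNReal} (hg : Measurable g) :
    ∫⁻ ω in Prod.fst ⁻¹' centred, ∑' k, g (relabel k ω)
        ∂((pointsLaw γ (Measure.infinitePi fun _ : ℤ => gammaMeasure 1 γ)).prod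
          (Measure.infinitePi fun _ : ℤ => G)) =
      ∫⁻ ω, g ω ∂((pointsLaw γ (Measure.infinitePi fun _ : ℤ => gammaMeasure 1 γ)).prod
          (Measure.infinitePi fun _ : ℤ => G)) := by
  have hp := isProbabilityMeasure_gammaMeasure one_pos hγ
  refine setLIntegral_tsum_comp (fun k => measurePreserving_relabel
    (map_infinitePi_comp_add _) (map_infinitePi_comp_add _) k) relabel_relabel_neg
    (measurable_fst measurableSet_centred) ?_ hg
  filter_upwards [Measure.quasiMeasurePreserving_fst.ae (ae_pointsLaw_biInfinite hγ)] with ω hω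
  exact hω.tsum_indicator_centred

/-- If exchanging preserves the law of the gaps, then dividing the intervals preserves the law of
the Poisson process. -/
lemma map_pointMeasure_divide_of_map_exchange (hγ : 0 < γ)
    (h : ((Measure.infinitePi fun _ : ℤ => gammaMeasure 1 γ).prod
        (Measure.infinitePi fun _ : ℤ => G)).map (fun ω => exchange ω.2 ω.1) =
      Measure.infinitePi fun _ : ℤ => gammaMeasure 1 γ) :
    (((pointsLaw γ (Measure.infinitePi fun _ : ℤ => gammaMeasure 1 γ)).prod
      (Measure.infinitePi fun _ : ℤ => G)).restrict (Prod.fst ⁻¹' centred)).map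
        (fun ω => pointMeasure (range (divide ω.1 ω.2))) =
    (((pointsLaw γ (Measure.infinitePi fun _ : ℤ => gammaMeasure 1 γ)).prod
      (Measure.infinitePi fun _ : ℤ => G)).restrict (Prod.fst ⁻¹' centred)).map
        (fun ω => pointMeasure (range ω.1)) := by
  have hp := isProbabilityMeasure_gammaMeasure one_pos hγ
  set M := pointsLaw γ (Measure.infinitePi fun _ : ℤ => gammaMeasure 1 γ)
  have hdiv : (M.prod (Measure.infinitePi fun _ : ℤ => G)).map (fun ω => divide ω.1 ω.2) = M := by
    rw [map_divide_pointsLaw_prod, h]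
  have hbi : ∀ᵐ ω ∂(M.prod (Measure.infinitePi fun _ : ℤ => G)), BiInfinite (divide ω.1 ω.2) := by
    refine ae_of_ae_map (f := fun ω : (ℤ → ℝ) × (ℤ → ℝ) => divide ω.1 ω.2) (p := BiInfinite)
      measurable_divide.aemeasurable ?_
    rw [hdiv]
    exact ae_pointsLaw_biInfinite hγ
  refine Measure.ext_of_lintegral _ fun f hf => ?_
  set F : (ℤ → ℝ) → ENNReal := fun z => f (pointMeasure (range z)) with hF
  have mF : Measurable F := hf.comp measurable_pointMeasure_range
  have mFc : Measurable fun z => F z * centred.indicator 1 z :=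
    mF.mul (measurable_one.indicator measurableSet_centred)
  rw [lintegral_map hf measurable_pointMeasure_range_divide,
    lintegral_map hf measurable_pointMeasure_range_fst]
  -- The divided sequence need not be centred when the original is. Inserting the sum of its
  -- `centred` indicators, which is 1, and unfolding exchanges one fundamental domain for the other,
  -- since `F` ignores labels.
  calc ∫⁻ ω in Prod.fst ⁻¹' centred, F (divide ω.1 ω.2) ∂(M.prod _)
      = ∫⁻ ω in Prod.fst ⁻¹' centred, ∑' k, (F (divide (relabel k ω).1 (relabel k ω).2) *
          centred.indicator 1 (divide (relabel k ω).1 (relabel k ω).2)) ∂(M.prod _) := by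
        refine lintegral_congr_ae (ae_restrict_of_ae ?_)
        filter_upwards [hbi] with ω hω
        simp only [divide_relabel, hF, pointMeasure_range_comp_add (divide ω.1 ω.2)]
        rw [ENNReal.tsum_mul_left, hω.tsum_indicator_centred, mul_one]
    _ = ∫⁻ ω, F (divide ω.1 ω.2) * centred.indicator 1 (divide ω.1 ω.2) ∂(M.prod _) :=
        setLIntegral_tsum_relabel hγ (g := fun ω => F (divide ω.1 ω.2) *
          centred.indicator 1 (divide ω.1 ω.2)) (mFc.comp measurable_divide)
    _ = ∫⁻ t, F t * centred.indicator 1 t ∂M := by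
        conv_rhs => rw [← hdiv]
        rw [lintegral_map mFc measurable_divide]
    _ = ∫⁻ ω, F ω.1 * centred.indicator 1 ω.1
          ∂(M.prod (Measure.infinitePi fun _ : ℤ => G)) := by
        exact (measurePreserving_fst.lintegral_comp mFc).symm
    _ = ∫⁻ ω in Prod.fst ⁻¹' centred, F ω.1 ∂(M.prod (Measure.infinitePi fun _ : ℤ => G)) := by
        rw [← lintegral_indicator (measurable_fst measurableSet_centred)]
        refine lintegral_congr fun ω => ?_
        by_cases hω : ω.1 ∈ centred
        · rw [indicator_of_mem hω, indicator_of_mem (s := Prod.fst ⁻¹' centred) hω]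
          simp
        · rw [indicator_of_notMem hω, indicator_of_notMem (s := Prod.fst ⁻¹' centred) hω]
          simp

/-- If the divided Poisson process has the intensity of the original one, then no two of its
points coincide. -/
lemma ae_strictMono_divide (hγ : 0 < γ) (hG : ∀ᵐ x ∂G, x ∈ Icc (0 : ℝ) 1)
    (h : (((pointsLaw γ (Measure.infinitePi fun _ : ℤ => gammaMeasure 1 γ)).prod
      (Measure.infinitePi fun _ : ℤ => G)).restrict (Prod.fst ⁻¹' centred)).map
        (fun ω => pointMeasure (range (divide ω.1 ω.2))) =
    (((pointsLaw γ (Measure.infinitePi fun _ : ℤ => gammaMeasure 1 γ)).prod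
      (Measure.infinitePi fun _ : ℤ => G)).restrict (Prod.fst ⁻¹' centred)).map
        (fun ω => pointMeasure (range ω.1))) :
    ∀ᵐ ω ∂((pointsLaw γ (Measure.infinitePi fun _ : ℤ => gammaMeasure 1 γ)).prod
      (Measure.infinitePi fun _ : ℤ => G)), StrictMono (divide ω.1 ω.2) := by
  have hp := isProbabilityMeasure_gammaMeasure one_pos hγ
  set E := Measure.infinitePi fun _ : ℤ => gammaMeasure 1 γ
  set L := Measure.infinitePi fun _ : ℤ => G
  set κ := (E.prod L).map fun ω => exchange ω.2 ω.1 with hκ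
  have iκ : IsProbabilityMeasure κ :=
    Measure.isProbabilityMeasure_map measurable_exchange.aemeasurable
  have hbi : ∀ᵐ ω ∂((pointsLaw γ E).prod L), BiInfinite ω.1 :=
    Measure.quasiMeasurePreserving_fst.ae (ae_pointsLaw_biInfinite hγ)
  have hβ : ∀ᵐ ω ∂((pointsLaw γ E).prod L), ∀ k, ω.2 k ∈ Icc (0 : ℝ) 1 :=
    Measure.quasiMeasurePreserving_snd.ae (ae_forall_mem_Icc hG)
  have mN : Measurable fun N : Measure ℝ => N (Ioc 0 1) := Measure.measurable_coe measurableSet_Ioc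
  -- Equality of laws is used only through the mean number of points in `(0, 1]`.
  have hint : ∫⁻ ω in Prod.fst ⁻¹' centred, pointMeasure (range (divide ω.1 ω.2)) (Ioc 0 1)
      ∂((pointsLaw γ E).prod L) =
      ∫⁻ ω in Prod.fst ⁻¹' centred, pointMeasure (range ω.1) (Ioc 0 1)
        ∂((pointsLaw γ E).prod L) := by
    rw [← lintegral_map mN measurable_pointMeasure_range_divide, h,
      lintegral_map mN measurable_pointMeasure_range_fst]
  have mI : Measurable ((Ioc (0 : ℝ) 1).indicator (1 : ℝ → ENNReal)) :=
    measurable_one.indicator measurableSet_Ioc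
  have hpos : MeasurableSet {τ : ℤ → ℝ | 0 < τ 0} :=
    measurableSet_lt measurable_const (measurable_pi_apply 0)
  set H : (ℤ → ℝ) → ENNReal := {τ : ℤ → ℝ | 0 < τ 0}.indicator 1 with hH
  have mH : Measurable H := measurable_one.indicator hpos
  set g : (ℤ → ℝ) → ENNReal := fun t => (Ioc (0 : ℝ) 1).indicator 1 (t 0) * H (gapsOf t) with hg
  have mg : Measurable g := (mI.comp (measurable_pi_apply 0)).mul (mH.comp measurable_gapsOf)
  have hright : ∫⁻ ω in Prod.fst ⁻¹' centred, pointMeasure (range ω.1) (Ioc 0 1)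
      ∂((pointsLaw γ E).prod L) = ENNReal.ofReal γ := by
    have : ∫⁻ ω in Prod.fst ⁻¹' centred, pointMeasure (range ω.1) (Ioc 0 1)
        ∂((pointsLaw γ E).prod L) = ∫⁻ ω in Prod.fst ⁻¹' centred,
        ∑' k, (Ioc (0 : ℝ) 1).indicator 1 ((relabel k ω).1 0) ∂((pointsLaw γ E).prod L) := by
      refine lintegral_congr_ae (ae_restrict_of_ae ?_)
      filter_upwards [hbi] with ω hω
      have himg : range ω.1 ∩ Ioc 0 1 = ω.1 '' {k | ω.1 k ∈ Ioc (0 : ℝ) 1} := by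
        rw [inter_comm, ← image_preimage_eq_inter_range]; rfl
      rw [pointMeasure_range_apply _ measurableSet_Ioc, himg,
        hω.strictMono.injective.encard_image, encard_eq_tsum_indicator]
      refine tsum_congr fun k => ?_
      simp only [relabel, zero_add]
      rfl
    have h1 := lintegral_pointsLaw_intensity (γ := γ) (κ := E) (H := 1) measurable_one
    simp only [Pi.one_apply, mul_one, lintegral_const, measure_univ] at h1
    rw [this]
    refine (setLIntegral_tsum_relabel hγ (g := fun ω => (Ioc (0 : ℝ) 1).indicator 1 (ω.1 0))
      (mI.comp ((measurable_pi_apply 0).comp measurable_fst))).trans ?_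
    rw [← h1]
    have m0 : Measurable fun t : ℤ → ℝ => (Ioc (0 : ℝ) 1).indicator (1 : ℝ → ENNReal) (t 0) :=
      mI.comp (measurable_pi_apply 0)
    exact measurePreserving_fst.lintegral_comp m0
  have hleft : ∫⁻ ω in Prod.fst ⁻¹' centred, pointMeasure (range (divide ω.1 ω.2)) (Ioc 0 1)
      ∂((pointsLaw γ E).prod L) ≤ ENNReal.ofReal γ * κ {τ | 0 < τ 0} := by
    calc _ ≤ ∫⁻ ω in Prod.fst ⁻¹' centred, ∑' k, g (divide (relabel k ω).1 (relabel k ω).2)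
          ∂((pointsLaw γ E).prod L) := by
          refine lintegral_mono_ae (ae_restrict_of_ae ?_)
          filter_upwards [hbi, hβ] with ω h1 h2
          -- Coinciding division points are counted once, at the last index of their block, where
          -- the next gap is positive.
          refine (pointMeasure_range_le_tsum (h1.monotone_divide h2) (h1.exists_lt_divide h2)
            measurableSet_Ioc).trans (ENNReal.tsum_le_tsum fun k => ?_)
          rw [divide_relabel]
          refine indicator_apply_le' (fun hj => ?_) fun _ => zero_le
          have e1 : (Ioc (0 : ℝ) 1).indicator (1 : ℝ → ENNReal) (divide ω.1 ω.2 (0 + k)) = 1 := by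
            rw [zero_add, indicator_of_mem hj.2]; rfl
          have e2 : H (gapsOf fun i => divide ω.1 ω.2 (i + k)) = 1 := by
            rw [hH, indicator_of_mem]
            · rfl
            · change 0 < divide ω.1 ω.2 (0 + 1 + k) - divide ω.1 ω.2 (0 + k)
              rw [zero_add, zero_add, add_comm 1 k]
              exact sub_pos.2 hj.1
          simp only [hg]
          rw [e1, e2, Pi.one_apply, one_mul]
      _ = ∫⁻ ω, g (divide ω.1 ω.2) ∂((pointsLaw γ E).prod L) :=
          setLIntegral_tsum_relabel hγ (g := fun ω => g (divide ω.1 ω.2)) (mg.comp measurable_divide)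
      _ = ENNReal.ofReal γ * κ {τ | 0 < τ 0} := by
          rw [lintegral_divide_pointsLaw_prod mg, hg, lintegral_pointsLaw_intensity mH, hH,
            lintegral_indicator_one hpos]
  -- The two means give `γ ≤ γ κ {τ | 0 < τ 0}`, so the exchanged gap with index 0 is almost surely
  -- positive; relabelling extends this to all gaps.
  have hκ1 : κ {τ | 0 < τ 0} = 1 := by
    refine le_antisymm prob_le_one ?_
    rw [hint, hright] at hleft
    have hne : ENNReal.ofReal γ ≠ 0 := by simpa using hγ
    exact (ENNReal.mul_le_mul_iff_right hne ENNReal.ofReal_ne_top).1 (by rwa [mul_one])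
  have hstep : ∀ᵐ ω ∂((pointsLaw γ E).prod L), divide ω.1 ω.2 0 < divide ω.1 ω.2 1 := by
    have h0 : ∀ᵐ τ ∂κ, 0 < τ 0 := (prob_compl_eq_zero_iff hpos).2 hκ1
    have h1 : ∀ᵐ t ∂(pointsLaw γ κ), t 0 < t 1 := by
      have hm : MeasurableSet {t : ℤ → ℝ | t 0 < t 1} :=
        measurableSet_lt (measurable_pi_apply 0) (measurable_pi_apply 1)
      rw [pointsLaw, ae_map_iff measurable_pointsOf.aemeasurable hm]
      filter_upwards [(Measure.quasiMeasurePreserving_snd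
        (μ := ENNReal.ofReal γ • (volume : Measure ℝ))).ae h0] with p hp
      have := pointsOf_add_one p.1 p.2 0
      rw [zero_add] at this
      rw [this]
      linarith
    rw [hκ, ← map_divide_pointsLaw_prod] at h1
    exact ae_of_ae_map measurable_divide.aemeasurable h1
  have hall : ∀ᵐ ω ∂((pointsLaw γ E).prod L), ∀ k : ℤ,
      divide ω.1 ω.2 k < divide ω.1 ω.2 (k + 1) := by
    refine ae_all_iff.2 fun k => ?_
    have := (measurePreserving_relabel (γ := γ) (map_infinitePi_comp_add (gammaMeasure 1 γ))
      (map_infinitePi_comp_add G) k).quasiMeasurePreserving.ae hstep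
    filter_upwards [this] with ω hω
    rw [divide_relabel] at hω
    simp only [zero_add, add_comm 1 k] at hω
    exact hω
  filter_upwards [hall] with ω hω using strictMono_int_of_lt_succ hω

/-- If dividing the intervals preserves the law of the Poisson process, then exchanging preserves
the law of the gaps. -/
lemma map_exchange_of_map_pointMeasure_divide (hγ : 0 < γ) (hG : ∀ᵐ x ∂G, x ∈ Icc (0 : ℝ) 1)
    (h : (((pointsLaw γ (Measure.infinitePi fun _ : ℤ => gammaMeasure 1 γ)).prod
      (Measure.infinitePi fun _ : ℤ => G)).restrict (Prod.fst ⁻¹' centred)).map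
        (fun ω => pointMeasure (range (divide ω.1 ω.2))) =
    (((pointsLaw γ (Measure.infinitePi fun _ : ℤ => gammaMeasure 1 γ)).prod
      (Measure.infinitePi fun _ : ℤ => G)).restrict (Prod.fst ⁻¹' centred)).map
        (fun ω => pointMeasure (range ω.1))) :
    ((Measure.infinitePi fun _ : ℤ => gammaMeasure 1 γ).prod
        (Measure.infinitePi fun _ : ℤ => G)).map (fun ω => exchange ω.2 ω.1) =
      Measure.infinitePi fun _ : ℤ => gammaMeasure 1 γ := by
  have hp := isProbabilityMeasure_gammaMeasure one_pos hγ
  have hstrict := ae_strictMono_divide hγ hG h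
  set E := Measure.infinitePi fun _ : ℤ => gammaMeasure 1 γ
  set L := Measure.infinitePi fun _ : ℤ => G
  have hbi : ∀ᵐ ω ∂((pointsLaw γ E).prod L), BiInfinite ω.1 :=
    Measure.quasiMeasurePreserving_fst.ae (ae_pointsLaw_biInfinite hγ)
  have hβ : ∀ᵐ ω ∂((pointsLaw γ E).prod L), ∀ k, ω.2 k ∈ Icc (0 : ℝ) 1 :=
    Measure.quasiMeasurePreserving_snd.ae (ae_forall_mem_Icc hG)
  have mI : Measurable ((Ioc (0 : ℝ) 1).indicator (1 : ℝ → ENNReal)) :=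
    measurable_one.indicator measurableSet_Ioc
  refine Measure.ext_of_lintegral _ fun H mH => ?_
  set g : (ℤ → ℝ) → ENNReal := fun t => (Ioc (0 : ℝ) 1).indicator 1 (t 0) * H (gapsOf t)
  have mg : Measurable g := (mI.comp (measurable_pi_apply 0)).mul (mH.comp measurable_gapsOf)
  -- This functional of the counting measure sums, over its points in `(0, 1]`, the value of `H` on
  -- the gaps seen from the point. Its expectation is `γ` times the integral of `H` against the gap
  -- law, for both processes.
  have mA : Measurable fun N : Measure ℝ => ∑' k : ℤ, g fun j => pointAt N (j + k) := by
    refine Measurable.tsum fun k => ?_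
    have mk : Measurable fun (N : Measure ℝ) (j : ℤ) => pointAt N (j + k) :=
      measurable_pi_lambda _ fun j => (measurable_pi_apply (j + k)).comp measurable_pointAt
    exact mg.comp mk
  have hleft : ∫⁻ N, ∑' k : ℤ, g (fun j => pointAt N (j + k))
      ∂(((pointsLaw γ E).prod L).restrict (Prod.fst ⁻¹' centred)).map
        (fun ω => pointMeasure (range (divide ω.1 ω.2))) =
      ENNReal.ofReal γ * ∫⁻ τ, H τ ∂((E.prod L).map fun ω => exchange ω.2 ω.1) := by
    rw [← lintegral_pointsLaw_intensity mH, ← map_divide_pointsLaw_prod,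
      lintegral_map mA measurable_pointMeasure_range_divide,
      lintegral_map mg measurable_divide]
    refine Eq.trans (lintegral_congr_ae (ae_restrict_of_ae ?_)) (setLIntegral_tsum_relabel hγ
      (g := fun ω => g (divide ω.1 ω.2)) (mg.comp measurable_divide))
    filter_upwards [hbi, hβ, hstrict] with ω h1 h2 h3
    simp only [divide_relabel]
    -- Strict monotonicity is needed here: if division points merged, the labelled sequence could
    -- not be recovered from the counting measure.
    exact (h1.divide_of_strictMono h2 h3).tsum_comp_pointAt g
  have hright : ∫⁻ N, ∑' k : ℤ, g (fun j => pointAt N (j + k))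
      ∂(((pointsLaw γ E).prod L).restrict (Prod.fst ⁻¹' centred)).map
        (fun ω => pointMeasure (range ω.1)) = ENNReal.ofReal γ * ∫⁻ τ, H τ ∂E := by
    have hfst : ∫⁻ ω, g ω.1 ∂((pointsLaw γ E).prod L) = ∫⁻ t, g t ∂(pointsLaw γ E) :=
      measurePreserving_fst.lintegral_comp mg
    rw [← lintegral_pointsLaw_intensity mH, ← hfst,
      lintegral_map mA measurable_pointMeasure_range_fst]
    refine Eq.trans (lintegral_congr_ae (ae_restrict_of_ae ?_)) (setLIntegral_tsum_relabel hγ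
      (g := fun ω => g ω.1) (mg.comp measurable_fst))
    filter_upwards [hbi] with ω h1
    exact h1.tsum_comp_pointAt g
  rw [h, hright] at hleft
  have hne : ENNReal.ofReal γ ≠ 0 := by simpa using hγ
  exact ((ENNReal.mul_right_inj hne ENNReal.ofReal_ne_top).1 hleft).symm

end DividedProcess

/-! ### Passage from random variables to laws of sequences, and the theorem -/

lemma map_fun_eq_infinitePi_of_hasLaw {Ω : Type*} [MeasurableSpace Ω] {P : Measure Ω}
    {μ : Measure ℝ} {X : ℤ → Ω → ℝ} (hX : ∀ k, HasLaw (X k) μ P) (hi : iIndepFun X P) :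
    P.map (fun ω k => X k ω) = Measure.infinitePi fun _ : ℤ => μ := by
  rw [hi.map_fun_eq_infinitePi_map₀' fun k => (hX k).aemeasurable]
  simp_rw [fun k => (hX k).map_eq]

/-- The process of division points of a homogeneous Poisson process has the same law as the
process itself if and only if exchanging preserves the law of the gaps. -/
lemma IsHomogeneousPoisson.identDistrib_neighbourShift_iff {Ω : Type*} [MeasurableSpace Ω]
    {P : Measure Ω} [IsProbabilityMeasure P] {γ : ℝ} (hγ : 0 < γ) {G : Measure ℝ}
    [IsProbabilityMeasure G] (hG : ∀ᵐ x ∂G, x ∈ Icc (0 : ℝ) 1) {T : Ω → Set ℝ} {b : ℤ → Ω → ℝ}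
    (hT : IsHomogeneousPoisson γ T P) (hb : ∀ k, HasLaw (b k) G P) (hbi : iIndepFun b P)
    (hbT : IndepFun (fun ω k => b k ω) (fun ω => pointMeasure (T ω)) P) :
    IdentDistrib (fun ω => pointMeasure (neighbourShift (fun k => b k ω) (T ω)))
        (fun ω => pointMeasure (T ω)) P P ↔
      ((Measure.infinitePi fun _ : ℤ => gammaMeasure 1 γ).prod
        (Measure.infinitePi fun _ : ℤ => G)).map (fun ω => exchange ω.2 ω.1) =
      Measure.infinitePi fun _ : ℤ => gammaMeasure 1 γ := by
  have hp := isProbabilityMeasure_gammaMeasure one_pos hγ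
  have mb : AEMeasurable (fun ω k => b k ω) P :=
    aemeasurable_pi_iff.2 fun k => (hb k).aemeasurable
  have mt : Measurable fun ω => pointAt (pointMeasure (T ω)) :=
    measurable_pointAt.comp hT.measurable
  have mjoint : AEMeasurable (fun ω => (pointAt (pointMeasure (T ω)), fun k => b k ω)) P :=
    mt.aemeasurable.prodMk mb
  -- The marks are independent of the counting measure, hence of the enumerated points, so points
  -- and marks have a product law; restricting the first factor to `centred` restricts the product.
  have hjoint : P.map (fun ω => (pointAt (pointMeasure (T ω)), fun k => b k ω)) =
      ((pointsLaw γ (Measure.infinitePi fun _ : ℤ => gammaMeasure 1 γ)).prod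
        (Measure.infinitePi fun _ : ℤ => G)).restrict (Prod.fst ⁻¹' centred) := by
    have hi : IndepFun (fun ω => pointAt (pointMeasure (T ω))) (fun ω k => b k ω) P :=
      hbT.symm.comp measurable_pointAt measurable_id
    rw [(indepFun_iff_map_prod_eq_prod_map_map mt.aemeasurable mb).1 hi, hT.map_pointAt hγ,
      map_fun_eq_infinitePi_of_hasLaw hb hbi, ← prod_univ, ← Measure.prod_restrict,
      Measure.restrict_univ]
  -- Almost surely `T ω` is the range of its centred enumeration, on which the shift is the division
  -- map.
  have hshift : (fun ω => pointMeasure (neighbourShift (fun k => b k ω) (T ω))) =ᵐ[P]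
      (fun ω => pointMeasure (range (divide ω.1 ω.2))) ∘
        fun ω => (pointAt (pointMeasure (T ω)), fun k => b k ω) := by
    filter_upwards [hT.ae_biInfinite_pointAt hγ] with ω ⟨h1, h2, h3⟩
    conv_lhs => rw [← h3]
    rw [h1.neighbourShift_range h2]
    rfl
  have hself : (fun ω => pointMeasure (T ω)) =ᵐ[P] (fun ω => pointMeasure (range ω.1)) ∘
        fun ω => (pointAt (pointMeasure (T ω)), fun k => b k ω) := by
    filter_upwards [hT.ae_biInfinite_pointAt hγ] with ω ⟨_, _, h3⟩
    simp only [Function.comp, h3]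
  have hmap1 : P.map (fun ω => pointMeasure (neighbourShift (fun k => b k ω) (T ω))) =
      (((pointsLaw γ (Measure.infinitePi fun _ : ℤ => gammaMeasure 1 γ)).prod
        (Measure.infinitePi fun _ : ℤ => G)).restrict (Prod.fst ⁻¹' centred)).map
          (fun ω => pointMeasure (range (divide ω.1 ω.2))) := by
    rw [Measure.map_congr hshift, ← hjoint,
      AEMeasurable.map_map_of_aemeasurable measurable_pointMeasure_range_divide.aemeasurable mjoint]
  have hmap2 : P.map (fun ω => pointMeasure (T ω)) =
      (((pointsLaw γ (Measure.infinitePi fun _ : ℤ => gammaMeasure 1 γ)).prod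
        (Measure.infinitePi fun _ : ℤ => G)).restrict (Prod.fst ⁻¹' centred)).map
          (fun ω => pointMeasure (range ω.1)) := by
    rw [Measure.map_congr hself, ← hjoint,
      AEMeasurable.map_map_of_aemeasurable measurable_pointMeasure_range_fst.aemeasurable mjoint]
  constructor
  · intro h
    have := h.map_eq
    rw [hmap1, hmap2] at this
    exact map_exchange_of_map_pointMeasure_divide hγ hG this
  · intro h
    refine ⟨(measurable_pointMeasure_range_divide.comp_aemeasurable mjoint).congr hshift.symm, hT.measurable.aemeasurable, ?_⟩
    rw [hmap1, hmap2]
    exact map_pointMeasure_divide_of_map_exchange hγ h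

lemma identDistrib_exchange_iff {Ω : Type*} [MeasurableSpace Ω] {P : Measure Ω}
    [IsProbabilityMeasure P] {ε G : Measure ℝ} {τ b : ℤ → Ω → ℝ}
    (hτ : ∀ k, HasLaw (τ k) ε P) (hτi : iIndepFun τ P) (hb : ∀ k, HasLaw (b k) G P)
    (hbi : iIndepFun b P) (hbτ : IndepFun (fun ω k => b k ω) (fun ω k => τ k ω) P) :
    IdentDistrib (fun ω => exchange (fun k => b k ω) (fun k => τ k ω)) (fun ω k => τ k ω) P P ↔
      ((Measure.infinitePi fun _ : ℤ => ε).prod (Measure.infinitePi fun _ : ℤ => G)).map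
        (fun ω => exchange ω.2 ω.1) = Measure.infinitePi fun _ : ℤ => ε := by
  have mb : AEMeasurable (fun ω k => b k ω) P :=
    aemeasurable_pi_iff.2 fun k => (hb k).aemeasurable
  have mτ : AEMeasurable (fun ω k => τ k ω) P :=
    aemeasurable_pi_iff.2 fun k => (hτ k).aemeasurable
  have hmap : P.map (fun ω => exchange (fun k => b k ω) (fun k => τ k ω)) =
      ((Measure.infinitePi fun _ : ℤ => ε).prod (Measure.infinitePi fun _ : ℤ => G)).map
        (fun ω => exchange ω.2 ω.1) := by
    rw [← map_fun_eq_infinitePi_of_hasLaw hτ hτi, ← map_fun_eq_infinitePi_of_hasLaw hb hbi,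
      ← (indepFun_iff_map_prod_eq_prod_map_map mτ mb).1 hbτ.symm,
      AEMeasurable.map_map_of_aemeasurable measurable_exchange.aemeasurable (mτ.prodMk mb)]
    rfl
  rw [← hmap, ← map_fun_eq_infinitePi_of_hasLaw hτ hτi]
  exact ⟨fun h => h.map_eq,
    fun h => ⟨measurable_exchange.comp_aemeasurable (mτ.prodMk mb), mτ, h⟩⟩

theorem mainTheorem5 (γ : ℝ) (hγ : 0 < γ)
    (G : Measure ℝ) [IsProbabilityMeasure G] (hG : ∀ᵐ x ∂G, x ∈ Icc (0 : ℝ) 1) :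
    -- the point process itself
    (∀ {Ω : Type*} [MeasurableSpace Ω] (P : Measure Ω) [IsProbabilityMeasure P]
      (T : Ω → Set ℝ) (b : ℤ → Ω → ℝ),
      IsHomogeneousPoisson γ T P →
      (∀ k, HasLaw (b k) G P) → iIndepFun b P →
      IndepFun (fun ω k => b k ω) (fun ω => pointMeasure (T ω)) P →
      (IdentDistrib (fun ω => pointMeasure (neighbourShift (fun k => b k ω) (T ω)))
          (fun ω => pointMeasure (T ω)) P P ↔
        G = Measure.dirac 0 ∨ G = Measure.dirac 1 ∨
          ∃ r ∈ Ioo (0 : ℝ) 1, G = betaMeasure r (1 - r))) ∧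
    -- the sequence of its interpoint distances under the Palm distribution
    (∀ {Ω : Type*} [MeasurableSpace Ω] (P : Measure Ω) [IsProbabilityMeasure P]
      (τ b : ℤ → Ω → ℝ),
      (∀ k, HasLaw (τ k) (gammaMeasure 1 γ) P) → iIndepFun τ P →
      (∀ k, HasLaw (b k) G P) → iIndepFun b P →
      IndepFun (fun ω k => b k ω) (fun ω k => τ k ω) P →
      (IdentDistrib (fun ω => exchange (fun k => b k ω) (fun k => τ k ω))
          (fun ω k => τ k ω) P P ↔
        G = Measure.dirac 0 ∨ G = Measure.dirac 1 ∨
          ∃ r ∈ Ioo (0 : ℝ) 1, G = betaMeasure r (1 - r))) := by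
  refine ⟨fun P _ T b hT hb hbi hbT => ?_, fun P _ τ b hτ hτi hb hbi hbτ => ?_⟩
  · rw [hT.identDistrib_neighbourShift_iff hγ hG hb hbi hbT]
    exact map_exchange_iff hγ hG
  · rw [identDistrib_exchange_iff hτ hτi hb hbi hbτ]
    exact map_exchange_iff hγ hG
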